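/- Let $(M,g)$ be a nonempty compact smooth Riemannian manifold without boundary of dimension $6$; $\nabla$, $\Delta=\nabla\cdot\nabla$, $|\cdot|$ and integrals over $M$ refer to $g$ and its volume measure. Let $\alpha,\beta\in\mathbb R$, let $R,T$ be real functions on $M$ and let $F_1,F_3,F_5$ be differential forms on $M$ of degrees $1,3,5$. For functions $v,u>0$ on $M$ (conformal factor and warp factor) consider the system $$10uv\,\Delta v+6\nabla\cdot(v^2\nabla u)-2uv^2R+u\big(v^2|F_1|^2+|F_3|^2+v^{-2}|F_5|^2\big)-2uT=2\alpha v^3,$$ $$5\Delta(u^2v)+5u^2\Delta v-2u^2vR-6v|\nabla u|^2+u^2\big(v|F_1|^2-v^{-3}|F_5|^2\big)=6(\alpha uv^2+\beta v^2),\qquad (\ast)$$ and the effective potential (with $G_N$ a constant) $$V_{eff}(v,u)=\tfrac12\int_M\Big(-u^2v^2R-5\nabla v\cdot\nabla(u^2v)-3v^2|\nabla u|^2+\tfrac{u^2}{2}\big(v^2|F_1|^2+|F_3|^2+v^{-2}|F_5|^2\big)-u^2T\Big)+\alpha\Big(\tfrac1{G_N}-\int_M uv^3\Big)+\beta\Big(\mathrm{Vol}(M)-\int_M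 v^3\Big).$$ A solution $(v,u)$ of $(\ast)$ is called stable if $\frac{\partial^2V_{eff}}{\partial v^2}:=\frac{d^2}{dt^2}\big|_{t=0}V_{eff}(v+t,u)>0$. In $(\ast)$, $R,F_1,F_3,T$ enter only through $a=2R-|F_1|^2$ and $b=|F_3|^2-2T$, which are treated as unknown functions ($R$ is not required to be the scalar curvature of $g$). Then, for every sufficiently large real number $s$ the following holds. For every $\varepsilon>0$ there are $\alpha\in(0,\varepsilon)$ and $\beta\in(-\varepsilon,0)$ such that, for all $5$-forms $F_5$ in some neighbourhood of $0$ in $H^s$ and all pairs $(v,u)$ in some neighbourhood of $(1,1)$ in $H^s(M)\times H^s(M)$, there are functions $a,b\in H^{s-2}(M)$ with the following property: for all $R,T,F_1,F_3$, the pair $(v,u)$ is a classical ($C^2$, positive) solution of $(\ast)$ with the data $\alpha,\beta,F_5,R,T,F_1,F_3$ if and only if $2R-|F_1|^2=a$ and $|F_3|^2-2T=b$; and whenever this is the case, this solution is stable. -/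

import Mathlib

open Set Filter Topology MeasureTheory
open scoped Manifold ContDiff FourierTransform

noncomputable section

namespace Warped

/-- The model space of the six-dimensional internal manifold. -/
abbrev E6 : Type := EuclideanSpace ℝ (Fin 6)

/-! ### Sobolev spaces -/

/-- The `H^s(ℝ⁶)` norm `(∫ (1 + |ξ|²)^s |ĥ(ξ)|² dξ)^{1/2}` (possibly `∞`) of an integrable
function `h`. -/
def hsNorm (s : ℝ) (h : E6 → ℝ) : ENNReal :=
  (∫⁻ ξ : E6, ENNReal.ofReal ((1 + ‖ξ‖ ^ 2) ^ s) * ‖𝓕 (fun y : E6 => (h y : ℂ)) ξ‖ₑ ^ 2)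
    ^ (1 / 2 : ℝ)

section Manifold

variable {M : Type*} [TopologicalSpace M] [ChartedSpace E6 M]

/-- The smooth cutoff functions supported in the domain of the chart `φ`. -/
def Cutoff (φ : OpenPartialHomeomorph M E6) : Set (M → ℝ) :=
  {χ | ContMDiff (𝓡 6) 𝓘(ℝ, ℝ) ∞ χ ∧ tsupport χ ⊆ φ.source}

/-- The `H^s` norm of a function `h` given in the coordinates of the chart `φ` (so `h` matters
only on `φ.target`), localized by the cutoff `χ` and extended by zero to `ℝ⁶`. -/
def locNorm (s : ℝ) (φ : OpenPartialHomeomorph M E6) (χ : M → ℝ) (h : E6 → ℝ) : ENNReal :=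
  hsNorm s (φ.target.indicator fun y => χ (φ.symm y) * h y)

/-- `f ∈ H^s(M)`. This is used only for large `s` (larger than half the dimension), where every
class in `H^s` has exactly one continuous representative; `f` is that representative. -/
def MemHs (s : ℝ) (f : M → ℝ) : Prop :=
  Continuous f ∧ ∀ φ ∈ atlas E6 M, ∀ χ ∈ Cutoff φ, locNorm s φ χ (fun y => f (φ.symm y)) < ⊤

/-- The filter of neighbourhoods of `f₀` in `H^s(M)`: its basic members are cut out, within
`H^s(M)`, by finitely many conditions `‖χ (f - f₀)‖_{H^s} < ε`. -/
def hsNhds (s : ℝ) (f₀ : M → ℝ) : Filter (M → ℝ) :=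
  (⨅ φ ∈ atlas E6 M, ⨅ χ ∈ Cutoff φ, ⨅ ε ∈ {ε : ENNReal | 0 < ε},
    𝓟 {f | locNorm s φ χ (fun y => f (φ.symm y) - f₀ (φ.symm y)) < ε}) ⊓ 𝓟 {f | MemHs s f}

/-! ### Coordinates and differential forms -/

/-- The coordinate vector `∂_i` of the chart `φ`, at the point with coordinates `y`. -/
def coordVec (φ : OpenPartialHomeomorph M E6) (y : E6) (i : Fin 6) :
    TangentSpace (𝓡 6) (φ.symm y) :=
  mfderiv 𝓘(ℝ, E6) (𝓡 6) φ.symm y (EuclideanSpace.single i (1 : ℝ))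

variable (M) in
/-- Differential `p`-forms on `M` (no regularity). -/
abbrev Form (p : ℕ) : Type _ := ∀ x : M, (TangentSpace (𝓡 6) x) [⋀^Fin p]→ₗ[ℝ] ℝ

/-- The component `F_{i₁ … i_p}` of a form in the chart `φ`. -/
def Form.comp {p : ℕ} (F : Form M p) (φ : OpenPartialHomeomorph M E6) (i : Fin p → Fin 6)
    (y : E6) : ℝ :=
  F (φ.symm y) fun k => coordVec φ y (i k)

/-- `F` is a `p`-form of class `H^s` (continuous representative, as for functions). -/
def Form.MemHs {p : ℕ} (s : ℝ) (F : Form M p) : Prop :=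
  ∀ φ ∈ atlas E6 M, ∀ i : Fin p → Fin 6,
    ContinuousOn (F.comp φ i) φ.target ∧ ∀ χ ∈ Cutoff φ, locNorm s φ χ (F.comp φ i) < ⊤

variable (M) in
/-- The filter of neighbourhoods of `0` in the space of `p`-forms of class `H^s`. -/
def formNhdsZero (p : ℕ) (s : ℝ) : Filter (Form M p) :=
  (⨅ φ ∈ atlas E6 M, ⨅ χ ∈ Cutoff φ, ⨅ i : Fin p → Fin 6, ⨅ ε ∈ {ε : ENNReal | 0 < ε},
    𝓟 {F : Form M p | locNorm s φ χ (F.comp φ i) < ε}) ⊓ 𝓟 {F | F.MemHs s}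

/-! ### Riemannian geometry -/

variable [IsManifold (𝓡 6) ∞ M]

variable (M) in
/-- Smooth Riemannian metrics on `M`. -/
abbrev Metric6 : Type _ :=
  Bundle.ContMDiffRiemannianMetric (𝓡 6) ∞ E6 (fun x : M => TangentSpace (𝓡 6) x)

variable (g : Metric6 M)

/-- The matrix `g_{ij}` in the chart `φ`. -/
def gMat (φ : OpenPartialHomeomorph M E6) (y : E6) : Matrix (Fin 6) (Fin 6) ℝ :=
  Matrix.of fun i j => g.inner (φ.symm y) (coordVec φ y i) (coordVec φ y j)

/-- The Riemannian density `√(det g_{ij})` in the chart `φ`. -/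
def gDensity (φ : OpenPartialHomeomorph M E6) (y : E6) : ℝ := √(gMat g φ y).det

/-- The coordinate partial derivative `∂_i h`. -/
def pd (i : Fin 6) (h : E6 → ℝ) (y : E6) : ℝ := fderiv ℝ h y (EuclideanSpace.single i (1 : ℝ))

/-- `∇u · ∇w = g^{ij} ∂_i u ∂_j w`. -/
def gradDot (u w : M → ℝ) (x : M) : ℝ :=
  let φ := chartAt E6 x
  ∑ i, ∑ j, (gMat g φ (φ x))⁻¹ i j *
    pd i (fun y => u (φ.symm y)) (φ x) * pd j (fun y => w (φ.symm y)) (φ x)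

/-- `∇ · (w ∇u) = (det g)^{-1/2} ∂_i ((det g)^{1/2} w g^{ij} ∂_j u)`. -/
def divGrad (w u : M → ℝ) (x : M) : ℝ :=
  let φ := chartAt E6 x
  (gDensity g φ (φ x))⁻¹ * ∑ i, pd i (fun y => gDensity g φ y * w (φ.symm y) *
    ∑ j, (gMat g φ y)⁻¹ i j * pd j (fun z => u (φ.symm z)) y) (φ x)

/-- The Laplace–Beltrami operator `Δu = ∇ · ∇u`. -/
def laplace (u : M → ℝ) (x : M) : ℝ := divGrad g (fun _ => 1) u x

/-- `|F|² = (1/p!) g^{i₁j₁} ⋯ g^{i_pj_p} F_{i₁…i_p} F_{j₁…j_p}`. -/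
def Form.normSq {p : ℕ} (F : Form M p) (x : M) : ℝ :=
  let φ := chartAt E6 x
  (p.factorial : ℝ)⁻¹ * ∑ i : Fin p → Fin 6, ∑ j : Fin p → Fin 6,
    (∏ k, (gMat g φ (φ x))⁻¹ (i k) (j k)) * F.comp φ i (φ x) * F.comp φ j (φ x)

variable [T2Space M] [CompactSpace M]

variable (M) in
/-- A smooth partition of unity, indexed by the points of `M`, subordinate to the chart domains. -/
def chartPartition : SmoothPartitionOfUnity M (𝓡 6) M univ :=
  (SmoothPartitionOfUnity.exists_isSubordinate_chartAt_source (𝓡 6) M).choose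

variable [MeasurableSpace M] [BorelSpace M]

/-- The Riemannian volume measure: `∫ f = ∑_c ∫ (ρ_c f) √(det g_{ij}) dy`, each summand computed in
the chart at `c`, for the partition of unity `ρ`. -/
def vol : Measure M :=
  Measure.sum fun c : M =>
    (((volume : Measure E6).restrict (chartAt E6 c).target).withDensity fun y =>
      ENNReal.ofReal (chartPartition M c ((chartAt E6 c).symm y) *
        gDensity g (chartAt E6 c) y)).map (chartAt E6 c).symm

end Manifold

/-! ### The effective potential -/

section Potential

variable {M : Type*} [TopologicalSpace M] [ChartedSpace E6 M]

variable (M) in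
/-- The data entering the effective potential: the curvature term `R`, the field strengths `F_p`
(`p`-forms), the string term `T_string`, the Lagrange multipliers `α`, `β`, the integer `q`, and
Newton's constant. The manifold being six-dimensional, `F_p = 0` for `p > 6`. -/
structure FieldData where
  R : M → ℝ
  F : ∀ p : ℕ, Form M p
  T : M → ℝ
  α : ℝ
  β : ℝ
  q : ℤ
  GN : ℝ

variable [IsManifold (𝓡 6) ∞ M]

/-- The system of the equations of motion for the conformal factor `v = e^{2B}` and the warp factor
`u = e^{2A}`, in the classical sense. -/
structure IsSolution (g : Metric6 M) (D : FieldData M) (v u : M → ℝ) : Prop where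
  contDiff_v : ContMDiff (𝓡 6) 𝓘(ℝ, ℝ) 2 v
  contDiff_u : ContMDiff (𝓡 6) 𝓘(ℝ, ℝ) 2 u
  v_pos : ∀ x, 0 < v x
  u_pos : ∀ x, 0 < u x
  eq_u : ∀ x,
    10 * u x * v x * laplace g v x + 6 * divGrad g (fun z => v z ^ 2) u x
      - 2 * u x * v x ^ 2 * D.R x
      + u x * ∑ p ∈ Finset.range 7, v x ^ (3 - (p : ℤ)) * (D.F p).normSq g x
      - 2 * u x * v x ^ (((D.q : ℝ) - 3) / 2) * D.T x
    = 2 * D.α * v x ^ 3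
  eq_v : ∀ x,
    5 * laplace g (fun z => u z ^ 2 * v z) x + 5 * u x ^ 2 * laplace g v x
      - 2 * u x ^ 2 * v x * D.R x - 6 * v x * gradDot g u u x
      + u x ^ 2 / 2 * ∑ p ∈ Finset.range 7,
          (3 - (p : ℝ)) * v x ^ (2 - (p : ℤ)) * (D.F p).normSq g x
      - ((D.q : ℝ) - 3) / 2 * u x ^ 2 * v x ^ (((D.q : ℝ) - 5) / 2) * D.T x
    = 6 * (D.α * u x * v x ^ 2 + D.β * v x ^ 2)

variable [T2Space M] [CompactSpace M] [MeasurableSpace M] [BorelSpace M]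

/-- The effective potential `V_eff`. -/
def Veff (g : Metric6 M) (D : FieldData M) (v u : M → ℝ) : ℝ :=
  1 / 2 * ∫ x, (-(u x ^ 2 * v x ^ 2 * D.R x)
      - 5 * gradDot g v (fun z => u z ^ 2 * v z) x
      - 3 * v x ^ 2 * gradDot g u u x
      + u x ^ 2 / 2 * ∑ p ∈ Finset.range 7, v x ^ (3 - (p : ℤ)) * (D.F p).normSq g x
      - u x ^ 2 * v x ^ (((D.q : ℝ) - 3) / 2) * D.T x) ∂(vol g)
    + D.α * (1 / D.GN - ∫ x, u x * v x ^ 3 ∂(vol g))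
    + D.β * ((vol g).real univ - ∫ x, v x ^ 3 ∂(vol g))

/-- The second variation of `V_eff` with respect to `v`, in the direction `ψ`. -/
def secondVariation (g : Metric6 M) (D : FieldData M) (v u ψ : M → ℝ) : ℝ :=
  iteratedDeriv 2 (fun t : ℝ => Veff g D (fun x => v x + t * ψ x) u) 0

/-- The mass squared `∂²V_eff/∂v²` of the conformal factor. -/
def massSq (g : Metric6 M) (D : FieldData M) (v u : M → ℝ) : ℝ :=
  secondVariation g D v u fun _ => 1

/-- Stable solutions of the equations of motion. -/
def IsStable (g : Metric6 M) (D : FieldData M) (v u : M → ℝ) : Prop :=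
  IsSolution g D v u ∧ 0 < massSq g D v u

/-- The standing assumption of the Type IIB setting: `q = 3` and `F₀ = F₂ = F₄ = F₆ = 0`. -/
def FieldData.IsTypeIIB (D : FieldData M) : Prop :=
  D.q = 3 ∧ D.F 0 = 0 ∧ D.F 2 = 0 ∧ D.F 4 = 0 ∧ D.F 6 = 0

end Potential

end Warped

end

/-!
The functions `a = 2R - |F₁|²` and `b = |F₃|² - 2T` enter the two equations affinely, with
coefficients that are invertible for `u, v > 0`, so the `v`-equation defines `a` and then the
`u`-equation defines `b`. For large `r` the space `H^r(M)` is an algebra closed under inverses of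
nowhere vanishing functions, and `Δ` and `∇ · (v²∇u)` lose two derivatives; hence
`a, b ∈ H^{s-2}`.

For the stability, the integrand of `V_eff(v + t, u)` is a Laurent polynomial in `v + t` with
continuous coefficients, so it may be differentiated under the integral. Eliminating `a` by the
`v`-equation gives
`∂²V_eff/∂v² = ∫ 2u²v⁻⁴|F₅|² - 3v(αu + β) - (5/2)(Δ(u²v) + u²Δv)/v`.
With `α = ε/4` and `β = -ε/2` the middle term is close to `3ε/4` for `(v, u)` near `(1, 1)`, the
first is nonnegative, and the last is small since `H^s ⊂ C²`.
-/

noncomputable section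

namespace Warped

section Lintegral

theorem lintegral_mul_sq_le {X : Type*} [MeasurableSpace X] {μ : Measure X} {f g : X → ENNReal}
    (hf : AEMeasurable f μ) (hg : AEMeasurable g μ) :
    (∫⁻ x, f x * g x ∂μ) ^ 2 ≤ (∫⁻ x, f x ^ 2 ∂μ) * ∫⁻ x, g x ^ 2 ∂μ := by
  refine (pow_le_pow_left' (ENNReal.lintegral_mul_le_Lp_mul_Lq μ
    Real.HolderConjugate.two_two hf hg) 2).trans_eq ?_
  rw [mul_pow, ← ENNReal.rpow_natCast, ← ENNReal.rpow_natCast, ← ENNReal.rpow_mul,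
    ← ENNReal.rpow_mul]
  norm_num

theorem add_sq_le_two_mul_add_sq (a b : ENNReal) : (a + b) ^ 2 ≤ 2 * (a ^ 2 + b ^ 2) := by
  have := ENNReal.rpow_add_le_mul_rpow_add_rpow a b (p := 2) (by norm_num)
  norm_num at this
  exact this

variable {G : Type*} [AddGroup G] [MeasurableSpace G] [MeasurableAdd₂ G] [MeasurableNeg G]
  {μ : Measure G} {F H : G → ENNReal}

theorem lintegral_mul_sub_sq_le (hF : Measurable F) (hH : Measurable H) (ξ : G) :
    (∫⁻ η, F η * H (ξ - η) ∂μ) ^ 2 ≤ (∫⁻ η, F η ∂μ) * ∫⁻ η, F η * H (ξ - η) ^ 2 ∂μ := by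
  have sqrt_mul_self (x : ENNReal) : x ^ (1 / 2 : ℝ) * x ^ (1 / 2 : ℝ) = x := by
    rw [← ENNReal.rpow_add_of_nonneg _ _ (by norm_num) (by norm_num)]
    norm_num
  have := lintegral_mul_sq_le (μ := μ) (f := fun η => F η ^ (1 / 2 : ℝ))
    (g := fun η => F η ^ (1 / 2 : ℝ) * H (ξ - η)) (by fun_prop) (by fun_prop)
  simpa only [← mul_assoc, mul_pow, pow_two (_ ^ (1 / 2 : ℝ)), sqrt_mul_self] using this

theorem lintegral_convolution_sq_le [SFinite μ] [μ.IsAddRightInvariant] (hF : Measurable F)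
    (hH : Measurable H) :
    ∫⁻ ξ, (∫⁻ η, F η * H (ξ - η) ∂μ) ^ 2 ∂μ ≤ (∫⁻ η, F η ∂μ) ^ 2 * ∫⁻ η, H η ^ 2 ∂μ := by
  calc
    _ ≤ ∫⁻ ξ, (∫⁻ η, F η ∂μ) * ∫⁻ η, F η * H (ξ - η) ^ 2 ∂μ ∂μ :=
      lintegral_mono (lintegral_mul_sub_sq_le hF hH)
    _ = (∫⁻ η, F η ∂μ) * ∫⁻ η, ∫⁻ ξ, F η * H (ξ - η) ^ 2 ∂μ ∂μ := by
      rw [lintegral_const_mul _ (by fun_prop), lintegral_lintegral_swap]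
      exact Measurable.aemeasurable (by unfold Function.uncurry; fun_prop)
    _ = (∫⁻ η, F η ∂μ) * ∫⁻ η, F η * ∫⁻ ξ, H ξ ^ 2 ∂μ ∂μ := by
      congr! with η
      rw [lintegral_const_mul _ (by fun_prop), lintegral_sub_right_eq_self (fun ξ => H ξ ^ 2) η]
    _ = _ := by rw [lintegral_mul_const _ hF]; ring

end Lintegral

/-! ### Sobolev functions on Euclidean space -/

section Bracket

variable {E : Type*} [NormedAddCommGroup E]

/-- The Japanese bracket `⟨ξ⟩ = (1 + |ξ|²)^{1/2}`, with values in `[0, ∞]` because it only serves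
as a weight in lower integrals. -/
def bracket (ξ : E) : ENNReal := (1 + ‖ξ‖ₑ ^ 2) ^ (1 / 2 : ℝ)

theorem bracket_sq (ξ : E) : bracket ξ ^ 2 = 1 + ‖ξ‖ₑ ^ 2 := by
  rw [bracket, ← ENNReal.rpow_natCast, ← ENNReal.rpow_mul]
  norm_num

theorem one_le_bracket (ξ : E) : 1 ≤ bracket ξ :=
  ENNReal.one_le_rpow le_self_add (by norm_num)

theorem bracket_ne_zero (ξ : E) : bracket ξ ≠ 0 :=
  (one_pos.trans_le (one_le_bracket ξ)).ne'

theorem bracket_ne_top (ξ : E) : bracket ξ ≠ ⊤ :=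
  ENNReal.rpow_ne_top_of_nonneg (by norm_num) (by simp)

theorem enorm_le_bracket (ξ : E) : ‖ξ‖ₑ ≤ bracket ξ := by
  rw [← ENNReal.pow_le_pow_left_iff two_ne_zero, bracket_sq]
  exact le_add_self

theorem bracket_rpow_add (ξ : E) (s t : ℝ) :
    bracket ξ ^ (s + t) = bracket ξ ^ s * bracket ξ ^ t :=
  ENNReal.rpow_add s t (bracket_ne_zero ξ) (bracket_ne_top ξ)

theorem bracket_rpow_eq_ofReal (ξ : E) (s : ℝ) :
    bracket ξ ^ s = ENNReal.ofReal ((1 + ‖ξ‖ ^ 2) ^ (s / 2)) := by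
  rw [bracket, ← ENNReal.rpow_mul, ← ENNReal.ofReal_rpow_of_pos (by positivity),
    ENNReal.ofReal_add one_pos.le (by positivity), ENNReal.ofReal_pow (norm_nonneg ξ),
    ofReal_norm, ENNReal.ofReal_one, one_div_mul_eq_div]

theorem bracket_add_le (ξ η : E) : bracket (ξ + η) ≤ bracket ξ + bracket η := by
  rw [← ENNReal.pow_le_pow_left_iff two_ne_zero, bracket_sq]
  calc
    1 + ‖ξ + η‖ₑ ^ 2 ≤ 1 + (‖ξ‖ₑ + ‖η‖ₑ) ^ 2 := by gcongr; exact enorm_add_le ξ η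
    _ = 1 + ‖ξ‖ₑ ^ 2 + 2 * ‖ξ‖ₑ * ‖η‖ₑ + ‖η‖ₑ ^ 2 := by ring
    _ ≤ 1 + ‖ξ‖ₑ ^ 2 + 2 * bracket ξ * bracket η + (1 + ‖η‖ₑ ^ 2) := by
      gcongr
      exacts [enorm_le_bracket ξ, enorm_le_bracket η, le_add_self]
    _ = (bracket ξ + bracket η) ^ 2 := by rw [← bracket_sq, ← bracket_sq]; ring

theorem bracket_rpow_le {s : ℝ} (hs : 0 ≤ s) (ξ η : E) :
    bracket ξ ^ s ≤ 2 ^ s * (bracket η ^ s + bracket (ξ - η) ^ s) := by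
  have subadd : bracket ξ ≤ 2 * max (bracket η) (bracket (ξ - η)) := by
    rw [two_mul]
    exact (by simpa using bracket_add_le η (ξ - η) : bracket ξ ≤ _).trans
      (add_le_add (le_max_left _ _) (le_max_right _ _))
  refine (ENNReal.rpow_le_rpow subadd hs).trans ?_
  rw [ENNReal.mul_rpow_of_nonneg _ _ hs, (ENNReal.monotone_rpow_of_nonneg hs).map_max]
  gcongr
  exact max_le le_self_add le_add_self

variable [MeasurableSpace E] [BorelSpace E]

@[fun_prop]
theorem measurable_bracket : Measurable (bracket : E → ENNReal) := by
  unfold bracket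
  fun_prop

theorem lintegral_bracket_rpow_lt_top [NormedSpace ℝ E] [FiniteDimensional ℝ E] (μ : Measure E)
    [μ.IsAddHaarMeasure] {r : ℝ} (hr : r < -(Module.finrank ℝ E : ℝ)) :
    ∫⁻ ξ : E, bracket ξ ^ r ∂μ < ⊤ := by
  simp only [bracket_rpow_eq_ofReal]
  simpa using (integrable_rpow_neg_one_add_norm_sq (r := -r) (by linarith)).lintegral_lt_top

end Bracket

section Fourier

variable {E F : Type*} [NormedAddCommGroup E] [InnerProductSpace ℝ E] [FiniteDimensional ℝ E]
  [MeasurableSpace E] [BorelSpace E] [NormedAddCommGroup F] [NormedSpace ℂ F]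

theorem continuous_fourier {f : E → F} (hf : Integrable f) : Continuous (𝓕 f) :=
  VectorFourier.fourierIntegral_continuous Real.continuous_fourierChar continuous_inner hf

theorem measurable_enorm_fourier {f : E → F} (hf : Integrable f) :
    Measurable fun ξ => ‖𝓕 f ξ‖ₑ :=
  (continuous_fourier hf).enorm.measurable

theorem fourier_add {f g : E → F} (hf : Integrable f) (hg : Integrable g) (ξ : E) :
    𝓕 (fun y => f y + g y) ξ = 𝓕 f ξ + 𝓕 g ξ :=
  congrFun (VectorFourier.fourierIntegral_add Real.continuous_fourierChar continuous_inner hf hg) ξ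

theorem fourier_const_smul (c : ℂ) (f : E → F) (ξ : E) :
    𝓕 (fun y => c • f y) ξ = c • 𝓕 f ξ :=
  congrFun (VectorFourier.fourierIntegral_const_smul _ _ _ f c) ξ

theorem fourier_fderiv_apply {f : E → F} (hf : Integrable f) (hd : Differentiable ℝ f)
    (hf' : Integrable (fderiv ℝ f)) (v ξ : E) :
    𝓕 (fun y => fderiv ℝ f y v) ξ = (2 * Real.pi * Complex.I * inner ℝ ξ v) • 𝓕 f ξ := by
  have := congrArg (· v) (congrFun (Real.fourier_fderiv hf hd hf') ξ)
  rw [Real.fourier_continuousLinearMap_apply hf'] at this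
  rw [this]
  simp [VectorFourier.fourierSMulRight_apply, mul_smul, innerSL_apply_apply ℝ ξ v]

theorem fourier_smul_eq_integral [CompleteSpace F] {f : E → ℂ} {g : E → F} (hc : Continuous f)
    (hf : Integrable f) (hf' : Integrable (𝓕 f)) (hg : Integrable g) (ξ : E) :
    𝓕 (fun y => f y • g y) ξ = ∫ η, 𝓕 f η • 𝓕 g (ξ - η) := by
  set modulated : E → F := fun y => Real.fourierChar (-inner ℝ y ξ) • g y
  have fourier_modulated (η : E) : 𝓕 modulated η = 𝓕 g (ξ + η) := by
    simp only [Real.fourier_eq, modulated, smul_smul, ← AddChar.map_add_eq_mul]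
    simp only [inner_add_right, neg_add_rev]
  have inversion (y : E) : 𝓕 (fun η => 𝓕 f (-η)) y = f y := by
    rw [← Real.fourierInv_eq_fourier_comp_neg, hc.fourierInv_fourier_eq hf hf']
  have selfAdjoint : ∫ y, 𝓕 (fun η => 𝓕 f (-η)) y • modulated y =
      ∫ η, 𝓕 f (-η) • 𝓕 modulated η := by
    have := VectorFourier.integral_fourierIntegral_smul_eq_flip (L := innerₗ E)
      Real.continuous_fourierChar continuous_inner hf'.comp_neg
      ((Real.fourierIntegral_convergent_iff ξ).2 hg)
    rwa [flip_innerₗ] at this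
  calc
    𝓕 (fun y => f y • g y) ξ = ∫ y, 𝓕 (fun η => 𝓕 f (-η)) y • modulated y := by
      simp only [Real.fourier_eq _ ξ, inversion, modulated, smul_comm (f _)]
    _ = ∫ η, 𝓕 f (-η) • 𝓕 g (ξ - -η) := by
      simp only [selfAdjoint, fourier_modulated, sub_neg_eq_add]
    _ = _ := integral_neg_eq_self (fun η => 𝓕 f η • 𝓕 g (ξ - η)) volume

end Fourier

section IsSobolev

variable {E F : Type*} [NormedAddCommGroup E] [InnerProductSpace ℝ E] [FiniteDimensional ℝ E]
  [MeasurableSpace E] [BorelSpace E] [NormedAddCommGroup F] [NormedSpace ℂ F]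

/-- The square of the `H^s` norm of an integrable function. -/
def sobolevSq (s : ℝ) (f : E → F) : ENNReal := ∫⁻ ξ, (bracket ξ ^ s * ‖𝓕 f ξ‖ₑ) ^ 2

/-- The functions of class `H^s ∩ L¹`, given by their continuous representative. Integrability makes
the Fourier transform an honest integral. -/
structure IsSobolev (s : ℝ) (f : E → F) : Prop where
  continuous : Continuous f
  integrable : Integrable f
  sobolevSq_lt_top : sobolevSq s f < ⊤

theorem hsNorm_sq_eq_sobolevSq (s : ℝ) (h : E6 → ℝ) :
    hsNorm s h ^ 2 = sobolevSq s fun y => (h y : ℂ) := by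
  rw [hsNorm, ← ENNReal.rpow_natCast, ← ENNReal.rpow_mul]
  norm_num only [ENNReal.rpow_one]
  refine lintegral_congr fun ξ => ?_
  rw [mul_pow, bracket_rpow_eq_ofReal, ← ENNReal.ofReal_pow (by positivity),
    ← Real.rpow_mul_natCast (by positivity), Nat.cast_ofNat, div_mul_cancel₀ s two_ne_zero]

theorem hsNorm_lt_top_iff {s : ℝ} {h : E6 → ℝ} :
    hsNorm s h < ⊤ ↔ sobolevSq s (fun y => (h y : ℂ)) < ⊤ := by
  rw [← hsNorm_sq_eq_sobolevSq, ENNReal.pow_lt_top_iff]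
  simp

variable {s t : ℝ} {f g : E → F}

theorem sobolevSq_mono (hst : s ≤ t) (f : E → F) : sobolevSq s f ≤ sobolevSq t f := by
  unfold sobolevSq
  gcongr with ξ
  exact one_le_bracket ξ

theorem sobolevSq_add_le (s : ℝ) (hf : Integrable f) (hg : Integrable g) :
    sobolevSq s (fun y => f y + g y) ≤ 2 * (sobolevSq s f + sobolevSq s g) := by
  have := measurable_enorm_fourier hf
  rw [sobolevSq, sobolevSq, sobolevSq, ← lintegral_add_left (by fun_prop),
    ← lintegral_const_mul' _ _ ENNReal.ofNat_ne_top]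
  gcongr with ξ
  rw [fourier_add hf hg]
  refine le_trans ?_ (add_sq_le_two_mul_add_sq _ _)
  rw [← mul_add]
  gcongr
  exact enorm_add_le _ _

theorem sobolevSq_const_smul (s : ℝ) (c : ℂ) (f : E → F) :
    sobolevSq s (fun y => c • f y) = ‖c‖ₑ ^ 2 * sobolevSq s f := by
  rw [sobolevSq, sobolevSq, ← lintegral_const_mul' _ _ (by simp)]
  refine lintegral_congr fun ξ => ?_
  rw [fourier_const_smul, enorm_smul]
  ring

theorem lintegral_bracket_rpow_mul_fourier_sq_le (s k : ℝ) (hf : Integrable f) :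
    (∫⁻ ξ, bracket ξ ^ k * ‖𝓕 f ξ‖ₑ) ^ 2 ≤
      (∫⁻ ξ : E, bracket ξ ^ ((k - s) * 2)) * sobolevSq s f := by
  have := measurable_enorm_fourier hf
  have cauchySchwarz := lintegral_mul_sq_le (μ := volume) (f := fun ξ : E => bracket ξ ^ (k - s))
    (g := fun ξ => bracket ξ ^ s * ‖𝓕 f ξ‖ₑ) (by fun_prop) (by fun_prop)
  simpa only [sobolevSq, ← mul_assoc, ← bracket_rpow_add, sub_add_cancel,
    ← ENNReal.rpow_mul_natCast, Nat.cast_ofNat] using cauchySchwarz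

theorem lintegral_fourier_sq_le (s : ℝ) (hf : Integrable f) :
    (∫⁻ ξ, ‖𝓕 f ξ‖ₑ) ^ 2 ≤ (∫⁻ ξ : E, bracket ξ ^ (-(s * 2))) * sobolevSq s f := by
  simpa using lintegral_bracket_rpow_mul_fourier_sq_le s 0 hf

theorem sobolevSq_lt_top_of_integrable (hs : s < -(Module.finrank ℝ E : ℝ) / 2) (f : E → F) :
    sobolevSq s f < ⊤ := by
  have fourier_le (ξ : E) : ‖𝓕 f ξ‖ₑ ≤ ENNReal.ofReal (∫ y, ‖f y‖) := by
    rw [← ofReal_norm]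
    exact ENNReal.ofReal_le_ofReal (VectorFourier.norm_fourierIntegral_le_integral_norm _ _ _ _ _)
  calc
    sobolevSq s f ≤ ∫⁻ ξ : E, bracket ξ ^ (s * 2) * ENNReal.ofReal (∫ y, ‖f y‖) ^ 2 := by
      rw [sobolevSq]
      gcongr with ξ
      rw [mul_pow, ← ENNReal.rpow_mul_natCast, Nat.cast_ofNat]
      gcongr
      exact fourier_le ξ
    _ < ⊤ := by
      rw [lintegral_mul_const' _ _ (by simp)]
      exact ENNReal.mul_lt_top (lintegral_bracket_rpow_lt_top _ (by linarith)) (by simp)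

theorem sobolevSq_fderiv_apply_le (s : ℝ) (hf : Integrable f) (hd : Differentiable ℝ f)
    (hf' : Integrable (fderiv ℝ f)) (v : E) :
    sobolevSq s (fun y => fderiv ℝ f y v) ≤
      ENNReal.ofReal (2 * Real.pi * ‖v‖) ^ 2 * sobolevSq (s + 1) f := by
  rw [sobolevSq, sobolevSq, ← lintegral_const_mul' _ _ (by simp)]
  refine lintegral_mono fun ξ => ?_
  have inner_le : ‖(2 * Real.pi * Complex.I * inner ℝ ξ v : ℂ)‖ₑ ≤
      ENNReal.ofReal (2 * Real.pi * ‖v‖) * bracket ξ := by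
    refine le_trans ?_ (mul_le_mul_right (enorm_le_bracket ξ) _)
    rw [← ofReal_norm, ← ofReal_norm ξ, ← ENNReal.ofReal_mul (by positivity)]
    refine ENNReal.ofReal_le_ofReal ?_
    simp only [norm_mul, Complex.norm_ofNat, Complex.norm_real, Complex.norm_I, mul_one,
      Real.norm_of_nonneg Real.pi_pos.le]
    rw [mul_assoc (2 * Real.pi), mul_comm ‖v‖]
    gcongr
    exact norm_inner_le_norm ξ v
  rw [fourier_fderiv_apply hf hd hf', enorm_smul, bracket_rpow_add, ENNReal.rpow_one, ← mul_pow]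
  gcongr ?_ ^ 2
  calc
    _ ≤ bracket ξ ^ s * (ENNReal.ofReal (2 * Real.pi * ‖v‖) * bracket ξ * ‖𝓕 f ξ‖ₑ) := by
      gcongr
    _ = _ := by ring

theorem sobolevSq_add_one_le {ι : Type*} [Fintype ι] (b : OrthonormalBasis ι ℝ E) (s : ℝ)
    (hf : Integrable f) (hd : Differentiable ℝ f) (hf' : Integrable (fderiv ℝ f)) :
    sobolevSq (s + 1) f ≤ sobolevSq s f + ∑ i, sobolevSq s (fun y => fderiv ℝ f y (b i)) := by
  have := measurable_enorm_fourier hf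
  have (i : ι) := measurable_enorm_fourier (hf'.apply_continuousLinearMap (b i))
  simp only [sobolevSq]
  rw [← lintegral_finsetSum _ (by fun_prop), ← lintegral_add_left (by fun_prop)]
  refine lintegral_mono fun ξ => ?_
  have enorm_sq_eq : ‖ξ‖ₑ ^ 2 = ∑ i, ‖inner ℝ ξ (b i)‖ₑ ^ 2 := by
    simp only [← ofReal_norm, ← ENNReal.ofReal_pow (norm_nonneg _)]
    rw [← ENNReal.ofReal_sum_of_nonneg (fun _ _ => sq_nonneg _), b.sum_sq_norm_inner_left]
  have le_fourier_fderiv (i : ι) :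
      ‖inner ℝ ξ (b i)‖ₑ * ‖𝓕 f ξ‖ₑ ≤ ‖𝓕 (fun y => fderiv ℝ f y (b i)) ξ‖ₑ := by
    rw [fourier_fderiv_apply hf hd hf', enorm_smul]
    gcongr
    rw [enorm_mul, ← ofReal_norm (inner ℝ ξ (b i) : ℂ), Complex.norm_real, ofReal_norm]
    refine le_mul_of_one_le_left' ?_
    rw [← ofReal_norm, ENNReal.one_le_ofReal]
    simp only [norm_mul, Complex.norm_ofNat, Complex.norm_real, Complex.norm_I,
      Real.norm_of_nonneg Real.pi_pos.le]
    linarith [Real.pi_gt_three]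
  calc
    (bracket ξ ^ (s + 1) * ‖𝓕 f ξ‖ₑ) ^ 2 =
        (bracket ξ ^ s * ‖𝓕 f ξ‖ₑ) ^ 2 +
          ∑ i, (bracket ξ ^ s * (‖inner ℝ ξ (b i)‖ₑ * ‖𝓕 f ξ‖ₑ)) ^ 2 := by
      simp only [bracket_rpow_add, ENNReal.rpow_one, mul_pow, bracket_sq, enorm_sq_eq,
        ← Finset.mul_sum, ← Finset.sum_mul]
      ring
    _ ≤ _ := by gcongr; exact le_fourier_fderiv _

namespace IsSobolev

theorem add (hf : IsSobolev s f) (hg : IsSobolev s g) : IsSobolev s fun y => f y + g y :=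
  ⟨hf.continuous.add hg.continuous, hf.integrable.add hg.integrable,
    (sobolevSq_add_le s hf.integrable hg.integrable).trans_lt (ENNReal.mul_lt_top (by simp)
      (ENNReal.add_lt_top.2 ⟨hf.sobolevSq_lt_top, hg.sobolevSq_lt_top⟩))⟩

theorem const_smul (c : ℂ) (hf : IsSobolev s f) : IsSobolev s fun y => c • f y :=
  ⟨hf.continuous.const_smul c, hf.integrable.smul c, by
    rw [sobolevSq_const_smul]
    exact ENNReal.mul_lt_top (by simp) hf.sobolevSq_lt_top⟩

theorem lintegral_bracket_rpow_mul_fourier_lt_top {k : ℝ}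
    (hs : (Module.finrank ℝ E : ℝ) / 2 + k < s) (hf : IsSobolev s f) :
    ∫⁻ ξ, bracket ξ ^ k * ‖𝓕 f ξ‖ₑ < ⊤ := by
  refine (ENNReal.pow_lt_top_iff.1 ?_).resolve_right (two_ne_zero (α := ℕ))
  exact (lintegral_bracket_rpow_mul_fourier_sq_le s k hf.integrable).trans_lt
    (ENNReal.mul_lt_top (lintegral_bracket_rpow_lt_top _ (by linarith)) hf.sobolevSq_lt_top)

theorem lintegral_fourier_lt_top (hs : (Module.finrank ℝ E : ℝ) / 2 < s) (hf : IsSobolev s f) :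
    ∫⁻ ξ, ‖𝓕 f ξ‖ₑ < ⊤ := by
  simpa using hf.lintegral_bracket_rpow_mul_fourier_lt_top (k := 0) (by linarith)

theorem integrable_fourier (hs : (Module.finrank ℝ E : ℝ) / 2 < s) (hf : IsSobolev s f) :
    Integrable (𝓕 f) :=
  ⟨(continuous_fourier hf.integrable).aestronglyMeasurable, hf.lintegral_fourier_lt_top hs⟩

theorem fderiv_apply (hf : IsSobolev (s + 1) f) (hd : ContDiff ℝ 1 f)
    (hf' : Integrable (fderiv ℝ f)) (v : E) : IsSobolev s fun y => fderiv ℝ f y v :=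
  ⟨(hd.continuous_fderiv one_ne_zero).clm_apply continuous_const,
    hf'.apply_continuousLinearMap v,
    (sobolevSq_fderiv_apply_le s hf.integrable (hd.differentiable one_ne_zero) hf' v).trans_lt
      (ENNReal.mul_lt_top (by simp) hf.sobolevSq_lt_top)⟩

theorem of_fderiv_apply (hf : IsSobolev s f) (hd : ContDiff ℝ 1 f)
    (hf' : Integrable (fderiv ℝ f)) (h : ∀ v, IsSobolev s fun y => fderiv ℝ f y v) :
    IsSobolev (s + 1) f :=
  ⟨hf.continuous, hf.integrable, (sobolevSq_add_one_le (stdOrthonormalBasis ℝ E) s hf.integrable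
    (hd.differentiable one_ne_zero) hf').trans_lt (ENNReal.add_lt_top.2 ⟨hf.sobolevSq_lt_top,
      ENNReal.sum_lt_top.2 fun _ _ => (h _).sobolevSq_lt_top⟩)⟩

theorem of_contDiff {k : ℕ} (hd : ContDiff ℝ k f) (hc : HasCompactSupport f)
    (hs : s < -(Module.finrank ℝ E : ℝ) / 2) : IsSobolev (s + k) f := by
  induction k generalizing f with
  | zero =>
    exact ⟨hd.continuous, hd.continuous.integrable_of_hasCompactSupport hc,
      sobolevSq_lt_top_of_integrable (by simpa using hs) f⟩
  | succ k ih =>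
    have hd1 : ContDiff ℝ 1 f := hd.of_le (by norm_cast; omega)
    rw [Nat.cast_succ, ← add_assoc]
    refine (ih (hd.of_le (by norm_cast; omega)) hc).of_fderiv_apply hd1
      ((hd1.continuous_fderiv one_ne_zero).integrable_of_hasCompactSupport (hc.fderiv ℝ))
      fun v => ih ?_ (hc.fderiv_apply ℝ v)
    exact (hd.fderiv_right (m := k) (by norm_cast)).clm_apply contDiff_const

section Embedding

variable [CompleteSpace F]

theorem enorm_sq_le (hs : (Module.finrank ℝ E : ℝ) / 2 < s) (hf : IsSobolev s f) (y : E) :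
    ‖f y‖ₑ ^ 2 ≤ (∫⁻ ξ : E, bracket ξ ^ (-(s * 2))) * sobolevSq s f := by
  refine le_trans ?_ (lintegral_fourier_sq_le s hf.integrable)
  gcongr
  rw [← congrFun (hf.continuous.fourierInv_fourier_eq hf.integrable (hf.integrable_fourier hs)) y,
    Real.fourierInv_eq]
  refine (enorm_integral_le_lintegral_enorm _).trans_eq (lintegral_congr fun ξ => ?_)
  rw [← ofReal_norm, ← ofReal_norm, Circle.norm_smul]

theorem contDiff {k : ℕ} (hs : (Module.finrank ℝ E : ℝ) / 2 + k < s) (hf : IsSobolev s f) :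
    ContDiff ℝ k f := by
  have hcont := continuous_fourier hf.integrable
  have hint := hf.integrable_fourier (by linarith [k.cast_nonneg (α := ℝ)])
  have moments (n : ℕ) (hn : (n : ℕ∞) ≤ k) : Integrable fun ξ => ‖ξ‖ ^ n * ‖𝓕 f ξ‖ := by
    refine ⟨(by fun_prop : Continuous _).aestronglyMeasurable, (lintegral_mono fun ξ => ?_).trans_lt
      (hf.lintegral_bracket_rpow_mul_fourier_lt_top hs)⟩
    rw [enorm_mul, enorm_norm, enorm_pow, enorm_norm, ENNReal.rpow_natCast]
    gcongr ?_ * _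
    calc
      ‖ξ‖ₑ ^ n ≤ bracket ξ ^ n := by gcongr; exact enorm_le_bracket ξ
      _ ≤ bracket ξ ^ k := pow_le_pow_right₀ (one_le_bracket ξ) (by exact_mod_cast hn)
  have eq_fourier : f = fun y => 𝓕 (𝓕 f) (-y) := by
    ext y
    rw [← Real.fourierInv_eq_fourier_neg, hf.continuous.fourierInv_fourier_eq hf.integrable hint]
  rw [eq_fourier]
  exact (Real.contDiff_fourier (N := k) moments).comp contDiff_neg

theorem exists_norm_le (hs : (Module.finrank ℝ E : ℝ) / 2 < s) (hf : IsSobolev s f) :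
    ∃ C, ∀ y, ‖f y‖ ≤ C := by
  set B := (∫⁻ ξ : E, bracket ξ ^ (-(s * 2))) * sobolevSq s f
  have hB : B ≠ ⊤ := (ENNReal.mul_lt_top (lintegral_bracket_rpow_lt_top _ (by linarith))
    hf.sobolevSq_lt_top).ne
  refine ⟨√B.toReal, fun y => Real.le_sqrt_of_sq_le ?_⟩
  have := ENNReal.toReal_mono hB (hf.enorm_sq_le hs y)
  simpa using this

end Embedding

end IsSobolev

section Product

variable [CompleteSpace F] {f : E → ℂ}

theorem enorm_fourier_smul_le_lintegral (hc : Continuous f) (hf : Integrable f)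
    (hf' : Integrable (𝓕 f)) (hg : Integrable g) (ξ : E) :
    ‖𝓕 (fun y => f y • g y) ξ‖ₑ ≤ ∫⁻ η, ‖𝓕 f η‖ₑ * ‖𝓕 g (ξ - η)‖ₑ := by
  rw [fourier_smul_eq_integral hc hf hf' hg]
  simpa only [enorm_smul] using enorm_integral_le_lintegral_enorm fun η => 𝓕 f η • 𝓕 g (ξ - η)

theorem bracket_rpow_mul_fourier_smul_le (hs : 0 ≤ s) (hc : Continuous f) (hf : Integrable f)
    (hf' : Integrable (𝓕 f)) (hg : Integrable g) (ξ : E) :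
    bracket ξ ^ s * ‖𝓕 (fun y => f y • g y) ξ‖ₑ ≤
      2 ^ s * ((∫⁻ η, ‖𝓕 g η‖ₑ * (bracket (ξ - η) ^ s * ‖𝓕 f (ξ - η)‖ₑ)) +
        ∫⁻ η, ‖𝓕 f η‖ₑ * (bracket (ξ - η) ^ s * ‖𝓕 g (ξ - η)‖ₑ)) := by
  have := measurable_enorm_fourier hf
  have := measurable_enorm_fourier hg
  have := (measurable_enorm_fourier hg).comp (measurable_const_sub ξ)
  simp only [Function.comp_def] at this
  have swap : ∫⁻ η, ‖𝓕 g η‖ₑ * (bracket (ξ - η) ^ s * ‖𝓕 f (ξ - η)‖ₑ) =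
      ∫⁻ η, ‖𝓕 g (ξ - η)‖ₑ * (bracket η ^ s * ‖𝓕 f η‖ₑ) := by
    rw [← lintegral_sub_left_eq_self _ ξ]
    simp only [sub_sub_cancel]
  calc
    _ ≤ bracket ξ ^ s * ∫⁻ η, ‖𝓕 f η‖ₑ * ‖𝓕 g (ξ - η)‖ₑ := by
      gcongr
      exact enorm_fourier_smul_le_lintegral hc hf hf' hg ξ
    _ = ∫⁻ η, bracket ξ ^ s * (‖𝓕 f η‖ₑ * ‖𝓕 g (ξ - η)‖ₑ) :=
      (lintegral_const_mul _ (by fun_prop)).symm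
    _ ≤ ∫⁻ η, 2 ^ s * (bracket η ^ s + bracket (ξ - η) ^ s) *
        (‖𝓕 f η‖ₑ * ‖𝓕 g (ξ - η)‖ₑ) := by
      gcongr with η
      exact bracket_rpow_le hs ξ η
    _ = 2 ^ s * ∫⁻ η, (‖𝓕 g (ξ - η)‖ₑ * (bracket η ^ s * ‖𝓕 f η‖ₑ) +
        ‖𝓕 f η‖ₑ * (bracket (ξ - η) ^ s * ‖𝓕 g (ξ - η)‖ₑ)) := by
      rw [← lintegral_const_mul _ (by fun_prop)]
      congr! 2 with η
      ring
    _ = _ := by rw [swap, lintegral_add_left (by fun_prop)]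

theorem sobolevSq_smul_le (hs : 0 ≤ s) (hc : Continuous f) (hf : Integrable f)
    (hf' : Integrable (𝓕 f)) (hg : Integrable g) :
    sobolevSq s (fun y => f y • g y) ≤
      (2 ^ s) ^ 2 * (2 * ((∫⁻ η, ‖𝓕 g η‖ₑ) ^ 2 * sobolevSq s f +
        (∫⁻ η, ‖𝓕 f η‖ₑ) ^ 2 * sobolevSq s g)) := by
  have mf := measurable_enorm_fourier hf
  have mg := measurable_enorm_fourier hg
  have wf : Measurable fun ξ => bracket ξ ^ s * ‖𝓕 f ξ‖ₑ := by fun_prop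
  have wg : Measurable fun ξ => bracket ξ ^ s * ‖𝓕 g ξ‖ₑ := by fun_prop
  calc
    _ ≤ ∫⁻ ξ, (2 ^ s) ^ 2 * (2 *
        ((∫⁻ η, ‖𝓕 g η‖ₑ * (bracket (ξ - η) ^ s * ‖𝓕 f (ξ - η)‖ₑ)) ^ 2 +
          (∫⁻ η, ‖𝓕 f η‖ₑ * (bracket (ξ - η) ^ s * ‖𝓕 g (ξ - η)‖ₑ)) ^ 2)) := by
      refine lintegral_mono fun ξ =>
        (pow_le_pow_left' (bracket_rpow_mul_fourier_smul_le hs hc hf hf' hg ξ) 2).trans ?_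
      rw [mul_pow]
      gcongr
      exact add_sq_le_two_mul_add_sq _ _
    _ = (2 ^ s) ^ 2 * (2 *
        ((∫⁻ ξ, (∫⁻ η, ‖𝓕 g η‖ₑ * (bracket (ξ - η) ^ s * ‖𝓕 f (ξ - η)‖ₑ)) ^ 2) +
          ∫⁻ ξ, (∫⁻ η, ‖𝓕 f η‖ₑ * (bracket (ξ - η) ^ s * ‖𝓕 g (ξ - η)‖ₑ)) ^ 2)) := by
      rw [lintegral_const_mul' _ _ (by simp), lintegral_const_mul' _ _ (by simp),
        lintegral_add_left]
      exact (Measurable.lintegral_prod_right' (f := fun p : E × E =>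
        ‖𝓕 g p.2‖ₑ * (bracket (p.1 - p.2) ^ s * ‖𝓕 f (p.1 - p.2)‖ₑ))
        ((mg.comp measurable_snd).mul (wf.comp measurable_sub))).pow_const 2
    _ ≤ _ := by
      gcongr
      exacts [lintegral_convolution_sq_le mg wf, lintegral_convolution_sq_le mf wg]

theorem IsSobolev.smul (hs : (Module.finrank ℝ E : ℝ) / 2 < s) (hf : IsSobolev s f)
    (hg : IsSobolev s g) : IsSobolev s fun y => f y • g y := by
  obtain ⟨C, hC⟩ := hf.exists_norm_le hs
  have hs0 : 0 ≤ s := le_trans (by positivity) hs.le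
  refine ⟨hf.continuous.smul hg.continuous,
    hg.integrable.bdd_smul C hf.continuous.aestronglyMeasurable (.of_forall hC), ?_⟩
  refine (sobolevSq_smul_le hs0 hf.continuous hf.integrable (hf.integrable_fourier hs)
    hg.integrable).trans_lt (ENNReal.mul_lt_top
      (ENNReal.pow_lt_top (ENNReal.rpow_lt_top_of_nonneg hs0 (by simp)))
      (ENNReal.mul_lt_top (by simp) ?_))
  exact ENNReal.add_lt_top.2
    ⟨ENNReal.mul_lt_top (ENNReal.pow_lt_top (hg.lintegral_fourier_lt_top hs)) hf.sobolevSq_lt_top,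
      ENNReal.mul_lt_top (ENNReal.pow_lt_top (hf.lintegral_fourier_lt_top hs)) hg.sobolevSq_lt_top⟩

end Product

end IsSobolev

/-! ### Local Sobolev spaces -/

/-- Test functions on the open set `U`: smooth, with compact support contained in `U`. -/
structure IsTest {E : Type*} [NormedAddCommGroup E] [NormedSpace ℝ E] (U : Set E) (η : E → ℝ) :
    Prop where
  smooth : ContDiff ℝ ∞ η
  compact : HasCompactSupport η
  subset : tsupport η ⊆ U

namespace IsTest

section NormedSpace

variable {E : Type*} [NormedAddCommGroup E] [NormedSpace ℝ E] {U : Set E} {η h : E → ℝ} {y : E}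

theorem mem_of_mem_tsupport_mul (hη : IsTest U η) (hy : y ∈ tsupport fun z => η z * h z) :
    y ∈ U :=
  hη.subset (tsupport_mul_subset_left hy)

theorem eventuallyEq_zero (hη : IsTest U η) (hy : y ∉ U) : η =ᶠ[𝓝 y] 0 :=
  notMem_tsupport_iff_eventuallyEq.1 fun h => hy (hη.subset h)

theorem eq_zero (hη : IsTest U η) (hy : y ∉ U) : η y = 0 :=
  (hη.eventuallyEq_zero hy).self_of_nhds

theorem continuous_mul (hU : IsOpen U) (hη : IsTest U η) (hh : ContinuousOn h U) :
    Continuous fun y => η y * h y :=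
  continuous_of_tsupport fun _ hx => hη.smooth.continuous.continuousAt.mul
    (hh.continuousAt (hU.mem_nhds (hη.mem_of_mem_tsupport_mul hx)))

theorem contDiff_mul (hU : IsOpen U) (hη : IsTest U η) {k : ℕ} (hh : ContDiffOn ℝ k h U) :
    ContDiff ℝ k fun y => η y * h y :=
  contMDiff_iff_contDiff.1 <| contMDiff_of_tsupport fun _ hx =>
    ((hη.smooth.contDiffAt.of_le (mod_cast le_top)).mul
      (hh.contDiffAt (hU.mem_nhds (hη.mem_of_mem_tsupport_mul hx)))).contMDiffAt

theorem hasCompactSupport_mul (hη : IsTest U η) (h : E → ℝ) :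
    HasCompactSupport fun y => η y * h y :=
  hη.compact.mul_right

theorem hasCompactSupport_ofReal_mul (hη : IsTest U η) (h : E → ℝ) :
    HasCompactSupport fun y => ((η y * h y : ℝ) : ℂ) :=
  (hη.hasCompactSupport_mul h).comp_left (g := fun x : ℝ => (x : ℂ)) Complex.ofReal_zero

theorem contDiff_ofReal_mul (hU : IsOpen U) (hη : IsTest U η) {k : ℕ} (hh : ContDiffOn ℝ k h U) :
    ContDiff ℝ k fun y => ((η y * h y : ℝ) : ℂ) :=
  Complex.ofRealCLM.contDiff.comp (hη.contDiff_mul hU hh)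

theorem fderiv_apply (hη : IsTest U η) (v : E) : IsTest U fun y => fderiv ℝ η y v where
  smooth := (hη.smooth.fderiv_right (m := ∞) (by simp)).clm_apply contDiff_const
  compact := hη.compact.fderiv_apply ℝ v
  subset := (tsupport_fderiv_apply_subset ℝ v).trans hη.subset

theorem fderiv_mul_apply (hU : IsOpen U) (hη : IsTest U η) (hh : DifferentiableOn ℝ h U)
    (v y : E) :
    fderiv ℝ (fun z => η z * h z) y v = fderiv ℝ η y v * h y + η y * fderiv ℝ h y v := by
  by_cases hy : y ∈ U
  · rw [fderiv_fun_mul (hη.smooth.differentiable (by simp) y)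
      (hh.differentiableAt (hU.mem_nhds hy))]
    simp only [add_apply, smul_apply, smul_eq_mul]
    ring
  · have mul_eq_zero : (fun z => η z * h z) =ᶠ[𝓝 y] fun _ => 0 :=
      (hη.eventuallyEq_zero hy).mono fun z hz => by simp [hz]
    rw [mul_eq_zero.fderiv_eq, (hη.eventuallyEq_zero hy).fderiv_eq, hη.eq_zero hy]
    simp

end NormedSpace

theorem exists_eventually_eq_one {E : Type*} [NormedAddCommGroup E] [NormedSpace ℝ E]
    [FiniteDimensional ℝ E] {U K : Set E} (hU : IsOpen U) (hK : IsCompact K) (hKU : K ⊆ U) :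
    ∃ η, IsTest U η ∧ ∀ᶠ y in 𝓝ˢ K, η y = 1 := by
  obtain ⟨L, hL, hKL, hLU⟩ := exists_compact_between hK hU hKU
  obtain ⟨f, one_near, zero_off, -⟩ :=
    exists_contMDiffMap_one_nhds_of_subset_interior (n := (⊤ : ℕ∞)) 𝓘(ℝ, E) hK.isClosed hKL
  have tsupport_subset : tsupport f ⊆ L :=
    closure_minimal (fun x hx => by_contra fun hxL => hx (zero_off x hxL)) hL.isClosed
  exact ⟨f, ⟨f.contMDiff.contDiff, HasCompactSupport.of_support_subset_isCompact hL
    (subset_closure.trans tsupport_subset), tsupport_subset.trans hLU⟩, one_near⟩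

end IsTest

theorem fderiv_ofReal_comp_apply {E : Type*} [NormedAddCommGroup E] [NormedSpace ℝ E] {f : E → ℝ}
    {y : E} (hf : DifferentiableAt ℝ f y) (v : E) :
    fderiv ℝ (fun z => (f z : ℂ)) y v = (fderiv ℝ f y v : ℝ) := by
  rw [show (fun z => (f z : ℂ)) = Complex.ofRealCLM ∘ f from rfl,
    Complex.ofRealCLM.hasFDerivAt.comp y hf.hasFDerivAt |>.fderiv]
  rfl

section LocalSobolev

variable {E : Type*} [NormedAddCommGroup E] [InnerProductSpace ℝ E] [FiniteDimensional ℝ E]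
  [MeasurableSpace E] [BorelSpace E]

/-- The local Sobolev space `H^s_loc(U)`: after multiplication by any test function, the
(continuous) function lies in `H^s`. -/
structure MemHsLoc (s : ℝ) (U : Set E) (h : E → ℝ) : Prop where
  continuousOn : ContinuousOn h U
  sobolevSq_lt_top : ∀ η, IsTest U η → sobolevSq s (fun y => ((η y * h y : ℝ) : ℂ)) < ⊤

namespace MemHsLoc

variable {s t : ℝ} {U : Set E} {h k η : E → ℝ}

theorem isSobolev (hU : IsOpen U) (hh : MemHsLoc s U h) (hη : IsTest U η) :
    IsSobolev s fun y => ((η y * h y : ℝ) : ℂ) :=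
  have hc : Continuous fun y => ((η y * h y : ℝ) : ℂ) :=
    Complex.continuous_ofReal.comp (hη.continuous_mul hU hh.continuousOn)
  ⟨hc, hc.integrable_of_hasCompactSupport (hη.hasCompactSupport_ofReal_mul h),
    hh.sobolevSq_lt_top η hη⟩

theorem mono (hh : MemHsLoc t U h) (hst : s ≤ t) : MemHsLoc s U h :=
  ⟨hh.continuousOn, fun η hη => (sobolevSq_mono hst _).trans_lt (hh.sobolevSq_lt_top η hη)⟩

theorem congr (hh : MemHsLoc s U h) (e : EqOn k h U) : MemHsLoc s U k := by
  refine ⟨hh.continuousOn.congr e, fun η hη => ?_⟩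
  have mul_eq : (fun y => η y * k y) = fun y => η y * h y := by
    ext y
    by_cases hy : y ∈ U
    · rw [e hy]
    · simp [hη.eq_zero hy]
  simpa only [mul_eq, congrFun mul_eq] using hh.sobolevSq_lt_top η hη

theorem of_contDiffOn (hU : IsOpen U) {n : ℕ} (hh : ContDiffOn ℝ n h U)
    (hs : s < n - (Module.finrank ℝ E : ℝ) / 2) : MemHsLoc s U h := by
  refine ⟨hh.continuousOn, fun η hη => ?_⟩
  have := IsSobolev.of_contDiff (s := s - n)
    (hη.contDiff_ofReal_mul hU hh) (hη.hasCompactSupport_ofReal_mul h) (by linarith)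
  simpa only [sub_add_cancel] using this.sobolevSq_lt_top

theorem of_smooth (hU : IsOpen U) (hh : ContDiffOn ℝ ∞ h U) : MemHsLoc s U h := by
  obtain ⟨n, hn⟩ := exists_nat_gt (s + (Module.finrank ℝ E : ℝ) / 2)
  exact of_contDiffOn hU (n := n) (hh.of_le (mod_cast le_top)) (by linarith)

theorem const (hU : IsOpen U) (c : ℝ) : MemHsLoc s U fun _ => c :=
  of_smooth hU contDiffOn_const

theorem add (hU : IsOpen U) (hh : MemHsLoc s U h) (hk : MemHsLoc s U k) :
    MemHsLoc s U fun y => h y + k y := by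
  refine ⟨hh.continuousOn.add hk.continuousOn, fun η hη => ?_⟩
  simpa only [mul_add, Complex.ofReal_add] using
    ((hh.isSobolev hU hη).add (hk.isSobolev hU hη)).sobolevSq_lt_top

theorem const_mul (hU : IsOpen U) (c : ℝ) (hh : MemHsLoc s U h) :
    MemHsLoc s U fun y => c * h y := by
  refine ⟨continuousOn_const.mul hh.continuousOn, fun η hη => ?_⟩
  simpa only [mul_left_comm _ c, Complex.ofReal_mul, smul_eq_mul] using
    ((hh.isSobolev hU hη).const_smul c).sobolevSq_lt_top

theorem sum (hU : IsOpen U) {ι : Type*} (S : Finset ι) {f : ι → E → ℝ}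
    (hf : ∀ i ∈ S, MemHsLoc s U (f i)) : MemHsLoc s U fun y => ∑ i ∈ S, f i y := by
  simpa only [Finset.sum_fn] using
    Finset.sum_induction f (MemHsLoc s U) (fun _ _ => add hU) (const hU 0) hf

theorem mul (hU : IsOpen U) (hs : (Module.finrank ℝ E : ℝ) / 2 < s) (hh : MemHsLoc s U h)
    (hk : MemHsLoc s U k) : MemHsLoc s U fun y => h y * k y := by
  refine ⟨hh.continuousOn.mul hk.continuousOn, fun η hη => ?_⟩
  obtain ⟨θ, hθ, hθ1⟩ := IsTest.exists_eventually_eq_one hU hη.compact hη.subset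
  have split (y : E) : η y * (h y * k y) = (η y * h y) * (θ y * k y) := by
    by_cases hy : y ∈ tsupport η
    · rw [hθ1.self_of_nhdsSet y hy]; ring
    · rw [image_eq_zero_of_notMem_tsupport hy]; ring
  simpa only [split, Complex.ofReal_mul, smul_eq_mul] using
    ((hh.isSobolev hU hη).smul hs (hk.isSobolev hU hθ)).sobolevSq_lt_top

theorem prod (hU : IsOpen U) (hs : (Module.finrank ℝ E : ℝ) / 2 < s) {ι : Type*} (S : Finset ι)
    {f : ι → E → ℝ} (hf : ∀ i ∈ S, MemHsLoc s U (f i)) :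
    MemHsLoc s U fun y => ∏ i ∈ S, f i y := by
  simpa only [Finset.prod_fn] using
    Finset.prod_induction f (MemHsLoc s U) (fun _ _ => mul hU hs) (const hU 1) hf

theorem contDiffOn (hU : IsOpen U) {n : ℕ} (hs : (Module.finrank ℝ E : ℝ) / 2 + n < s)
    (hh : MemHsLoc s U h) : ContDiffOn ℝ n h U := by
  intro x hx
  obtain ⟨η, hη, hη1⟩ :=
    IsTest.exists_eventually_eq_one hU (isCompact_singleton (x := x)) (by simpa using hx)
  rw [nhdsSet_singleton] at hη1
  have mul_contDiff : ContDiff ℝ n fun y => η y * h y :=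
    Complex.reCLM.contDiff.comp ((hh.isSobolev hU hη).contDiff hs)
  refine (mul_contDiff.contDiffAt.congr_of_eventuallyEq ?_).contDiffWithinAt
  filter_upwards [hη1] with y hy
  rw [hy, one_mul]

theorem fderiv_apply (hU : IsOpen U) (hs : (Module.finrank ℝ E : ℝ) / 2 + 1 < s)
    (hh : MemHsLoc s U h) (v : E) : MemHsLoc (s - 1) U fun y => fderiv ℝ h y v := by
  have hC : ContDiffOn ℝ (1 : ℕ) h U := hh.contDiffOn hU (by simpa using hs)
  refine ⟨(hC.continuousOn_fderiv_of_isOpen hU (by simp)).clm_apply continuousOn_const,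
    fun η hη => ?_⟩
  have mul_contDiff := hη.contDiff_mul hU hC
  have product_rule (y : E) : ((η y * fderiv ℝ h y v : ℝ) : ℂ) =
      fderiv ℝ (fun z => ((η z * h z : ℝ) : ℂ)) y v +
        (-1 : ℂ) • ((fderiv ℝ η y v * h y : ℝ) : ℂ) := by
    rw [fderiv_ofReal_comp_apply (mul_contDiff.differentiable (by simp) y),
      hη.fderiv_mul_apply hU (hC.differentiableOn (by simp))]
    push_cast
    simp
  simp only [product_rule]
  have complex_contDiff := hη.contDiff_ofReal_mul hU hC
  refine (IsSobolev.add (IsSobolev.fderiv_apply (by simpa using hh.isSobolev hU hη)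
    (mod_cast complex_contDiff) ?_ v)
    (((hh.mono (by linarith)).isSobolev hU (hη.fderiv_apply v)).const_smul _)).sobolevSq_lt_top
  exact (complex_contDiff.continuous_fderiv (by simp)).integrable_of_hasCompactSupport
    ((hη.hasCompactSupport_ofReal_mul h).fderiv ℝ)

theorem of_fderiv_apply (hU : IsOpen U) (hC : ContDiffOn ℝ (1 : ℕ) h U) (hh : MemHsLoc s U h)
    (hd : ∀ v, MemHsLoc s U fun y => fderiv ℝ h y v) : MemHsLoc (s + 1) U h := by
  refine ⟨hh.continuousOn, fun η hη => ?_⟩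
  have mul_contDiff := hη.contDiff_mul hU hC
  have product_rule (v y : E) : fderiv ℝ (fun z => ((η z * h z : ℝ) : ℂ)) y v =
      ((fderiv ℝ η y v * h y : ℝ) : ℂ) + ((η y * fderiv ℝ h y v : ℝ) : ℂ) := by
    rw [fderiv_ofReal_comp_apply (mul_contDiff.differentiable (by simp) y),
      hη.fderiv_mul_apply hU (hC.differentiableOn (by simp)), Complex.ofReal_add]
  have complex_contDiff := hη.contDiff_ofReal_mul hU hC
  refine IsSobolev.sobolevSq_lt_top <| (hh.isSobolev hU hη).of_fderiv_apply
    (mod_cast complex_contDiff) ?_ fun v => ?_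
  · exact (complex_contDiff.continuous_fderiv (by simp)).integrable_of_hasCompactSupport
      ((hη.hasCompactSupport_ofReal_mul h).fderiv ℝ)
  · simp only [product_rule]
    exact (hh.isSobolev hU (hη.fderiv_apply v)).add ((hd v).isSobolev hU hη)

theorem inv_add_one (hU : IsOpen U) (hs : (Module.finrank ℝ E : ℝ) / 2 < s)
    (hh : MemHsLoc (s + 1) U h) (h0 : ∀ y ∈ U, h y ≠ 0) (hinv : MemHsLoc s U fun y => (h y)⁻¹) :
    MemHsLoc (s + 1) U fun y => (h y)⁻¹ := by
  have hC : ContDiffOn ℝ (1 : ℕ) h U := hh.contDiffOn hU (by simpa using hs)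
  refine of_fderiv_apply hU (hC.inv h0) hinv fun v => ?_
  have fderiv_mem : MemHsLoc s U fun y => fderiv ℝ h y v := by
    simpa using hh.fderiv_apply hU (by linarith) v
  refine (const_mul hU (-1) (mul hU hs (mul hU hs hinv hinv) fderiv_mem)).congr fun y hy => ?_
  have hd := ((hC.contDiffAt (hU.mem_nhds hy)).differentiableAt (by simp)).hasFDerivAt
  have inv_hasFDerivAt : HasFDerivAt (fun y => (h y)⁻¹) (-(h y ^ 2)⁻¹ • fderiv ℝ h y) y :=
    (hasDerivAt_inv (h0 y hy)).comp_hasFDerivAt y hd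
  simp only [inv_hasFDerivAt.fderiv, smul_apply, smul_eq_mul]
  ring

-- The embedding into `C^(d+2)` puts `1 / h` into `H^r_loc` for some `r ∈ (d/2, d/2 + 1]` with
-- `s - r` an integer; `∂(1/h) = -(1/h)² ∂h` then gains one derivative at a time.
theorem inv (hU : IsOpen U) (hs : 3 * (Module.finrank ℝ E : ℝ) / 2 + 2 < s)
    (hh : MemHsLoc s U h) (h0 : ∀ y ∈ U, h y ≠ 0) : MemHsLoc s U fun y => (h y)⁻¹ := by
  set d := Module.finrank ℝ E
  have low {r : ℝ} (hr : r ≤ (d : ℝ) / 2 + 1) : MemHsLoc r U fun y => (h y)⁻¹ :=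
    of_contDiffOn hU (n := d + 2) ((hh.contDiffOn hU (by push_cast; linarith)).inv h0)
      (by push_cast; linarith)
  have gain (r : ℝ) (hr : (d : ℝ) / 2 < r) (hr' : r ≤ (d : ℝ) / 2 + 1) (n : ℕ) (hn : r + n ≤ s) :
      MemHsLoc (r + n) U fun y => (h y)⁻¹ := by
    induction n with
    | zero => simpa using low hr'
    | succ n ih =>
      rw [Nat.cast_succ, ← add_assoc] at hn ⊢
      exact inv_add_one hU (by linarith [n.cast_nonneg (α := ℝ)]) (hh.mono hn) h0
        (ih (by linarith))
  set n := ⌈s - (d : ℝ) / 2 - 1⌉₊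
  have le_n : s - (d : ℝ) / 2 - 1 ≤ n := Nat.le_ceil _
  have n_lt : (n : ℝ) < s - (d : ℝ) / 2 - 1 + 1 :=
    Nat.ceil_lt_add_one (by linarith [d.cast_nonneg (α := ℝ)])
  simpa using gain (s - n) (by linarith) (by linarith) n (by linarith)

end MemHsLoc

end LocalSobolev

section PartialDerivatives

variable {f f₁ f₂ : E6 → ℝ} {x : E6}

theorem pd_add (hf₁ : DifferentiableAt ℝ f₁ x) (hf₂ : DifferentiableAt ℝ f₂ x) (i : Fin 6) :
    pd i (fun y => f₁ y + f₂ y) x = pd i f₁ x + pd i f₂ x := by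
  simp only [pd, fderiv_fun_add hf₁ hf₂, add_apply]

theorem pd_mul (hf₁ : DifferentiableAt ℝ f₁ x) (hf₂ : DifferentiableAt ℝ f₂ x) (i : Fin 6) :
    pd i (fun y => f₁ y * f₂ y) x = pd i f₁ x * f₂ x + f₁ x * pd i f₂ x := by
  simp only [pd, fderiv_fun_mul hf₁ hf₂, add_apply, smul_apply, smul_eq_mul]
  ring

theorem pd_congr (e : f₁ =ᶠ[𝓝 x] f₂) (i : Fin 6) : pd i f₁ x = pd i f₂ x := by
  simp only [pd, e.fderiv_eq]

theorem pd_sum {ι : Type*} (S : Finset ι) {f : ι → E6 → ℝ}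
    (hf : ∀ j ∈ S, DifferentiableAt ℝ (f j) x) (i : Fin 6) :
    pd i (fun y => ∑ j ∈ S, f j y) x = ∑ j ∈ S, pd i (f j) x := by
  simp only [pd, fderiv_fun_sum hf, sum_apply]

theorem pd_const (c : ℝ) (x : E6) (i : Fin 6) : pd i (fun _ => c) x = 0 := by
  simp [pd]

theorem pd_const_mul (c : ℝ) (f : E6 → ℝ) (x : E6) (i : Fin 6) :
    pd i (fun y => c * f y) x = c * pd i f x := by
  have := congrFun (fderiv_const_smul_field (𝕜 := ℝ) (f := f) c) x
  rw [pd, show (fun y => c * f y) = c • f from rfl, this]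
  rfl

theorem contDiff_pd {k : ℕ∞ω} (hf : ContDiff ℝ (k + 1) f) (i : Fin 6) : ContDiff ℝ k (pd i f) :=
  (hf.fderiv_right le_rfl).clm_apply contDiff_const

theorem hasCompactSupport_pd (hf : HasCompactSupport f) (i : Fin 6) : HasCompactSupport (pd i f) :=
  hf.fderiv_apply ℝ _

end PartialDerivatives

theorem half_finrank_E6 : (Module.finrank ℝ E6 : ℝ) / 2 = 3 := by
  norm_num [finrank_euclideanSpace_fin]

theorem MemHsLoc.pd {s : ℝ} {U : Set E6} {h : E6 → ℝ} (hU : IsOpen U) (hs : 4 < s)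
    (hh : MemHsLoc s U h) (i : Fin 6) : MemHsLoc (s - 1) U (pd i h) :=
  hh.fderiv_apply hU (by rw [half_finrank_E6]; linarith) _

/-! ### Sobolev functions in coordinates -/

theorem tsupport_indicator_comp_symm_subset {X Y : Type*} [TopologicalSpace X]
    [TopologicalSpace Y] [T2Space Y] (e : OpenPartialHomeomorph X Y) {f : X → ℝ}
    (hf : IsCompact (tsupport f)) (hsub : tsupport f ⊆ e.source) :
    tsupport (e.target.indicator fun y => f (e.symm y)) ⊆ e '' tsupport f := by
  refine closure_minimal (fun y hy => ?_)
    (hf.image_of_continuousOn (e.continuousOn.mono hsub)).isClosed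
  rw [Function.mem_support, indicator_apply_ne_zero] at hy
  exact ⟨e.symm y, subset_tsupport _ hy.2, e.right_inv hy.1⟩

theorem continuous_iff_comp_chart_symm {H M X : Type*} [TopologicalSpace H] [TopologicalSpace M]
    [ChartedSpace H M] [TopologicalSpace X] {f : M → X} :
    Continuous f ↔ ∀ φ ∈ atlas H M, ContinuousOn (fun y => f (φ.symm y)) φ.target := by
  refine ⟨fun h φ _ => h.comp_continuousOn φ.continuousOn_symm, fun h => ?_⟩
  refine continuous_iff_continuousAt.2 fun x => ?_
  have hx := mem_chart_source H x
  rw [(chartAt H x).symm.continuousAt_iff_continuousAt_comp_right hx]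
  exact (h _ (chart_mem_atlas H x)).continuousAt
    ((chartAt H x).open_target.mem_nhds ((chartAt H x).map_source hx))

section Coordinates

variable {M : Type*} [TopologicalSpace M]

theorem locNorm_eq_hsNorm_indicator_mul (s : ℝ) (φ : OpenPartialHomeomorph M E6) (χ : M → ℝ)
    (h : E6 → ℝ) :
    locNorm s φ χ h = hsNorm s fun y => φ.target.indicator (fun y => χ (φ.symm y)) y * h y := by
  rw [locNorm]
  congr 1
  ext y
  by_cases hy : y ∈ φ.target <;> simp [hy]

variable [ChartedSpace E6 M] [IsManifold (𝓡 6) ∞ M] {φ : OpenPartialHomeomorph M E6}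

theorem contMDiffOn_chart_of_mem_atlas (hφ : φ ∈ atlas E6 M) :
    ContMDiffOn (𝓡 6) 𝓘(ℝ, E6) ∞ φ φ.source :=
  contMDiffOn_of_mem_maximalAtlas (IsManifold.subset_maximalAtlas hφ)

theorem contMDiffOn_chart_symm_of_mem_atlas (hφ : φ ∈ atlas E6 M) :
    ContMDiffOn 𝓘(ℝ, E6) (𝓡 6) ∞ φ.symm φ.target :=
  contMDiffOn_symm_of_mem_maximalAtlas (IsManifold.subset_maximalAtlas hφ)

theorem Cutoff.isTest [CompactSpace M] (hφ : φ ∈ atlas E6 M) {χ : M → ℝ} (hχ : χ ∈ Cutoff φ) :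
    IsTest φ.target (φ.target.indicator fun y => χ (φ.symm y)) := by
  have compact := (isClosed_tsupport χ).isCompact
  have hsub := tsupport_indicator_comp_symm_subset φ compact hχ.2
  have image_subset : φ '' tsupport χ ⊆ φ.target := image_subset_iff.2 fun x hx =>
    φ.map_source (hχ.2 hx)
  refine ⟨(contMDiff_of_tsupport fun y hy => ?_).contDiff,
    .of_support_subset_isCompact (compact.image_of_continuousOn (φ.continuousOn.mono hχ.2))
      (subset_closure.trans hsub), hsub.trans image_subset⟩
  have hyt := φ.open_target.mem_nhds (image_subset (hsub hy))
  refine (hχ.1.contMDiffAt.comp y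
    ((contMDiffOn_chart_symm_of_mem_atlas hφ).contMDiffAt hyt)).congr_of_eventuallyEq ?_
  filter_upwards [hyt] with z hz
  simp [hz]

theorem IsTest.exists_cutoff [T2Space M] (hφ : φ ∈ atlas E6 M) {η : E6 → ℝ}
    (hη : IsTest φ.target η) :
    ∃ χ ∈ Cutoff φ, φ.target.indicator (fun y => χ (φ.symm y)) = η := by
  have hsub := tsupport_indicator_comp_symm_subset φ.symm hη.compact.isCompact hη.subset
  have image_subset : φ.symm '' tsupport η ⊆ φ.source := image_subset_iff.2 fun y hy =>
    φ.map_target (hη.subset hy)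
  refine ⟨φ.source.indicator fun x => η (φ x),
    ⟨contMDiff_of_tsupport fun x hx => ?_, hsub.trans image_subset⟩, ?_⟩
  · have hxs := φ.open_source.mem_nhds (image_subset (hsub hx))
    refine (hη.smooth.contMDiff.contMDiffAt.comp x
      ((contMDiffOn_chart_of_mem_atlas hφ).contMDiffAt hxs)).congr_of_eventuallyEq ?_
    filter_upwards [hxs] with z hz
    simp [hz]
  · ext y
    by_cases hy : y ∈ φ.target
    · simp [hy, φ.map_target hy, φ.right_inv hy]
    · rw [indicator_of_notMem hy, hη.eq_zero hy]

theorem memHsLoc_target_iff [T2Space M] [CompactSpace M] (hφ : φ ∈ atlas E6 M) (s : ℝ)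
    (h : E6 → ℝ) :
    MemHsLoc s φ.target h ↔ ContinuousOn h φ.target ∧ ∀ χ ∈ Cutoff φ, locNorm s φ χ h < ⊤ := by
  simp only [locNorm_eq_hsNorm_indicator_mul, hsNorm_lt_top_iff]
  refine ⟨fun H => ⟨H.continuousOn, fun χ hχ => H.sobolevSq_lt_top _ (Cutoff.isTest hφ hχ)⟩,
    fun H => ⟨H.1, fun η hη => ?_⟩⟩
  obtain ⟨χ, hχ, rfl⟩ := hη.exists_cutoff hφ
  exact H.2 χ hχ

theorem memHs_iff [T2Space M] [CompactSpace M] {s : ℝ} {f : M → ℝ} :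
    MemHs s f ↔ ∀ φ ∈ atlas E6 M, MemHsLoc s φ.target fun y => f (φ.symm y) := by
  rw [MemHs, continuous_iff_comp_chart_symm (H := E6), ← forall₂_and]
  exact forall₂_congr fun _ hφ => (memHsLoc_target_iff hφ _ _).symm

theorem Form.memHs_iff [T2Space M] [CompactSpace M] {s : ℝ} {p : ℕ} {F : Form M p} :
    F.MemHs s ↔ ∀ φ ∈ atlas E6 M, ∀ i, MemHsLoc s φ.target (F.comp φ i) :=
  forall₂_congr fun _ hφ => forall_congr' fun _ => (memHsLoc_target_iff hφ _ _).symm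

end Coordinates

/-! ### Jacobi's formula and the Piola identity -/

open scoped Matrix

section Det

variable {𝕜 E ι : Type*} [NontriviallyNormedField 𝕜] [NormedAddCommGroup E] [NormedSpace 𝕜 E]
  [Fintype ι] [DecidableEq ι]

theorem contDiff_det {n : ℕ∞ω} : ContDiff 𝕜 n fun A : ι → ι → 𝕜 => (Matrix.of A).det := by
  simp only [Matrix.det_apply', Matrix.of_apply]
  exact ContDiff.sum fun σ _ => contDiff_const.mul
    (contDiff_prod fun i _ => contDiff_apply_apply 𝕜 𝕜 (σ i) i)

theorem contDiff_adjugate {n : ℕ∞ω} (i j : ι) :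
    ContDiff 𝕜 n fun A : ι → ι → 𝕜 => (Matrix.of A).adjugate i j := by
  have adjugate_eq (A : ι → ι → 𝕜) : (Matrix.of A).adjugate i j =
      (Matrix.of (Function.update A j (Pi.single i 1))).det := Matrix.adjugate_apply _ i j
  simp only [adjugate_eq]
  refine contDiff_det.comp (contDiff_pi.2 fun k => ?_)
  by_cases hk : k = j
  · subst hk
    simpa only [Function.update_self] using contDiff_const
  · simpa only [Function.update_of_ne hk] using contDiff_apply 𝕜 (ι → 𝕜) k

theorem contDiffOn_det {n : ℕ∞ω} {U : Set E} {A : E → Matrix ι ι 𝕜}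
    (hA : ContDiffOn 𝕜 n (fun y i j => A y i j) U) : ContDiffOn 𝕜 n (fun y => (A y).det) U :=
  contDiff_det.comp_contDiffOn hA

theorem contDiffOn_inv_apply {n : ℕ∞ω} {U : Set E} {A : E → Matrix ι ι 𝕜}
    (hA : ContDiffOn 𝕜 n (fun y i j => A y i j) U)
    (hdet : ∀ y ∈ U, (A y).det ≠ 0) (i j : ι) : ContDiffOn 𝕜 n (fun y => (A y)⁻¹ i j) U := by
  refine (((contDiffOn_det hA).inv hdet).mul
    ((contDiff_adjugate i j).comp_contDiffOn hA)).congr fun y _ => ?_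
  rw [Matrix.inv_def, Ring.inverse_eq_inv']
  rfl

theorem sum_adjugate_mul (A : Matrix ι ι 𝕜) (l : ι) (c : ι → 𝕜) :
    ∑ m, A.adjugate l m * c m = ∑ σ : Equiv.Perm ι,
      (Equiv.Perm.sign σ : ℤ) * ((∏ j ∈ Finset.univ.erase l, A (σ j) j) * c (σ l)) := by
  have eq_det : ∑ m, A.adjugate l m * c m = (A.updateCol l c).det := by
    rw [← Matrix.cramer_apply, Matrix.cramer_eq_adjugate_mulVec]
    rfl
  rw [eq_det, Matrix.det_apply']
  refine Finset.sum_congr rfl fun σ _ => ?_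
  rw [← Finset.prod_erase_mul Finset.univ _ (Finset.mem_univ l), Matrix.updateCol_self]
  congr 2
  exact Finset.prod_congr rfl fun j hj => Matrix.updateCol_ne (Finset.ne_of_mem_erase hj)

theorem hasFDerivAt_det {A : E → Matrix ι ι 𝕜} {A' : ι → ι → E →L[𝕜] 𝕜} {y : E}
    (hA : ∀ k l, HasFDerivAt (fun z => A z k l) (A' k l) y) :
    HasFDerivAt (fun z => (A z).det) (∑ l, ∑ m, (A y).adjugate l m • A' m l) y := by
  simp only [Matrix.det_apply']
  refine (HasFDerivAt.fun_sum fun σ _ => (HasFDerivAt.finsetProd fun l _ =>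
    hA (σ l) l).const_mul ((Equiv.Perm.sign σ : ℤ) : 𝕜)).congr_fderiv ?_
  ext v
  simp only [sum_apply, smul_apply, smul_eq_mul,
    sum_adjugate_mul (A y) _ fun m => A' m _ v, Finset.mul_sum]
  exact Finset.sum_comm

end Det

section Jacobian

variable {τ : E6 → E6} {A : E6 → Matrix (Fin 6) (Fin 6) ℝ} {y : E6}

theorem differentiableAt_det (hA : ∀ k l, DifferentiableAt ℝ (fun z => A z k l) y) :
    DifferentiableAt ℝ (fun z => (A z).det) y :=
  (hasFDerivAt_det fun k l => (hA k l).hasFDerivAt).differentiableAt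

theorem differentiableAt_adjugate (hA : ∀ k l, DifferentiableAt ℝ (fun z => A z k l) y)
    (k l : Fin 6) : DifferentiableAt ℝ (fun z => (A z).adjugate k l) y :=
  ((contDiff_adjugate (n := 1) k l).differentiable one_ne_zero).differentiableAt.comp y
    (differentiableAt_pi.2 fun i => differentiableAt_pi.2 (hA i))

theorem pd_det (hA : ∀ k l, DifferentiableAt ℝ (fun z => A z k l) y) (i : Fin 6) :
    pd i (fun z => (A z).det) y = ∑ l, ∑ m, (A y).adjugate l m * pd i (fun z => A z m l) y := by
  simp only [pd, (hasFDerivAt_det fun k l => (hA k l).hasFDerivAt).fderiv, sum_apply,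
    smul_apply, smul_eq_mul]

-- Differentiate `A * adjugate A = det A` and multiply by `adjugate A` from the left.
theorem det_mul_pd_adjugate (hA : ∀ k l, DifferentiableAt ℝ (fun z => A z k l) y)
    (i k l : Fin 6) :
    (A y).det * pd i (fun z => (A z).adjugate k l) y =
      pd i (fun z => (A z).det) y * (A y).adjugate k l -
        ∑ a, ∑ b, (A y).adjugate k a * (pd i (fun z => A z a b) y * (A y).adjugate b l) := by
  have hadj := differentiableAt_adjugate hA
  set T : Matrix (Fin 6) (Fin 6) ℝ := Matrix.of fun a b => pd i (fun z => A z a b) y with hT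
  set P : Matrix (Fin 6) (Fin 6) ℝ :=
    Matrix.of fun a b => pd i (fun z => (A z).adjugate a b) y with hP
  have product_rule : T * (A y).adjugate + A y * P =
      pd i (fun z => (A z).det) y • (1 : Matrix (Fin 6) (Fin 6) ℝ) := by
    ext a b
    have mul_adjugate (z : E6) : ∑ c, A z a c * (A z).adjugate c b =
        (A z).det * (1 : Matrix (Fin 6) (Fin 6) ℝ) a b := by
      rw [← Matrix.mul_apply, Matrix.mul_adjugate, Matrix.smul_apply, smul_eq_mul]
    have := congrArg (fun f => pd i f y) (funext mul_adjugate)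
    simp only [pd_sum _ (f := fun c z => A z a c * (A z).adjugate c b)
      (fun c _ => (hA a c).mul (hadj c b)), pd_mul (hA _ _) (hadj _ _),
      pd_mul (differentiableAt_det hA) (differentiableAt_const _), pd_const, mul_zero,
      add_zero, Finset.sum_add_distrib] at this
    simpa only [Matrix.add_apply, Matrix.mul_apply, Matrix.smul_apply, smul_eq_mul, hT, hP,
      Matrix.of_apply] using this
  have solved : (A y).det • P = pd i (fun z => (A z).det) y • (A y).adjugate -
      (A y).adjugate * (T * (A y).adjugate) := by
    have := congrArg ((A y).adjugate * ·) product_rule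
    simp only [Matrix.mul_add, ← Matrix.mul_assoc _ (A y), Matrix.adjugate_mul, Matrix.smul_mul,
      Matrix.one_mul, Matrix.mul_smul, Matrix.mul_one] at this
    exact eq_sub_of_add_eq' this
  simpa only [Matrix.sub_apply, Matrix.smul_apply, smul_eq_mul, Matrix.mul_apply, hT, hP,
    Matrix.of_apply, Finset.mul_sum] using congrFun₂ solved k l

theorem pd_pd_comm {f : E6 → ℝ} (hf : ContDiffAt ℝ 2 f y) (i j : Fin 6) :
    pd i (pd j f) y = pd j (pd i f) y := by
  have hd : DifferentiableAt ℝ (fderiv ℝ f) y :=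
    (hf.fderiv_right (m := 1) (by norm_num)).differentiableAt one_ne_zero
  have pd_pd_eq (i j : Fin 6) : pd i (pd j f) y =
      fderiv ℝ (fderiv ℝ f) y (EuclideanSpace.single i 1) (EuclideanSpace.single j 1) := by
    change fderiv ℝ (fun z => fderiv ℝ f z (EuclideanSpace.single j 1)) y _ = _
    simp [fderiv_clm_apply hd (differentiableAt_const _)]
  rw [pd_pd_eq, pd_pd_eq]
  exact hf.isSymmSndFDerivAt (by simp) _ _

/-- The Jacobian matrix of `τ`: the entry in row `k` and column `i` is `∂_i τ_k`. -/
def jac (τ : E6 → E6) (y : E6) : Matrix (Fin 6) (Fin 6) ℝ :=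
  Matrix.of fun k i => pd i (fun z => τ z k) y

theorem fderiv_single_eq_sum_jac (hτ : DifferentiableAt ℝ τ y) (i : Fin 6) :
    fderiv ℝ τ y (EuclideanSpace.single i 1) =
      ∑ k, jac τ y k i • EuclideanSpace.single k (1 : ℝ) := by
  have jac_eq (k : Fin 6) : jac τ y k i = fderiv ℝ τ y (EuclideanSpace.single i 1) k := by
    have : HasFDerivAt (fun z => τ z k)
        ((EuclideanSpace.proj k : E6 →L[ℝ] ℝ).comp (fderiv ℝ τ y)) y :=
      (EuclideanSpace.proj k : E6 →L[ℝ] ℝ).hasFDerivAt.comp y hτ.hasFDerivAt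
    simp only [jac, Matrix.of_apply, pd, this.fderiv]
    rfl
  ext l
  simp [← jac_eq, Pi.single_apply]

theorem pd_comp {f : E6 → ℝ} (hf : DifferentiableAt ℝ f (τ y)) (hτ : DifferentiableAt ℝ τ y)
    (i : Fin 6) : pd i (fun z => f (τ z)) y = ∑ k, jac τ y k i * pd k f (τ y) := by
  have chain : HasFDerivAt (fun z => f (τ z)) ((fderiv ℝ f (τ y)).comp (fderiv ℝ τ y)) y :=
    hf.hasFDerivAt.comp y hτ.hasFDerivAt
  simp only [pd, chain.fderiv, ContinuousLinearMap.comp_apply, fderiv_single_eq_sum_jac hτ,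
    map_sum, map_smul, smul_eq_mul]

theorem jac_comp {σ : E6 → E6} (hσ : DifferentiableAt ℝ σ (τ y)) (hτ : DifferentiableAt ℝ τ y) :
    jac (fun z => σ (τ z)) y = jac σ (τ y) * jac τ y := by
  ext k i
  rw [jac, Matrix.of_apply, pd_comp (f := fun w => σ w k) (differentiableAt_euclidean.1 hσ k) hτ,
    Matrix.mul_apply]
  exact Finset.sum_congr rfl fun m _ => mul_comm _ _

theorem jac_eq_one_of_eventuallyEq_id (h : τ =ᶠ[𝓝 y] id) : jac τ y = 1 := by
  ext k i
  have proj_hasFDerivAt : HasFDerivAt (fun z : E6 => z k) (EuclideanSpace.proj k : E6 →L[ℝ] ℝ) y :=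
    (EuclideanSpace.proj k : E6 →L[ℝ] ℝ).hasFDerivAt
  rw [jac, Matrix.of_apply, pd_congr (f₂ := fun z : E6 => z k) (h.mono fun z hz => by rw [hz, id]),
    pd, proj_hasFDerivAt.fderiv]
  simp [Matrix.one_apply]

theorem differentiableAt_jac (hτ : ContDiffAt ℝ 2 τ y) (k l : Fin 6) :
    DifferentiableAt ℝ (fun z => jac τ z k l) y :=
  (((contDiffAt_euclidean.1 hτ k).fderiv_right (m := 1) (by norm_num)).clm_apply
    contDiffAt_const).differentiableAt one_ne_zero

theorem sum_pd_adjugate_jac (hτ : ContDiffAt ℝ 2 τ y) (hdet : (jac τ y).det ≠ 0) (k : Fin 6) :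
    ∑ i, pd i (fun z => (jac τ z).adjugate i k) y = 0 := by
  have hA := differentiableAt_jac hτ
  have symm (i m l : Fin 6) : pd i (fun z => jac τ z m l) y = pd l (fun z => jac τ z m i) y :=
    pd_pd_comm (contDiffAt_euclidean.1 hτ m) i l
  refine (mul_eq_zero.1 ?_).resolve_left hdet
  simp only [Finset.mul_sum, det_mul_pd_adjugate hA, pd_det hA, Finset.sum_sub_distrib,
    Finset.sum_mul, sub_eq_zero]
  rw [Finset.sum_comm]
  refine Finset.sum_congr rfl fun l _ => ?_
  rw [Finset.sum_comm]
  refine Finset.sum_congr rfl fun m _ => Finset.sum_congr rfl fun i _ => ?_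
  rw [symm i m l, mul_assoc]

-- The field on the left is the Piola transform of `Y`.
theorem sum_pd_adjugate_jac_mul_comp (hτ : ContDiffAt ℝ 2 τ y) (hdet : (jac τ y).det ≠ 0)
    {Y : Fin 6 → E6 → ℝ} (hY : ∀ k, DifferentiableAt ℝ (Y k) (τ y)) :
    ∑ i, pd i (fun z => ∑ k, (jac τ z).adjugate i k * Y k (τ z)) y =
      (jac τ y).det * ∑ k, pd k (Y k) (τ y) := by
  have hadj := differentiableAt_adjugate (differentiableAt_jac hτ)
  have hτd : DifferentiableAt ℝ τ y := hτ.differentiableAt two_ne_zero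
  have hYτ (k : Fin 6) : DifferentiableAt ℝ (fun z => Y k (τ z)) y := (hY k).comp y hτd
  have jac_mul_adjugate (m k : Fin 6) : ∑ i, jac τ y m i * (jac τ y).adjugate i k =
      (jac τ y).det * (1 : Matrix (Fin 6) (Fin 6) ℝ) m k := by
    rw [← Matrix.mul_apply, Matrix.mul_adjugate, Matrix.smul_apply, smul_eq_mul]
  calc
    _ = ∑ k, ((∑ i, pd i (fun z => (jac τ z).adjugate i k) y) * Y k (τ y) +
        ∑ m, (∑ i, jac τ y m i * (jac τ y).adjugate i k) * pd m (Y k) (τ y)) := by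
      simp only [pd_sum _ (f := fun k z => (jac τ z).adjugate _ k * Y k (τ z))
        (fun k _ => (hadj _ k).mul (hYτ k)), pd_mul (hadj _ _) (hYτ _), pd_comp (hY _) hτd,
        Finset.sum_mul, Finset.mul_sum, Finset.sum_add_distrib]
      congr 1
      · exact Finset.sum_comm
      · rw [Finset.sum_comm]
        refine Finset.sum_congr rfl fun k _ => ?_
        rw [Finset.sum_comm]
        exact Finset.sum_congr rfl fun m _ => Finset.sum_congr rfl fun i _ => by ring
    _ = _ := by
      simp [sum_pd_adjugate_jac hτ hdet, jac_mul_adjugate, Matrix.one_apply, Finset.mul_sum]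

end Jacobian

/-! ### Tensor norms -/

section TensorPower

variable {n R : Type*} {p : ℕ}

/-- The matrix induced by `A` on `p`-tensors, in the basis of `p`-fold tensor products. -/
def tensorPower [CommMonoid R] (p : ℕ) (A : Matrix n n R) :
    Matrix (Fin p → n) (Fin p → n) R :=
  Matrix.of fun i j => ∏ k, A (i k) (j k)

theorem tensorPower_mul [Fintype n] [CommSemiring R] (A B : Matrix n n R) :
    tensorPower p (A * B) = tensorPower p A * tensorPower p B := by
  ext i j
  simp only [tensorPower, Matrix.of_apply, Matrix.mul_apply, Finset.prod_univ_sum,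
    Fintype.piFinset_univ, Finset.prod_mul_distrib]

theorem tensorPower_transpose [CommMonoid R] (A : Matrix n n R) :
    tensorPower p Aᵀ = (tensorPower p A)ᵀ :=
  rfl

theorem dotProduct_tensorPower_mulVec [Fintype n] [CommSemiring R] (H A : Matrix n n R)
    (F : (Fin p → n) → R) :
    (tensorPower p Aᵀ *ᵥ F) ⬝ᵥ tensorPower p H *ᵥ (tensorPower p Aᵀ *ᵥ F) =
      F ⬝ᵥ tensorPower p (A * H * Aᵀ) *ᵥ F := by
  simp only [tensorPower_mul, tensorPower_transpose, ← Matrix.mulVec_mulVec,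
    Matrix.mulVec_transpose, Matrix.dotProduct_mulVec, Matrix.vecMul_vecMul]

open scoped MatrixOrder in
theorem posSemidef_tensorPower [Finite n] {H : Matrix n n ℝ} (hH : H.PosSemidef) :
    (tensorPower p H).PosSemidef := by
  have := Fintype.ofFinite n
  classical
  obtain ⟨B, rfl⟩ := CStarAlgebra.nonneg_iff_eq_star_mul_self.1 hH.nonneg
  rw [Matrix.star_eq_conjTranspose, Matrix.conjTranspose_eq_transpose_of_trivial, tensorPower_mul,
    tensorPower_transpose, ← Matrix.conjTranspose_eq_transpose_of_trivial]
  exact Matrix.posSemidef_conjTranspose_mul_self _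

end TensorPower

/-! ### The metric in coordinates -/

section Transition

variable {M : Type*} [TopologicalSpace M] {φ ψ : OpenPartialHomeomorph M E6} {y : E6}

/-- The transition map `ψ ∘ φ⁻¹`, whose source consists of the `φ`-coordinates of the points in the
domains of both charts. -/
abbrev transition (φ ψ : OpenPartialHomeomorph M E6) : OpenPartialHomeomorph E6 E6 :=
  φ.symm.trans ψ

theorem symm_transition (hy : y ∈ (transition φ ψ).source) :
    ψ.symm (transition φ ψ y) = φ.symm y :=
  ψ.left_inv hy.2

theorem comp_symm_eventuallyEq (hy : y ∈ (transition φ ψ).source) {X : Type*} (u : M → X) :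
    (fun z => u (φ.symm z)) =ᶠ[𝓝 y] fun z => u (ψ.symm (transition φ ψ z)) := by
  filter_upwards [(transition φ ψ).open_source.mem_nhds hy] with z hz
  rw [symm_transition hz]

variable [ChartedSpace E6 M]

theorem chartAt_mem_transition_source (hy : y ∈ φ.target) :
    chartAt E6 (φ.symm y) (φ.symm y) ∈ (transition (chartAt E6 (φ.symm y)) φ).source := by
  have hs := mem_chart_source E6 (φ.symm y)
  refine ⟨(chartAt E6 (φ.symm y)).map_source hs, ?_⟩
  change (chartAt E6 (φ.symm y)).symm (chartAt E6 (φ.symm y) (φ.symm y)) ∈ φ.source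
  rw [OpenPartialHomeomorph.left_inv _ hs]
  exact φ.map_target hy

theorem transition_chartAt (hy : y ∈ φ.target) :
    transition (chartAt E6 (φ.symm y)) φ (chartAt E6 (φ.symm y) (φ.symm y)) = y := by
  rw [OpenPartialHomeomorph.trans_apply,
    OpenPartialHomeomorph.left_inv _ (mem_chart_source E6 (φ.symm y)), φ.right_inv hy]

/-- `coordVec φ y i` as an element of the model space, of which every tangent space is a copy. This
allows comparing coordinate vectors at points of `M` that are only propositionally equal. -/
def coordVecE (φ : OpenPartialHomeomorph M E6) (y : E6) (i : Fin 6) : E6 := coordVec φ y i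

/-- The value of `F` at `x` as a form on the model space, for use with `coordVecE`. -/
def Form.atE {p : ℕ} (F : Form M p) (x : M) : E6 [⋀^Fin p]→ₗ[ℝ] ℝ := F x

theorem Form.comp_eq_atE {p : ℕ} (F : Form M p) {x : M} (hx : φ.symm y = x) (i : Fin p → Fin 6) :
    F.comp φ i y = F.atE x fun k => coordVecE φ y (i k) := by
  subst hx; rfl

variable [IsManifold (𝓡 6) ∞ M]

theorem contDiffAt_transition (hφ : φ ∈ atlas E6 M) (hψ : ψ ∈ atlas E6 M)
    (hy : y ∈ (transition φ ψ).source) : ContDiffAt ℝ ∞ (transition φ ψ) y :=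
  (((contMDiffOn_chart_of_mem_atlas hψ).contMDiffAt (ψ.open_source.mem_nhds hy.2)).comp y
    ((contMDiffOn_chart_symm_of_mem_atlas hφ).contMDiffAt
      (φ.open_target.mem_nhds hy.1))).contDiffAt

theorem contDiffAt_two_transition (hφ : φ ∈ atlas E6 M) (hψ : ψ ∈ atlas E6 M)
    (hy : y ∈ (transition φ ψ).source) : ContDiffAt ℝ 2 (transition φ ψ) y :=
  (contDiffAt_transition hφ hψ hy).of_le (WithTop.coe_le_coe.2 le_top)

theorem differentiableAt_transition (hφ : φ ∈ atlas E6 M) (hψ : ψ ∈ atlas E6 M)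
    (hy : y ∈ (transition φ ψ).source) : DifferentiableAt ℝ (transition φ ψ) y :=
  (contDiffAt_two_transition hφ hψ hy).differentiableAt two_ne_zero

theorem isUnit_det_jac_transition (hφ : φ ∈ atlas E6 M) (hψ : ψ ∈ atlas E6 M)
    (hy : y ∈ (transition φ ψ).source) : IsUnit (jac (transition φ ψ) y).det := by
  have hy' : transition φ ψ y ∈ (transition ψ φ).source :=
    (transition φ ψ).map_source hy
  have jac_mul_jac : jac (transition ψ φ) (transition φ ψ y) * jac (transition φ ψ) y = 1 := by
    rw [← jac_comp (differentiableAt_transition hψ hφ hy') (differentiableAt_transition hφ hψ hy)]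
    exact jac_eq_one_of_eventuallyEq_id ((transition φ ψ).eventually_left_inverse hy)
  exact Matrix.isUnit_det_of_left_inverse jac_mul_jac

theorem pd_comp_symm (hφ : φ ∈ atlas E6 M) (hψ : ψ ∈ atlas E6 M)
    (hy : y ∈ (transition φ ψ).source) {u : M → ℝ}
    (hu : DifferentiableAt ℝ (fun z => u (ψ.symm z)) (transition φ ψ y)) :
    (fun i => pd i (fun z => u (φ.symm z)) y) = (jac (transition φ ψ) y)ᵀ *ᵥ
      fun k => pd k (fun z => u (ψ.symm z)) (transition φ ψ y) := by
  ext i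
  rw [pd_congr (comp_symm_eventuallyEq hy u), pd_comp hu (differentiableAt_transition hφ hψ hy)]
  rfl

theorem coordVecE_transition (hφ : φ ∈ atlas E6 M) (hψ : ψ ∈ atlas E6 M)
    (hy : y ∈ (transition φ ψ).source) (i : Fin 6) :
    coordVecE φ y i = ∑ k, jac (transition φ ψ) y k i • coordVecE ψ (transition φ ψ y) k := by
  have hτ := differentiableAt_transition hφ hψ hy
  have hψ_symm : MDifferentiableAt 𝓘(ℝ, E6) (𝓡 6) ψ.symm (transition φ ψ y) :=
    ((contMDiffOn_chart_symm_of_mem_atlas hψ).contMDiffAt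
      (ψ.open_target.mem_nhds (ψ.map_source hy.2))).mdifferentiableAt (by simp)
  let D : E6 →L[ℝ] E6 := mfderiv 𝓘(ℝ, E6) (𝓡 6) ψ.symm (transition φ ψ y)
  have chain : HasMFDerivAt 𝓘(ℝ, E6) (𝓡 6) φ.symm y (D.comp (fderiv ℝ (transition φ ψ) y)) :=
    (hψ_symm.hasMFDerivAt.comp y hτ.hasFDerivAt.hasMFDerivAt).congr_of_eventuallyEq
      (comp_symm_eventuallyEq hy id)
  have coordVecE_eq : coordVecE φ y i =
      D (fderiv ℝ (transition φ ψ) y (EuclideanSpace.single i 1)) := by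
    rw [coordVecE, coordVec, chain.mfderiv]
    rfl
  rw [coordVecE_eq, fderiv_single_eq_sum_jac hτ, map_sum]
  exact Finset.sum_congr rfl fun k _ => map_smul D _ _

theorem linearIndependent_coordVecE (hφ : φ ∈ atlas E6 M) (hy : y ∈ φ.target) :
    LinearIndependent ℝ (coordVecE φ y) := by
  let D : E6 →L[ℝ] E6 := mfderiv 𝓘(ℝ, E6) (𝓡 6) φ.symm y
  have injective : Function.Injective D :=
    ((mdifferentiable_of_mem_atlas (I := 𝓡 6) hφ).symm).mfderiv_injective hy
  have basis_independent :=
    (EuclideanSpace.basisFun (Fin 6) ℝ).toBasis.linearIndependent.map' D.toLinearMap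
      (LinearMap.ker_eq_bot.2 injective)
  have coordVecE_eq : coordVecE φ y = D ∘ (EuclideanSpace.basisFun (Fin 6) ℝ).toBasis := by
    ext1 i
    rw [Function.comp, OrthonormalBasis.coe_toBasis, EuclideanSpace.basisFun_apply]
    rfl
  rw [coordVecE_eq]
  exact basis_independent

theorem contMDiffOn_coordVec (hφ : φ ∈ atlas E6 M) (i : Fin 6) :
    ContMDiffOn 𝓘(ℝ, E6) (𝓡 6).tangent ∞
      (fun y => (⟨φ.symm y, coordVec φ y i⟩ : TangentBundle (𝓡 6) M)) φ.target := by
  have tangentMap_smooth := (contMDiffOn_chart_symm_of_mem_atlas hφ).contMDiffOn_tangentMapWithin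
    (m := ∞) (by simp) φ.open_target.uniqueMDiffOn
  have section_smooth : ContMDiff 𝓘(ℝ, E6) 𝓘(ℝ, E6).tangent ∞
      (fun y : E6 => (⟨y, EuclideanSpace.single i (1 : ℝ)⟩ : TangentBundle 𝓘(ℝ, E6) E6)) :=
    fun y => contMDiffAt_vectorSpace_iff_contDiffAt.2 contDiffAt_const
  refine (tangentMap_smooth.comp section_smooth.contMDiffOn fun y hy => hy).congr fun y hy => ?_
  simp only [Function.comp, tangentMapWithin, coordVec]
  rw [mfderivWithin_of_isOpen φ.open_target hy]

end Transition

section Metric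

variable {M : Type*} [TopologicalSpace M] [ChartedSpace E6 M] [IsManifold (𝓡 6) ∞ M]
  (g : Metric6 M) {φ ψ : OpenPartialHomeomorph M E6} {y : E6}

/-- The metric at `x` as a bilinear form on the model space, for use with `coordVecE`. -/
def metricE (x : M) : E6 →L[ℝ] E6 →L[ℝ] ℝ := g.inner x

theorem gMat_apply {x : M} (hx : φ.symm y = x) (i j : Fin 6) :
    gMat g φ y i j = metricE g x (coordVecE φ y i) (coordVecE φ y j) := by
  subst hx; rfl

theorem gMat_transition (hφ : φ ∈ atlas E6 M) (hψ : ψ ∈ atlas E6 M)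
    (hy : y ∈ (transition φ ψ).source) :
    gMat g φ y = (jac (transition φ ψ) y)ᵀ * gMat g ψ (transition φ ψ y) *
      jac (transition φ ψ) y := by
  ext i j
  rw [gMat_apply g rfl, coordVecE_transition hφ hψ hy i, coordVecE_transition hφ hψ hy j]
  simp only [map_sum, map_smul, sum_apply, smul_apply, smul_eq_mul, Matrix.mul_apply,
    Matrix.transpose_apply, gMat_apply g (symm_transition hy), Finset.sum_mul, Finset.mul_sum]
  exact Finset.sum_congr rfl fun k _ => Finset.sum_congr rfl fun l _ => by ring

theorem dotProduct_gMat_mulVec (c : Fin 6 → ℝ) :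
    c ⬝ᵥ gMat g φ y *ᵥ c = metricE g (φ.symm y) (∑ i, c i • coordVecE φ y i)
      (∑ i, c i • coordVecE φ y i) := by
  simp only [map_sum, map_smul, sum_apply, smul_apply, smul_eq_mul, dotProduct, Matrix.mulVec,
    Finset.mul_sum, gMat_apply g rfl]
  rw [Finset.sum_comm]
  exact Finset.sum_congr rfl fun i _ => Finset.sum_congr rfl fun j _ => by ring

theorem gMat_posDef (hφ : φ ∈ atlas E6 M) (hy : y ∈ φ.target) : (gMat g φ y).PosDef := by
  refine .of_dotProduct_mulVec_pos ?_ fun c hc => ?_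
  · ext i j
    exact g.symm _ _ _
  · rw [star_trivial, dotProduct_gMat_mulVec]
    exact g.pos (φ.symm y) _ fun h0 => hc <| funext <|
      Fintype.linearIndependent_iff.1 (linearIndependent_coordVecE hφ hy) c h0

theorem gMat_det_pos (hφ : φ ∈ atlas E6 M) (hy : y ∈ φ.target) : 0 < (gMat g φ y).det :=
  (gMat_posDef g hφ hy).det_pos

theorem gDensity_pos (hφ : φ ∈ atlas E6 M) (hy : y ∈ φ.target) : 0 < gDensity g φ y :=
  Real.sqrt_pos.2 (gMat_det_pos g hφ hy)

theorem gDensity_transition (hφ : φ ∈ atlas E6 M) (hψ : ψ ∈ atlas E6 M)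
    (hy : y ∈ (transition φ ψ).source) :
    gDensity g φ y = |(jac (transition φ ψ) y).det| * gDensity g ψ (transition φ ψ y) := by
  rw [gDensity, gDensity, gMat_transition g hφ hψ hy, Matrix.det_mul, Matrix.det_mul,
    Matrix.det_transpose, ← Real.sqrt_sq_eq_abs, ← Real.sqrt_mul (sq_nonneg _)]
  congr 1
  ring

theorem gMat_inv_transition (hφ : φ ∈ atlas E6 M) (hψ : ψ ∈ atlas E6 M)
    (hy : y ∈ (transition φ ψ).source) :
    jac (transition φ ψ) y * (gMat g φ y)⁻¹ * (jac (transition φ ψ) y)ᵀ =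
      (gMat g ψ (transition φ ψ y))⁻¹ := by
  have hA := isUnit_det_jac_transition hφ hψ hy
  have hAt : IsUnit (jac (transition φ ψ) y)ᵀ.det := by rwa [Matrix.det_transpose]
  rw [gMat_transition g hφ hψ hy, Matrix.mul_inv_rev, Matrix.mul_inv_rev, ← Matrix.mul_assoc,
    Matrix.mul_nonsing_inv _ hA, Matrix.one_mul, Matrix.mul_assoc, Matrix.nonsing_inv_mul _ hAt,
    Matrix.mul_one]

theorem contDiffOn_gMat (hφ : φ ∈ atlas E6 M) :
    ContDiffOn ℝ ∞ (fun y i j => gMat g φ y i j) φ.target := by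
  refine contDiffOn_pi.2 fun i => contDiffOn_pi.2 fun j y hy => ?_
  have : ContMDiffWithinAt 𝓘(ℝ, E6) ((𝓡 6).prod 𝓘(ℝ)) ∞
      (fun y => Bundle.TotalSpace.mk' ℝ (E := Bundle.Trivial M ℝ) (φ.symm y)
        (g.inner (φ.symm y) (coordVec φ y i) (coordVec φ y j))) φ.target y := by
    apply ContMDiffWithinAt.clm_bundle_apply₂ (F₁ := E6) (F₂ := E6)
    · exact g.contMDiff.contMDiffAt.comp_contMDiffWithinAt y
        (contMDiffOn_chart_symm_of_mem_atlas hφ y hy)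
    · exact contMDiffOn_coordVec hφ i y hy
    · exact contMDiffOn_coordVec hφ j y hy
  simp only [Bundle.contMDiffWithinAt_totalSpace] at this
  exact this.2.contDiffWithinAt

theorem contDiffOn_gMat_det (hφ : φ ∈ atlas E6 M) :
    ContDiffOn ℝ ∞ (fun y => (gMat g φ y).det) φ.target :=
  contDiffOn_det (contDiffOn_gMat g hφ)

theorem contDiffOn_gMat_inv (hφ : φ ∈ atlas E6 M) (i j : Fin 6) :
    ContDiffOn ℝ ∞ (fun y => (gMat g φ y)⁻¹ i j) φ.target :=
  contDiffOn_inv_apply (contDiffOn_gMat g hφ) (fun _ hy => (gMat_det_pos g hφ hy).ne') i j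

theorem contDiffOn_gDensity (hφ : φ ∈ atlas E6 M) : ContDiffOn ℝ ∞ (gDensity g φ) φ.target :=
  (contDiffOn_gMat_det g hφ).sqrt fun _ hy => (gMat_det_pos g hφ hy).ne'

end Metric

/-! ### Invariance of the differential operators -/

theorem exists_eventually_abs_eq_mul {X : Type*} [TopologicalSpace X] {f : X → ℝ} {x : X}
    (hf : ContinuousAt f x) (h0 : f x ≠ 0) : ∃ ε : ℝ, ∀ᶠ z in 𝓝 x, |f z| = ε * f z := by
  rcases lt_or_gt_of_ne h0 with h | h
  · refine ⟨-1, ?_⟩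
    filter_upwards [hf.eventually_lt_const h] with z hz
    rw [abs_of_neg hz, neg_one_mul]
  · refine ⟨1, ?_⟩
    filter_upwards [hf.eventually_const_lt h] with z hz
    rw [abs_of_pos hz, one_mul]

section Invariance

variable {M : Type*} [TopologicalSpace M] [ChartedSpace E6 M] [IsManifold (𝓡 6) ∞ M]
  (g : Metric6 M) {φ ψ : OpenPartialHomeomorph M E6} {y : E6} {u w : M → ℝ}

/-- `g^{ij} ∂_i u ∂_j w`, for functions given in the chart `φ`. -/
def gradIn (φ : OpenPartialHomeomorph M E6) (u w : E6 → ℝ) (y : E6) : ℝ :=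
  ∑ i, ∑ j, (gMat g φ y)⁻¹ i j * pd i u y * pd j w y

/-- The component `(det g)^{1/2} w g^{ij} ∂_j u` of the densitized flux, for functions given in the
chart `φ`. -/
def fluxIn (φ : OpenPartialHomeomorph M E6) (w u : E6 → ℝ) (i : Fin 6) (y : E6) : ℝ :=
  gDensity g φ y * w y * ∑ j, (gMat g φ y)⁻¹ i j * pd j u y

/-- `(det g)^{-1/2} ∂_i ((det g)^{1/2} w g^{ij} ∂_j u)`, for functions given in the chart `φ`. -/
def divIn (φ : OpenPartialHomeomorph M E6) (w u : E6 → ℝ) (y : E6) : ℝ :=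
  (gDensity g φ y)⁻¹ * ∑ i, pd i (fluxIn g φ w u i) y

/-- `|F|²` computed from the components of `F` in the chart `φ`. -/
def Form.normSqIn {p : ℕ} (F : Form M p) (φ : OpenPartialHomeomorph M E6) (y : E6) : ℝ :=
  (p.factorial : ℝ)⁻¹ * ∑ i : Fin p → Fin 6, ∑ j : Fin p → Fin 6,
    (∏ k, (gMat g φ y)⁻¹ (i k) (j k)) * F.comp φ i y * F.comp φ j y

theorem gradIn_eq_dotProduct (u w : E6 → ℝ) :
    gradIn g φ u w y = (fun i => pd i u y) ⬝ᵥ ((gMat g φ y)⁻¹ *ᵥ fun i => pd i w y) := by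
  simp only [gradIn, dotProduct, Matrix.mulVec, Finset.mul_sum]
  exact Finset.sum_congr rfl fun i _ => Finset.sum_congr rfl fun j _ => by ring

theorem Form.normSqIn_eq_dotProduct {p : ℕ} (F : Form M p) :
    F.normSqIn g φ y = (p.factorial : ℝ)⁻¹ * ((fun i => F.comp φ i y) ⬝ᵥ
      (tensorPower p (gMat g φ y)⁻¹ *ᵥ fun i => F.comp φ i y)) := by
  simp only [normSqIn, dotProduct, Matrix.mulVec, Finset.mul_sum, tensorPower, Matrix.of_apply]
  exact Finset.sum_congr rfl fun i _ => Finset.sum_congr rfl fun j _ => by ring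

theorem gradIn_transition (hφ : φ ∈ atlas E6 M) (hψ : ψ ∈ atlas E6 M)
    (hy : y ∈ (transition φ ψ).source)
    (hu : DifferentiableAt ℝ (fun z => u (ψ.symm z)) (transition φ ψ y))
    (hw : DifferentiableAt ℝ (fun z => w (ψ.symm z)) (transition φ ψ y)) :
    gradIn g φ (fun z => u (φ.symm z)) (fun z => w (φ.symm z)) y =
      gradIn g ψ (fun z => u (ψ.symm z)) (fun z => w (ψ.symm z)) (transition φ ψ y) := by
  rw [gradIn_eq_dotProduct, gradIn_eq_dotProduct, pd_comp_symm hφ hψ hy hu,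
    pd_comp_symm hφ hψ hy hw, ← gMat_inv_transition g hφ hψ hy, Matrix.mulVec_transpose,
    ← Matrix.dotProduct_mulVec, Matrix.mulVec_mulVec, Matrix.mulVec_mulVec]

theorem adjugate_jac_transition_mul_gMat_inv (hφ : φ ∈ atlas E6 M) (hψ : ψ ∈ atlas E6 M)
    (hy : y ∈ (transition φ ψ).source) :
    (jac (transition φ ψ) y).adjugate * (gMat g ψ (transition φ ψ y))⁻¹ =
      (jac (transition φ ψ) y).det • ((gMat g φ y)⁻¹ * (jac (transition φ ψ) y)ᵀ) := by
  rw [← gMat_inv_transition g hφ hψ hy, ← Matrix.mul_assoc, ← Matrix.mul_assoc,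
    Matrix.adjugate_mul, Matrix.smul_mul, Matrix.one_mul, Matrix.smul_mul]

theorem fluxIn_transition (hφ : φ ∈ atlas E6 M) (hψ : ψ ∈ atlas E6 M)
    (hy : y ∈ (transition φ ψ).source) (w : M → ℝ)
    (hu : DifferentiableAt ℝ (fun z => u (ψ.symm z)) (transition φ ψ y)) (i : Fin 6) :
    (jac (transition φ ψ) y).det *
        fluxIn g φ (fun z => w (φ.symm z)) (fun z => u (φ.symm z)) i y =
      |(jac (transition φ ψ) y).det| * ∑ k, (jac (transition φ ψ) y).adjugate i k *
        fluxIn g ψ (fun z => w (ψ.symm z)) (fun z => u (ψ.symm z)) k (transition φ ψ y) := by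
  set J := jac (transition φ ψ) y
  set du : Fin 6 → ℝ := fun k => pd k (fun z => u (ψ.symm z)) (transition φ ψ y)
  have flux_eq : fluxIn g φ (fun z => w (φ.symm z)) (fun z => u (φ.symm z)) i y =
      gDensity g φ y * w (φ.symm y) * ((gMat g φ y)⁻¹ *ᵥ (Jᵀ *ᵥ du)) i := by
    rw [← pd_comp_symm hφ hψ hy hu]
    rfl
  have sum_eq : ∑ k, J.adjugate i k *
        fluxIn g ψ (fun z => w (ψ.symm z)) (fun z => u (ψ.symm z)) k (transition φ ψ y) =
      gDensity g ψ (transition φ ψ y) * w (φ.symm y) *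
        (J.adjugate *ᵥ ((gMat g ψ (transition φ ψ y))⁻¹ *ᵥ du)) i := by
    rw [Matrix.mulVec, dotProduct, Finset.mul_sum]
    refine Finset.sum_congr rfl fun k _ => ?_
    rw [fluxIn, symm_transition hy, mul_left_comm]
    rfl
  rw [flux_eq, sum_eq, Matrix.mulVec_mulVec, Matrix.mulVec_mulVec,
    adjugate_jac_transition_mul_gMat_inv g hφ hψ hy, Matrix.smul_mulVec, Pi.smul_apply,
    smul_eq_mul, gDensity_transition g hφ hψ hy]
  ring

theorem differentiableAt_fluxIn (hφ : φ ∈ atlas E6 M) (hy : y ∈ φ.target) {w u : E6 → ℝ}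
    (hw : DifferentiableAt ℝ w y) (hu : ContDiffAt ℝ 2 u y) (i : Fin 6) :
    DifferentiableAt ℝ (fluxIn g φ w u i) y := by
  have hn := φ.open_target.mem_nhds hy
  have density_diff : DifferentiableAt ℝ (gDensity g φ) y :=
    ((contDiffOn_gDensity g hφ).contDiffAt hn).differentiableAt (by simp)
  refine (density_diff.mul hw).mul (DifferentiableAt.fun_sum fun j _ => ?_)
  have inv_diff : DifferentiableAt ℝ (fun y => (gMat g φ y)⁻¹ i j) y :=
    ((contDiffOn_gMat_inv g hφ i j).contDiffAt hn).differentiableAt (by simp)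
  have pd_contDiff : ContDiffAt ℝ 1 (pd j u) y :=
    (hu.fderiv_right (m := 1) (by norm_num)).clm_apply contDiffAt_const
  exact inv_diff.mul (pd_contDiff.differentiableAt one_ne_zero)

theorem exists_fluxIn_eventuallyEq (hφ : φ ∈ atlas E6 M) (hψ : ψ ∈ atlas E6 M)
    (hy : y ∈ (transition φ ψ).source) (w : M → ℝ)
    (hu : ∀ᶠ z in 𝓝 (transition φ ψ y), DifferentiableAt ℝ (fun z => u (ψ.symm z)) z) :
    ∃ ε : ℝ, |(jac (transition φ ψ) y).det| = ε * (jac (transition φ ψ) y).det ∧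
      ∀ i, fluxIn g φ (fun z => w (φ.symm z)) (fun z => u (φ.symm z)) i =ᶠ[𝓝 y]
        fun z => ε * ∑ k, (jac (transition φ ψ) z).adjugate i k *
          fluxIn g ψ (fun z => w (ψ.symm z)) (fun z => u (ψ.symm z)) k (transition φ ψ z) := by
  have hτ := contDiffAt_two_transition hφ hψ hy
  obtain ⟨ε, hε⟩ := exists_eventually_abs_eq_mul
    (differentiableAt_det (differentiableAt_jac hτ)).continuousAt
    (isUnit_det_jac_transition hφ hψ hy).ne_zero
  refine ⟨ε, hε.self_of_nhds, fun i => ?_⟩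
  filter_upwards [hε, hτ.continuousAt.eventually hu, (transition φ ψ).open_source.mem_nhds hy]
    with z abs_eq hu_z hz
  have flux_eq := fluxIn_transition g hφ hψ hz w hu_z i
  rw [abs_eq, mul_comm ε, mul_assoc] at flux_eq
  exact mul_left_cancel₀ (isUnit_det_jac_transition hφ hψ hz).ne_zero flux_eq

theorem divIn_transition (hφ : φ ∈ atlas E6 M) (hψ : ψ ∈ atlas E6 M)
    (hy : y ∈ (transition φ ψ).source)
    (hw : DifferentiableAt ℝ (fun z => w (ψ.symm z)) (transition φ ψ y))
    (hu : ContDiffAt ℝ 2 (fun z => u (ψ.symm z)) (transition φ ψ y)) :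
    divIn g φ (fun z => w (φ.symm z)) (fun z => u (φ.symm z)) y =
      divIn g ψ (fun z => w (ψ.symm z)) (fun z => u (ψ.symm z)) (transition φ ψ y) := by
  have hdet := (isUnit_det_jac_transition hφ hψ hy).ne_zero
  obtain ⟨ε, hε, flux_eq⟩ := exists_fluxIn_eventuallyEq g hφ hψ hy w
    ((hu.eventually (by simp)).mono fun z hz => hz.differentiableAt two_ne_zero)
  have sum_pd_flux : ∑ i, pd i (fluxIn g φ (fun z => w (φ.symm z)) (fun z => u (φ.symm z)) i) y =
      |(jac (transition φ ψ) y).det| * ∑ k, pd k (fluxIn g ψ (fun z => w (ψ.symm z))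
        (fun z => u (ψ.symm z)) k) (transition φ ψ y) := by
    rw [hε, mul_assoc, ← sum_pd_adjugate_jac_mul_comp (contDiffAt_two_transition hφ hψ hy) hdet
      (differentiableAt_fluxIn g hψ (ψ.map_source hy.2) hw hu), Finset.mul_sum]
    exact Finset.sum_congr rfl fun i _ => by rw [pd_congr (flux_eq i), pd_const_mul]
  rw [divIn, divIn, sum_pd_flux, gDensity_transition g hφ hψ hy, mul_inv_rev, mul_assoc,
    inv_mul_cancel_left₀ (abs_ne_zero.2 hdet)]

theorem Form.comp_transition {p : ℕ} (F : Form M p) (hφ : φ ∈ atlas E6 M) (hψ : ψ ∈ atlas E6 M)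
    (hy : y ∈ (transition φ ψ).source) :
    (fun i => F.comp φ i y) = tensorPower p (jac (transition φ ψ) y)ᵀ *ᵥ
      fun i => F.comp ψ i (transition φ ψ y) := by
  ext i
  simp only [Matrix.mulVec, dotProduct, tensorPower, Matrix.of_apply, Matrix.transpose_apply,
    F.comp_eq_atE (rfl : φ.symm y = _), F.comp_eq_atE (symm_transition hy),
    coordVecE_transition hφ hψ hy]
  set L := (F.atE (φ.symm y)).toMultilinearMap
  exact (L.map_sum fun (k : Fin p) (l : Fin 6) => jac (transition φ ψ) y l (i k) •
    coordVecE ψ (transition φ ψ y) l).trans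
      (Finset.sum_congr rfl fun m _ => L.map_smul_univ _ _)

theorem Form.normSqIn_transition {p : ℕ} (F : Form M p) (hφ : φ ∈ atlas E6 M)
    (hψ : ψ ∈ atlas E6 M) (hy : y ∈ (transition φ ψ).source) :
    F.normSqIn g φ y = F.normSqIn g ψ (transition φ ψ y) := by
  rw [normSqIn_eq_dotProduct, normSqIn_eq_dotProduct, F.comp_transition hφ hψ hy,
    dotProduct_tensorPower_mulVec, gMat_inv_transition g hφ hψ hy]

theorem gradDot_symm (hφ : φ ∈ atlas E6 M) (hy : y ∈ φ.target)
    (hu : DifferentiableAt ℝ (fun z => u (φ.symm z)) y)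
    (hw : DifferentiableAt ℝ (fun z => w (φ.symm z)) y) :
    gradDot g u w (φ.symm y) = gradIn g φ (fun z => u (φ.symm z)) (fun z => w (φ.symm z)) y := by
  have e := transition_chartAt hy
  have := gradIn_transition g (chart_mem_atlas E6 (φ.symm y)) hφ (chartAt_mem_transition_source hy)
    (u := u) (w := w) (by rwa [e]) (by rwa [e])
  rwa [e] at this

theorem divGrad_symm (hφ : φ ∈ atlas E6 M) (hy : y ∈ φ.target)
    (hw : DifferentiableAt ℝ (fun z => w (φ.symm z)) y)
    (hu : ContDiffAt ℝ 2 (fun z => u (φ.symm z)) y) :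
    divGrad g w u (φ.symm y) = divIn g φ (fun z => w (φ.symm z)) (fun z => u (φ.symm z)) y := by
  have e := transition_chartAt hy
  have := divIn_transition g (chart_mem_atlas E6 (φ.symm y)) hφ (chartAt_mem_transition_source hy)
    (u := u) (w := w) (by rwa [e]) (by rwa [e])
  rwa [e] at this

theorem Form.normSq_symm {p : ℕ} (F : Form M p) (hφ : φ ∈ atlas E6 M) (hy : y ∈ φ.target) :
    F.normSq g (φ.symm y) = F.normSqIn g φ y := by
  have := F.normSqIn_transition g (chart_mem_atlas E6 (φ.symm y)) hφ
    (chartAt_mem_transition_source hy)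
  rwa [transition_chartAt hy] at this

theorem Form.normSq_nonneg {p : ℕ} (F : Form M p) (x : M) : 0 ≤ F.normSq g x := by
  have normSq_eq : F.normSq g x = F.normSqIn g (chartAt E6 x) (chartAt E6 x x) := rfl
  rw [normSq_eq, normSqIn_eq_dotProduct]
  have posDef := gMat_posDef g (chart_mem_atlas E6 x)
    ((chartAt E6 x).map_source (mem_chart_source E6 x))
  exact mul_nonneg (by positivity)
    ((posSemidef_tensorPower posDef.inv.posSemidef).dotProduct_mulVec_nonneg _)

end Invariance

/-! ### Sobolev functions on the manifold -/

section SobolevManifold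

variable {M : Type*} [TopologicalSpace M] [ChartedSpace E6 M] [IsManifold (𝓡 6) ∞ M]
  (g : Metric6 M) {s t : ℝ} {φ : OpenPartialHomeomorph M E6}

theorem MemHsLoc.fluxIn {w u : E6 → ℝ} (hs : 4 < s) (hφ : φ ∈ atlas E6 M)
    (hw : MemHsLoc s φ.target w) (hu : MemHsLoc s φ.target u) (i : Fin 6) :
    MemHsLoc (s - 1) φ.target (fluxIn g φ w u i) := by
  have hU := φ.open_target
  have h3 : (Module.finrank ℝ E6 : ℝ) / 2 < s - 1 := by linarith [half_finrank_E6]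
  exact ((MemHsLoc.of_smooth hU (contDiffOn_gDensity g hφ)).mul hU h3
    (hw.mono (by linarith))).mul hU h3 (MemHsLoc.sum hU _ fun j _ =>
      (MemHsLoc.of_smooth hU (contDiffOn_gMat_inv g hφ i j)).mul hU h3 (hu.pd hU hs j))

theorem MemHsLoc.divIn {w u : E6 → ℝ} (hs : 5 < s) (hφ : φ ∈ atlas E6 M)
    (hw : MemHsLoc s φ.target w) (hu : MemHsLoc s φ.target u) :
    MemHsLoc (s - 2) φ.target (divIn g φ w u) := by
  have hU := φ.open_target
  have density_inv : ContDiffOn ℝ ∞ (fun y => (gDensity g φ y)⁻¹) φ.target :=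
    (contDiffOn_gDensity g hφ).inv fun y hy => (gDensity_pos g hφ hy).ne'
  refine (MemHsLoc.of_smooth hU density_inv).mul hU (by linarith [half_finrank_E6])
    (MemHsLoc.sum hU _ fun i _ => ?_)
  rw [show s - 2 = s - 1 - 1 by ring]
  exact (hw.fluxIn g (by linarith) hφ hu i).pd hU (by linarith) i

variable [T2Space M] [CompactSpace M]

namespace MemHs

variable {f h : M → ℝ}

theorem const (c : ℝ) : MemHs s fun _ : M => c :=
  memHs_iff.2 fun φ _ => MemHsLoc.const φ.open_target c

theorem mono (hf : MemHs t f) (hst : s ≤ t) : MemHs s f :=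
  memHs_iff.2 fun φ hφ => (memHs_iff.1 hf φ hφ).mono hst

theorem add (hf : MemHs s f) (hh : MemHs s h) : MemHs s fun x => f x + h x :=
  memHs_iff.2 fun φ hφ => (memHs_iff.1 hf φ hφ).add φ.open_target (memHs_iff.1 hh φ hφ)

theorem const_mul (c : ℝ) (hf : MemHs s f) : MemHs s fun x => c * f x :=
  memHs_iff.2 fun φ hφ => (memHs_iff.1 hf φ hφ).const_mul φ.open_target c

theorem sub (hf : MemHs s f) (hh : MemHs s h) : MemHs s fun x => f x - h x := by
  simpa only [neg_one_mul, ← sub_eq_add_neg] using hf.add (hh.const_mul (-1))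

theorem mul (hs : 3 < s) (hf : MemHs s f) (hh : MemHs s h) : MemHs s fun x => f x * h x :=
  memHs_iff.2 fun φ hφ =>
    (memHs_iff.1 hf φ hφ).mul φ.open_target (half_finrank_E6.trans_lt hs) (memHs_iff.1 hh φ hφ)

theorem pow (hs : 3 < s) (hf : MemHs s f) (n : ℕ) : MemHs s fun x => f x ^ n := by
  induction n with
  | zero => simpa only [pow_zero] using const 1
  | succ n ih => simpa only [pow_succ] using ih.mul hs hf

theorem inv (hs : 11 < s) (hf : MemHs s f) (h0 : ∀ x, f x ≠ 0) : MemHs s fun x => (f x)⁻¹ :=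
  memHs_iff.2 fun φ hφ => (memHs_iff.1 hf φ hφ).inv φ.open_target
    (by linarith [half_finrank_E6]) fun y _ => h0 (φ.symm y)

variable {y : E6}

theorem contDiffOn {n : ℕ} (hn : 3 + n < s) (hf : MemHs s f) (hφ : φ ∈ atlas E6 M) :
    ContDiffOn ℝ n (fun y => f (φ.symm y)) φ.target :=
  (memHs_iff.1 hf φ hφ).contDiffOn φ.open_target (by rwa [half_finrank_E6])

theorem contDiffAt_two (hs : 5 < s) (hf : MemHs s f) (hφ : φ ∈ atlas E6 M) (hy : y ∈ φ.target) :
    ContDiffAt ℝ 2 (fun y => f (φ.symm y)) y :=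
  (hf.contDiffOn (n := 2) (by norm_num; linarith) hφ).contDiffAt (φ.open_target.mem_nhds hy)

theorem differentiableAt (hs : 5 < s) (hf : MemHs s f) (hφ : φ ∈ atlas E6 M)
    (hy : y ∈ φ.target) : DifferentiableAt ℝ (fun y => f (φ.symm y)) y :=
  (hf.contDiffAt_two hs hφ hy).differentiableAt two_ne_zero

theorem contMDiff {n : ℕ} (hn : 3 + n < s) (hf : MemHs s f) :
    ContMDiff (𝓡 6) 𝓘(ℝ, ℝ) n f := by
  intro x
  have hx := mem_chart_source E6 x
  set φ := chartAt E6 x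
  have contMDiffAt_symm : ContMDiffAt 𝓘(ℝ, E6) 𝓘(ℝ, ℝ) n (fun y => f (φ.symm y)) (φ x) :=
    ((hf.contDiffOn hn (chart_mem_atlas E6 x)).contDiffAt
      (φ.open_target.mem_nhds (φ.map_source hx))).contMDiffAt
  have contMDiffAt_chart : ContMDiffAt (𝓡 6) 𝓘(ℝ, E6) n φ x :=
    ((contMDiffOn_chart_of_mem_atlas (chart_mem_atlas E6 x)).contMDiffAt
      (φ.open_source.mem_nhds hx)).of_le (mod_cast le_top)
  refine (contMDiffAt_symm.comp x contMDiffAt_chart).congr_of_eventuallyEq ?_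
  filter_upwards [φ.open_source.mem_nhds hx] with z hz
  rw [Function.comp_apply, φ.left_inv hz]

theorem gradDot (hs : 5 < s) (hf : MemHs s f) (hh : MemHs s h) :
    MemHs (s - 1) (gradDot g f h) := by
  refine memHs_iff.2 fun φ hφ => MemHsLoc.congr ?_ fun y hy =>
    gradDot_symm g hφ hy (hf.differentiableAt hs hφ hy) (hh.differentiableAt hs hφ hy)
  have hU := φ.open_target
  have h3 : (Module.finrank ℝ E6 : ℝ) / 2 < s - 1 := by linarith [half_finrank_E6]
  refine MemHsLoc.sum hU _ fun i _ => MemHsLoc.sum hU _ fun j _ => ?_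
  exact ((MemHsLoc.of_smooth hU (contDiffOn_gMat_inv g hφ i j)).mul hU h3
    ((memHs_iff.1 hf φ hφ).pd hU (by linarith) i)).mul hU h3
    ((memHs_iff.1 hh φ hφ).pd hU (by linarith) j)

end MemHs

theorem MemHs.divGrad {f h : M → ℝ} (hs : 5 < s) (hf : MemHs s f) (hh : MemHs s h) :
    MemHs (s - 2) (divGrad g f h) :=
  memHs_iff.2 fun φ hφ => ((memHs_iff.1 hf φ hφ).divIn g hs hφ (memHs_iff.1 hh φ hφ)).congr
    fun _ hy => divGrad_symm g hφ hy (hf.differentiableAt hs hφ hy) (hh.contDiffAt_two hs hφ hy)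

theorem MemHs.laplace {f : M → ℝ} (hs : 5 < s) (hf : MemHs s f) :
    MemHs (s - 2) (laplace g f) :=
  (MemHs.const 1).divGrad g hs hf

theorem Form.MemHs.normSq (hs : 3 < s) {p : ℕ} {F : Form M p} (hF : F.MemHs s) :
    Warped.MemHs s (F.normSq g) := by
  refine Warped.memHs_iff.2 fun φ hφ => MemHsLoc.congr ?_ fun y hy => F.normSq_symm g hφ hy
  have hU := φ.open_target
  have h3 := half_finrank_E6.trans_lt hs
  refine MemHsLoc.const_mul hU _ (MemHsLoc.sum hU _ fun i _ => MemHsLoc.sum hU _ fun j _ => ?_)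
  exact ((MemHsLoc.prod hU h3 _ fun k _ => MemHsLoc.of_smooth hU
    (contDiffOn_gMat_inv g hφ _ _)).mul hU h3 (Form.memHs_iff.1 hF φ hφ i)).mul hU h3
    (Form.memHs_iff.1 hF φ hφ j)

end SobolevManifold

/-! ### Leibniz rules -/

section Leibniz

variable {M : Type*} [TopologicalSpace M] [ChartedSpace E6 M] [IsManifold (𝓡 6) ∞ M]
  (g : Metric6 M) {φ : OpenPartialHomeomorph M E6} {y : E6}

theorem gradIn_comm (hφ : φ ∈ atlas E6 M) (hy : y ∈ φ.target) (A B : E6 → ℝ) :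
    gradIn g φ A B y = gradIn g φ B A y := by
  have inv_symm : ((gMat g φ y)⁻¹).transpose = (gMat g φ y)⁻¹ := by
    rw [← Matrix.conjTranspose_eq_transpose_of_trivial]
    exact (gMat_posDef g hφ hy).inv.isHermitian
  rw [gradIn_eq_dotProduct, gradIn_eq_dotProduct, Matrix.dotProduct_mulVec,
    ← Matrix.mulVec_transpose, inv_symm, dotProduct_comm]

theorem sum_pd_mul_fluxIn (hφ : φ ∈ atlas E6 M) (hy : y ∈ φ.target) (w A B : E6 → ℝ) :
    (gDensity g φ y)⁻¹ * ∑ i, pd i A y * fluxIn g φ w B i y = w y * gradIn g φ A B y := by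
  have density_ne := (gDensity_pos g hφ hy).ne'
  simp only [fluxIn, gradIn, Finset.mul_sum]
  refine Finset.sum_congr rfl fun i _ => Finset.sum_congr rfl fun j _ => ?_
  field_simp

theorem fluxIn_mul {w A B : E6 → ℝ} (hA : DifferentiableAt ℝ A y) (hB : DifferentiableAt ℝ B y)
    (i : Fin 6) : fluxIn g φ w (fun z => A z * B z) i y =
      A y * fluxIn g φ w B i y + B y * fluxIn g φ w A i y := by
  simp only [fluxIn, pd_mul hA hB, Finset.mul_sum, ← Finset.sum_add_distrib]
  exact Finset.sum_congr rfl fun j _ => by ring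

theorem pd_fluxIn_mul (hφ : φ ∈ atlas E6 M) (hy : y ∈ φ.target) {w A B : E6 → ℝ}
    (hw : DifferentiableAt ℝ w y) (hA : ContDiffAt ℝ 2 A y) (hB : ContDiffAt ℝ 2 B y)
    (i : Fin 6) :
    pd i (fluxIn g φ w (fun z => A z * B z) i) y =
      (pd i A y * fluxIn g φ w B i y + A y * pd i (fluxIn g φ w B i) y) +
      (pd i B y * fluxIn g φ w A i y + B y * pd i (fluxIn g φ w A i) y) := by
  have diff_A := hA.differentiableAt two_ne_zero
  have diff_B := hB.differentiableAt two_ne_zero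
  have flux_A := differentiableAt_fluxIn g hφ hy hw hA i
  have flux_B := differentiableAt_fluxIn g hφ hy hw hB i
  have flux_mul : fluxIn g φ w (fun z => A z * B z) i =ᶠ[𝓝 y]
      fun z => A z * fluxIn g φ w B i z + B z * fluxIn g φ w A i z := by
    filter_upwards [hA.eventually (by simp), hB.eventually (by simp)] with z hAz hBz
    exact fluxIn_mul g (hAz.differentiableAt two_ne_zero) (hBz.differentiableAt two_ne_zero) i
  rw [pd_congr flux_mul, pd_add (diff_A.fun_mul flux_B) (diff_B.fun_mul flux_A),
    pd_mul diff_A flux_B, pd_mul diff_B flux_A]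

theorem divIn_mul (hφ : φ ∈ atlas E6 M) (hy : y ∈ φ.target) {w A B : E6 → ℝ}
    (hw : DifferentiableAt ℝ w y) (hA : ContDiffAt ℝ 2 A y) (hB : ContDiffAt ℝ 2 B y) :
    divIn g φ w (fun z => A z * B z) y =
      A y * divIn g φ w B y + B y * divIn g φ w A y + 2 * (w y * gradIn g φ A B y) := by
  have grad_AB := sum_pd_mul_fluxIn g hφ hy w A B
  have grad_BA := sum_pd_mul_fluxIn g hφ hy w B A
  rw [gradIn_comm g hφ hy B A] at grad_BA
  simp only [divIn, pd_fluxIn_mul g hφ hy hw hA hB, Finset.sum_add_distrib, mul_add, grad_AB,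
    grad_BA, ← Finset.mul_sum]
  ring

variable {x : M} {f h k : M → ℝ}

theorem gradDot_mul_right
    (hh : DifferentiableAt ℝ (fun y => h ((chartAt E6 x).symm y)) (chartAt E6 x x))
    (hk : DifferentiableAt ℝ (fun y => k ((chartAt E6 x).symm y)) (chartAt E6 x x)) :
    gradDot g f (fun z => h z * k z) x = h x * gradDot g f k x + k x * gradDot g f h x := by
  simp only [gradDot, pd_mul hh hk, (chartAt E6 x).left_inv (mem_chart_source E6 x),
    Finset.mul_sum, ← Finset.sum_add_distrib]
  exact Finset.sum_congr rfl fun i _ => Finset.sum_congr rfl fun j _ => by ring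

theorem laplace_mul
    (hf : ContDiffAt ℝ 2 (fun y => f ((chartAt E6 x).symm y)) (chartAt E6 x x))
    (hh : ContDiffAt ℝ 2 (fun y => h ((chartAt E6 x).symm y)) (chartAt E6 x x)) :
    laplace g (fun z => f z * h z) x =
      f x * laplace g h x + h x * laplace g f x + 2 * gradDot g f h x := by
  have mul_eq := divIn_mul g (chart_mem_atlas E6 x)
    ((chartAt E6 x).map_source (mem_chart_source E6 x)) (differentiableAt_const (1 : ℝ)) hf hh
  rwa [one_mul, (chartAt E6 x).left_inv (mem_chart_source E6 x)] at mul_eq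

end Leibniz

/-! ### The volume measure -/

section Volume

variable {M : Type*} [TopologicalSpace M] [ChartedSpace E6 M] [IsManifold (𝓡 6) ∞ M]
  (g : Metric6 M) [T2Space M] [CompactSpace M]

/-- The density in the chart at `c` of the part of the volume measure cut out by `ρ_c`. -/
def volDensity (c : M) (y : E6) : ℝ :=
  chartPartition M c ((chartAt E6 c).symm y) * gDensity g (chartAt E6 c) y

theorem tsupport_chartPartition (c : M) :
    tsupport (chartPartition M c) ⊆ (chartAt E6 c).source :=
  (SmoothPartitionOfUnity.exists_isSubordinate_chartAt_source (𝓡 6) M).choose_spec c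

theorem continuousOn_volDensity (c : M) : ContinuousOn (volDensity g c) (chartAt E6 c).target :=
  ((chartPartition M c).contMDiff.continuous.comp_continuousOn
    (chartAt E6 c).continuousOn_symm).mul
    (contDiffOn_gDensity g (chart_mem_atlas E6 c)).continuousOn

theorem exists_isCompact_volDensity_eq_zero (c : M) : ∃ K : Set E6, IsCompact K ∧
    K ⊆ (chartAt E6 c).target ∧ ∀ y ∈ (chartAt E6 c).target, y ∉ K → volDensity g c y = 0 := by
  refine ⟨chartAt E6 c '' tsupport (chartPartition M c), ?_, ?_, fun y hy hyK => ?_⟩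
  · exact (isClosed_tsupport _).isCompact.image_of_continuousOn
      ((chartAt E6 c).continuousOn.mono (tsupport_chartPartition c))
  · exact image_subset_iff.2 fun x hx => (chartAt E6 c).map_source (tsupport_chartPartition c hx)
  · have partition_eq : chartPartition M c ((chartAt E6 c).symm y) = 0 := by
      by_contra hne
      exact hyK ⟨_, subset_tsupport _ hne, (chartAt E6 c).right_inv hy⟩
    rw [volDensity, partition_eq, zero_mul]

variable [MeasurableSpace M]

/-- The summand of the volume measure belonging to the chart at `c`. -/
def volPiece (c : M) : Measure M :=
  (((volume : Measure E6).restrict (chartAt E6 c).target).withDensity fun y =>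
    ENNReal.ofReal (volDensity g c y)).map (chartAt E6 c).symm

theorem vol_eq_sum [BorelSpace M] : vol g = Measure.sum (volPiece g) := rfl

variable [BorelSpace M]

theorem volPiece_univ (c : M) :
    volPiece g c univ = ∫⁻ y in (chartAt E6 c).target, ENNReal.ofReal (volDensity g c y) := by
  have measurable_symm : AEMeasurable (chartAt E6 c).symm
      (((volume : Measure E6).restrict (chartAt E6 c).target).withDensity fun y =>
        ENNReal.ofReal (volDensity g c y)) :=
    ((chartAt E6 c).continuousOn_symm.aemeasurable
      (chartAt E6 c).open_target.measurableSet).mono_ac (withDensity_absolutelyContinuous _ _)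
  rw [volPiece, Measure.map_apply_of_aemeasurable measurable_symm MeasurableSet.univ,
    preimage_univ, withDensity_apply _ MeasurableSet.univ, Measure.restrict_univ]

theorem volPiece_univ_lt_top (c : M) : volPiece g c univ < ⊤ := by
  obtain ⟨K, hK, hKt, density_eq_zero⟩ := exists_isCompact_volDensity_eq_zero g c
  obtain ⟨B, hB⟩ := hK.exists_bound_of_continuousOn ((continuousOn_volDensity g c).mono hKt)
  rw [volPiece_univ]
  calc ∫⁻ y in (chartAt E6 c).target, ENNReal.ofReal (volDensity g c y)
    _ ≤ ∫⁻ y in (chartAt E6 c).target, K.indicator (fun _ => ENNReal.ofReal B) y := by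
      refine setLIntegral_mono' (chartAt E6 c).open_target.measurableSet fun y hy => ?_
      by_cases hyK : y ∈ K
      · rw [indicator_of_mem hyK]
        exact ENNReal.ofReal_le_ofReal ((le_abs_self _).trans (hB y hyK))
      · rw [density_eq_zero y hy hyK, ENNReal.ofReal_zero]
        exact zero_le
    _ = ENNReal.ofReal B * (volume.restrict (chartAt E6 c).target) K := by
      rw [lintegral_indicator_const hK.measurableSet]
    _ < ⊤ := ENNReal.mul_lt_top ENNReal.ofReal_lt_top
      ((Measure.restrict_apply_le _ _).trans_lt hK.measure_lt_top)

theorem volPiece_univ_pos {c x : M} (hx : 0 < chartPartition M c x) : 0 < volPiece g c univ := by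
  set φ := chartAt E6 c with hφ
  have mem_source : x ∈ φ.source := tsupport_chartPartition c (subset_tsupport _ hx.ne')
  have mem_target : φ x ∈ φ.target := φ.map_source mem_source
  have density_pos : 0 < volDensity g c (φ x) := by
    rw [volDensity, ← hφ, φ.left_inv mem_source]
    exact mul_pos hx (gDensity_pos g (chart_mem_atlas E6 c) mem_target)
  have eventually_pos : ∀ᶠ y in 𝓝 (φ x), y ∈ φ.target ∧ 0 < volDensity g c y :=
    (φ.open_target.eventually_mem mem_target).and
      (((continuousOn_volDensity g c).continuousAt
        (φ.open_target.mem_nhds mem_target)).eventually_const_lt density_pos)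
  have measurable_density : AEMeasurable (fun y => ENNReal.ofReal (volDensity g c y))
      (volume.restrict φ.target) :=
    ((continuousOn_volDensity g c).aemeasurable φ.open_target.measurableSet).ennreal_ofReal
  rw [volPiece_univ, pos_iff_ne_zero, ne_eq, lintegral_eq_zero_iff' measurable_density,
    EventuallyEq, ae_restrict_iff' φ.open_target.measurableSet]
  intro ae_eq_zero
  refine (Measure.measure_pos_of_mem_nhds volume eventually_pos).ne'
    (measure_mono_null ?_ (ae_iff.1 ae_eq_zero))
  exact fun y hy h => (ENNReal.ofReal_pos.2 hy.2).ne' (h hy.1)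

instance isFiniteMeasure_vol : IsFiniteMeasure (vol g) := by
  have finite_support : {c : M | (Function.support (chartPartition M c)).Nonempty}.Finite :=
    (chartPartition M).locallyFinite.finite_nonempty_of_compact
  refine ⟨?_⟩
  rw [vol_eq_sum, Measure.sum_apply _ MeasurableSet.univ,
    tsum_eq_sum (s := finite_support.toFinset)]
  · exact ENNReal.sum_lt_top.2 fun c _ => volPiece_univ_lt_top g c
  · intro c hc
    have partition_eq (x : M) : chartPartition M c x = 0 := by
      by_contra hx
      exact hc (finite_support.mem_toFinset.2 ⟨x, hx⟩)
    simp only [volPiece_univ, volDensity, partition_eq, zero_mul, ENNReal.ofReal_zero,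
      lintegral_zero]

theorem vol_univ_pos [Nonempty M] : 0 < vol g univ := by
  obtain ⟨x⟩ := ‹Nonempty M›
  obtain ⟨c, hc⟩ := (chartPartition M).exists_pos_of_mem (mem_univ x)
  exact (volPiece_univ_pos g hc).trans_le (Measure.le_sum (volPiece g) c univ)

theorem integrable_of_continuous {f : M → ℝ} (hf : Continuous f) : Integrable f (vol g) :=
  hf.integrable_of_hasCompactSupport (HasCompactSupport.of_compactSpace f)

end Volume

/-! ### Sobolev neighbourhoods are `C²` neighbourhoods -/

namespace IsSobolev

variable {E F : Type*} [NormedAddCommGroup E] [InnerProductSpace ℝ E] [FiniteDimensional ℝ E]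
  [MeasurableSpace E] [BorelSpace E] [NormedAddCommGroup F] [NormedSpace ℂ F] {s : ℝ}

theorem eventually_forall_fderiv_apply {p : (E → F) → Prop}
    (hp : ∀ᶠ ε in 𝓝 (0 : ENNReal), ∀ f, IsSobolev s f → sobolevSq s f ≤ ε → p f) (v : E) :
    ∀ᶠ ε in 𝓝 (0 : ENNReal), ∀ f, IsSobolev (s + 1) f → sobolevSq (s + 1) f ≤ ε →
      ContDiff ℝ 1 f → HasCompactSupport f → p fun y => fderiv ℝ f y v := by
  have tendsto_zero :
      Tendsto (fun ε => ENNReal.ofReal (2 * Real.pi * ‖v‖) ^ 2 * ε) (𝓝 0) (𝓝 0) := by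
    simpa using ENNReal.Tendsto.const_mul (b := 0) tendsto_id (Or.inr (by simp))
  filter_upwards [tendsto_zero.eventually hp] with ε hε f hf hfε hd hc
  have integrable_fderiv : Integrable (fderiv ℝ f) :=
    (hd.continuous_fderiv one_ne_zero).integrable_of_hasCompactSupport (hc.fderiv ℝ)
  exact hε _ (hf.fderiv_apply hd integrable_fderiv v)
    ((sobolevSq_fderiv_apply_le s hf.integrable (hd.differentiable one_ne_zero) integrable_fderiv
      v).trans (by gcongr))

theorem eventually_forall_norm_le [CompleteSpace F] {δ : ℝ}
    (hs : (Module.finrank ℝ E : ℝ) / 2 < s) (hδ : 0 < δ) :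
    ∀ᶠ ε in 𝓝 (0 : ENNReal), ∀ f : E → F, IsSobolev s f → sobolevSq s f ≤ ε → ∀ y, ‖f y‖ ≤ δ := by
  set C : ENNReal := ∫⁻ ξ : E, bracket ξ ^ (-(s * 2))
  have C_lt_top : C < ⊤ := lintegral_bracket_rpow_lt_top _ (by linarith)
  have tendsto_zero : Tendsto (fun ε => C * ε) (𝓝 0) (𝓝 0) := by
    simpa using ENNReal.Tendsto.const_mul (b := 0) tendsto_id (Or.inr C_lt_top.ne)
  filter_upwards [tendsto_zero.eventually_le_const (ENNReal.ofReal_pos.2 (pow_pos hδ 2))]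
    with ε hε f hf hfε y
  have : ‖f y‖ₑ ^ 2 ≤ ENNReal.ofReal (δ ^ 2) :=
    (hf.enorm_sq_le hs y).trans ((mul_le_mul_right hfε C).trans hε)
  rw [← ofReal_norm, ← ENNReal.ofReal_pow (norm_nonneg _),
    ENNReal.ofReal_le_ofReal_iff (by positivity)] at this
  exact (pow_le_pow_iff_left₀ (norm_nonneg _) hδ.le two_ne_zero).1 this

end IsSobolev

/-- The function `h` and its coordinate derivatives of order at most two are bounded by `ε` at the
point `y`. -/
structure IsC2LeAt (ε : ℝ) (h : E6 → ℝ) (y : E6) : Prop where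
  abs_le : |h y| ≤ ε
  abs_pd_le : ∀ i, |pd i h y| ≤ ε
  abs_pd_pd_le : ∀ i j, |pd i (pd j h) y| ≤ ε

theorem IsC2LeAt.congr {ε : ℝ} {h k : E6 → ℝ} {y : E6} (hh : IsC2LeAt ε h y) (e : h =ᶠ[𝓝 y] k) :
    IsC2LeAt ε k y where
  abs_le := e.self_of_nhds ▸ hh.abs_le
  abs_pd_le i := pd_congr e i ▸ hh.abs_pd_le i
  abs_pd_pd_le i j :=
    pd_congr (e.eventuallyEq_nhds.mono fun _ he => pd_congr he j) i ▸ hh.abs_pd_pd_le i j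

theorem eventually_forall_isC2LeAt_of_sobolevSq_le {s δ : ℝ} (hs : 5 < s) (hδ : 0 < δ) :
    ∀ᶠ ε in 𝓝 (0 : ENNReal), ∀ k : E6 → ℝ, ContDiff ℝ 2 k → HasCompactSupport k →
      IsSobolev s (fun y => (k y : ℂ)) → sobolevSq s (fun y => (k y : ℂ)) ≤ ε →
      ∀ y, IsC2LeAt δ k y := by
  have bound {r : ℝ} (hr : 3 < r) := IsSobolev.eventually_forall_norm_le (E := E6) (F := ℂ)
    (half_finrank_E6.trans_lt hr) hδ
  have bound_fderiv {r : ℝ} (hr : 3 < r) (i : Fin 6) :=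
    IsSobolev.eventually_forall_fderiv_apply (bound hr) (EuclideanSpace.single i (1 : ℝ))
  filter_upwards [bound (r := s) (by linarith),
    eventually_all.2 (bound_fderiv (r := s - 1) (by linarith)),
    eventually_all.2 fun i => eventually_all.2 fun j => IsSobolev.eventually_forall_fderiv_apply
      (bound_fderiv (r := s - 2) (by linarith) i) (EuclideanSpace.single j (1 : ℝ))]
    with ε hε₀ hε₁ hε₂ k hd hc hk hkε y
  rw [sub_add_cancel] at hε₁
  rw [show s - 2 + 1 + 1 = s by ring] at hε₂
  have ofReal_pd {h : E6 → ℝ} (hh : ContDiff ℝ 1 h) (i : Fin 6) :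
      (fun z => fderiv ℝ (fun y => (h y : ℂ)) z (EuclideanSpace.single i (1 : ℝ))) =
        fun z => ((pd i h z : ℝ) : ℂ) :=
    funext fun z => fderiv_ofReal_comp_apply ((hh.differentiable one_ne_zero) z) _
  have ofReal_contDiff {h : E6 → ℝ} (hh : ContDiff ℝ 1 h) : ContDiff ℝ 1 fun y => (h y : ℂ) :=
    Complex.ofRealCLM.contDiff.comp hh
  have ofReal_compact {h : E6 → ℝ} (hh : HasCompactSupport h) :
      HasCompactSupport fun y => (h y : ℂ) := hh.comp_left Complex.ofReal_zero
  have hd₁ : ContDiff ℝ 1 k := hd.of_le one_le_two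
  have pd_contDiff (i : Fin 6) : ContDiff ℝ 1 (pd i k) := contDiff_pd (mod_cast hd) i
  have norm_ofReal_pd {h : E6 → ℝ} (hh : ContDiff ℝ 1 h) (i : Fin 6) :
      ‖fderiv ℝ (fun y => (h y : ℂ)) y (EuclideanSpace.single i (1 : ℝ))‖ = |pd i h y| := by
    rw [congrFun (ofReal_pd hh i) y, Complex.norm_real, Real.norm_eq_abs]
  refine ⟨by simpa using hε₀ _ hk hkε y, fun i => ?_, fun i j => ?_⟩
  · simpa only [norm_ofReal_pd hd₁] using
      hε₁ i _ hk hkε (ofReal_contDiff hd₁) (ofReal_compact hc) y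
  · have := hε₂ i j _ hk hkε (ofReal_contDiff hd₁) (ofReal_compact hc)
    rw [ofReal_pd hd₁] at this
    simpa only [norm_ofReal_pd (pd_contDiff j)] using
      this (ofReal_contDiff (pd_contDiff j)) (ofReal_compact (hasCompactSupport_pd hc j)) y

theorem eventually_forall_isC2LeAt_of_hsNorm_lt {s δ : ℝ} (hs : 5 < s) (hδ : 0 < δ) :
    ∀ᶠ ε in 𝓝 (0 : ENNReal), ∀ (U : Set E6) (η h : E6 → ℝ), IsOpen U → IsTest U η →
      MemHsLoc s U h → hsNorm s (fun y => η y * h y) < ε →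
      ∀ y, (∀ᶠ z in 𝓝 y, η z = 1) → IsC2LeAt δ h y := by
  have tendsto_zero : Tendsto (fun ε : ENNReal => ε ^ 2) (𝓝 0) (𝓝 0) := by
    simpa using (ENNReal.continuous_pow 2).tendsto 0
  filter_upwards [tendsto_zero.eventually (eventually_forall_isC2LeAt_of_sobolevSq_le hs hδ)]
    with ε hε U η h hU hη hh norm_lt y hy
  have contDiffOn_h : ContDiffOn ℝ (2 : ℕ) h U :=
    hh.contDiffOn hU (by rw [half_finrank_E6]; norm_num; linarith)
  refine (hε _ (mod_cast hη.contDiff_mul hU contDiffOn_h) (hη.hasCompactSupport_mul h)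
    (hh.isSobolev hU hη) ?_ y).congr (hy.mono fun z hz => by simp only [hz, one_mul])
  rw [← hsNorm_sq_eq_sobolevSq]
  gcongr

theorem abs_sum_sum_mul_le {ι κ : Type*} [Fintype ι] [Fintype κ] {A B t : ι → κ → ℝ} {ε : ℝ}
    (hA : ∀ i j, |A i j| ≤ B i j) (ht : ∀ i j, |t i j| ≤ ε) :
    |∑ i, ∑ j, A i j * t i j| ≤ (∑ i, ∑ j, B i j) * ε := by
  simp only [Finset.sum_mul]
  refine (Finset.abs_sum_le_sum_abs _ _).trans (Finset.sum_le_sum fun i _ =>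
    (Finset.abs_sum_le_sum_abs _ _).trans (Finset.sum_le_sum fun j _ => ?_))
  rw [abs_mul]
  exact mul_le_mul (hA i j) (ht i j) (abs_nonneg _) ((abs_nonneg _).trans (hA i j))

section Neighbourhoods

variable {M : Type*} [TopologicalSpace M] [ChartedSpace E6 M] {φ : OpenPartialHomeomorph M E6}
  {s δ : ℝ} {f₀ : M → ℝ}

theorem eventually_memHs (s : ℝ) (f₀ : M → ℝ) : ∀ᶠ f in hsNhds s f₀, MemHs s f :=
  mem_inf_of_right (mem_principal_self _)

theorem eventually_locNorm_lt (s : ℝ) (f₀ : M → ℝ) (hφ : φ ∈ atlas E6 M) {χ : M → ℝ}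
    (hχ : χ ∈ Cutoff φ) {ε : ENNReal} (hε : 0 < ε) :
    ∀ᶠ f in hsNhds s f₀, locNorm s φ χ (fun y => f (φ.symm y) - f₀ (φ.symm y)) < ε :=
  mem_inf_of_left <| mem_iInf_of_mem φ <| mem_iInf_of_mem hφ <| mem_iInf_of_mem χ <|
    mem_iInf_of_mem hχ <| mem_iInf_of_mem ε <| mem_iInf_of_mem hε <| mem_principal_self _

variable [IsManifold (𝓡 6) ∞ M] (g : Metric6 M)

theorem divIn_one_eq (hφ : φ ∈ atlas E6 M) {y : E6} (hy : y ∈ φ.target) {u : E6 → ℝ}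
    (hu : ContDiffAt ℝ 2 u y) :
    divIn g φ (fun _ => 1) u y =
      ∑ i, ∑ j, (gDensity g φ y)⁻¹ * pd i (fun z => gDensity g φ z * (gMat g φ z)⁻¹ i j) y *
        pd j u y + ∑ i, ∑ j, (gMat g φ y)⁻¹ i j * pd i (pd j u) y := by
  have hn := φ.open_target.mem_nhds hy
  have density_ne_zero := (gDensity_pos g hφ hy).ne'
  have coefficient_diff (i j : Fin 6) :
      DifferentiableAt ℝ (fun z => gDensity g φ z * (gMat g φ z)⁻¹ i j) y :=
    (((contDiffOn_gDensity g hφ).mul (contDiffOn_gMat_inv g hφ i j)).contDiffAt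
      hn).differentiableAt (by simp)
  have pd_diff (j : Fin 6) : DifferentiableAt ℝ (pd j u) y :=
    ((hu.fderiv_right (m := 1) (by norm_num)).clm_apply contDiffAt_const).differentiableAt
      one_ne_zero
  have flux_eq (i : Fin 6) : fluxIn g φ (fun _ => 1) u i =
      fun z => ∑ j, gDensity g φ z * (gMat g φ z)⁻¹ i j * pd j u z := by
    ext z
    simp only [fluxIn, mul_one, Finset.mul_sum, mul_assoc]
  simp only [divIn, flux_eq, Finset.mul_sum, ← Finset.sum_add_distrib]
  refine Finset.sum_congr rfl fun i _ => ?_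
  rw [pd_sum _ fun j _ => (coefficient_diff i j).fun_mul (pd_diff j), Finset.mul_sum]
  refine Finset.sum_congr rfl fun j _ => ?_
  rw [pd_mul (coefficient_diff i j) (pd_diff j)]
  field_simp

theorem exists_forall_abs_gradIn_le (hφ : φ ∈ atlas E6 M) {K : Set E6} (hK : IsCompact K)
    (hKφ : K ⊆ φ.target) : ∃ C, ∀ y ∈ K, ∀ (ε : ℝ) (h : E6 → ℝ), IsC2LeAt ε h y →
      |gradIn g φ h h y| ≤ C * ε ^ 2 := by
  choose B hB using fun i j => hK.exists_bound_of_continuousOn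
    ((contDiffOn_gMat_inv g hφ i j).continuousOn.mono hKφ)
  refine ⟨∑ i, ∑ j, B i j, fun y hy ε h hh => ?_⟩
  simp only [gradIn, mul_assoc]
  refine abs_sum_sum_mul_le (fun i j => hB i j y hy) fun i j => ?_
  rw [abs_mul, sq]
  exact mul_le_mul (hh.abs_pd_le i) (hh.abs_pd_le j) (abs_nonneg _)
    ((abs_nonneg _).trans hh.abs_le)

theorem exists_forall_abs_divIn_one_le (hφ : φ ∈ atlas E6 M) {K : Set E6} (hK : IsCompact K)
    (hKφ : K ⊆ φ.target) : ∃ C, ∀ y ∈ K, ∀ (ε : ℝ) (h : E6 → ℝ), ContDiffAt ℝ 2 h y →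
      IsC2LeAt ε h y → |divIn g φ (fun _ => 1) h y| ≤ C * ε := by
  have continuousOn_coefficient (i j : Fin 6) : ContinuousOn (fun y => (gDensity g φ y)⁻¹ *
      pd i (fun z => gDensity g φ z * (gMat g φ z)⁻¹ i j) y) φ.target :=
    ((contDiffOn_gDensity g hφ).continuousOn.inv₀ fun y hy => (gDensity_pos g hφ hy).ne').mul
      ((((contDiffOn_gDensity g hφ).mul
        (contDiffOn_gMat_inv g hφ i j)).continuousOn_fderiv_of_isOpen φ.open_target
          (by simp)).clm_apply continuousOn_const)
  choose B₁ hB₁ using fun i j =>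
    hK.exists_bound_of_continuousOn ((continuousOn_coefficient i j).mono hKφ)
  choose B₂ hB₂ using fun i j =>
    hK.exists_bound_of_continuousOn ((contDiffOn_gMat_inv g hφ i j).continuousOn.mono hKφ)
  refine ⟨∑ i, ∑ j, B₁ i j + ∑ i, ∑ j, B₂ i j, fun y hy ε h hd hh => ?_⟩
  rw [divIn_one_eq g hφ (hKφ hy) hd, add_mul]
  exact (abs_add_le _ _).trans (add_le_add
    (abs_sum_sum_mul_le (fun i j => hB₁ i j y hy) fun _ j => hh.abs_pd_le j)
    (abs_sum_sum_mul_le (fun i j => hB₂ i j y hy) hh.abs_pd_pd_le))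

/-- The function `h` is `C²`-small at the point `x`, as measured by the invariant quantities `h`,
`Δh` and `|∇h|²`. -/
structure IsC2Small (δ : ℝ) (h : M → ℝ) (x : M) : Prop where
  abs_le : |h x| ≤ δ
  abs_laplace_le : |laplace g h x| ≤ δ
  gradDot_le : gradDot g h h x ≤ δ

theorem exists_forall_isC2Small (hφ : φ ∈ atlas E6 M) {K : Set E6} (hK : IsCompact K)
    (hKφ : K ⊆ φ.target) (hδ : 0 < δ) : ∃ ε, 0 < ε ∧ ∀ y ∈ K, ∀ h : M → ℝ,
      ContDiffAt ℝ 2 (fun z => h (φ.symm z)) y → IsC2LeAt ε (fun z => h (φ.symm z)) y →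
      IsC2Small g δ h (φ.symm y) := by
  obtain ⟨C₁, hC₁⟩ := exists_forall_abs_gradIn_le g hφ hK hKφ
  obtain ⟨C₂, hC₂⟩ := exists_forall_abs_divIn_one_le g hφ hK hKφ
  have eventually_le {p : ℝ → ℝ} (hp : Continuous p) (hp0 : p 0 = 0) :
      ∀ᶠ ε in 𝓝[>] (0 : ℝ), p ε ≤ δ :=
    nhdsWithin_le_nhds ((hp.tendsto' 0 0 hp0).eventually_le_const hδ)
  obtain ⟨ε, ⟨⟨le_δ, grad_le⟩, div_le⟩, hε⟩ :=
    (((eventually_le continuous_id rfl).and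
      (eventually_le (p := fun ε => C₁ * ε ^ 2) (by fun_prop) (by simp))).and
      (eventually_le (p := fun ε => C₂ * ε) (by fun_prop) (by simp))).and
      self_mem_nhdsWithin |>.exists
  refine ⟨ε, hε, fun y hy h hd hh => ⟨hh.abs_le.trans le_δ, ?_, ?_⟩⟩
  · rw [laplace, divGrad_symm g hφ (hKφ hy) (differentiableAt_const _) hd]
    exact (hC₂ y hy ε _ hd hh).trans div_le
  · have hd₁ := hd.differentiableAt two_ne_zero
    rw [gradDot_symm g hφ (hKφ hy) hd₁ hd₁]
    exact (le_abs_self _).trans ((hC₁ y hy ε _ hh).trans grad_le)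

variable [T2Space M] [CompactSpace M]

theorem eventually_forall_isC2Small_symm (hs : 5 < s) (hf₀ : MemHs s f₀) (hφ : φ ∈ atlas E6 M)
    {K : Set E6} (hK : IsCompact K) (hKφ : K ⊆ φ.target) (hδ : 0 < δ) :
    ∀ᶠ f in hsNhds s f₀, ∀ y ∈ K, IsC2Small g δ (fun x => f x - f₀ x) (φ.symm y) := by
  obtain ⟨ε, hε, isC2Small⟩ := exists_forall_isC2Small g hφ hK hKφ hδ
  obtain ⟨η, hη, η_eq_one⟩ := IsTest.exists_eventually_eq_one φ.open_target hK hKφ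
  obtain ⟨χ, hχ, hχη⟩ := hη.exists_cutoff hφ
  obtain ⟨r, isC2LeAt, hr⟩ :=
    ((eventually_forall_isC2LeAt_of_hsNorm_lt hs hε).filter_mono nhdsWithin_le_nhds |>.and
      (self_mem_nhdsWithin (s := Ioi 0))).exists
  filter_upwards [eventually_memHs s f₀, eventually_locNorm_lt s f₀ hφ hχ hr]
    with f hf norm_lt y hy
  have hsub := hf.sub hf₀
  rw [locNorm_eq_hsNorm_indicator_mul, hχη] at norm_lt
  exact isC2Small y hy _ (hsub.contDiffAt_two hs hφ (hKφ hy))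
    (isC2LeAt φ.target η _ φ.open_target hη (memHs_iff.1 hsub φ hφ) norm_lt y
      (eventually_nhdsSet_iff_forall.1 η_eq_one y hy))

theorem eventually_forall_isC2Small (hs : 5 < s) (hf₀ : MemHs s f₀) (hδ : 0 < δ) :
    ∀ᶠ f in hsNhds s f₀, ∀ x, IsC2Small g δ (fun z => f z - f₀ z) x := by
  suffices ∀ᶠ f in hsNhds s f₀, ∀ x ∈ univ, IsC2Small g δ (fun z => f z - f₀ z) x by
    simpa only [mem_univ, forall_const] using this
  refine isCompact_univ.induction_on
    (p := fun S => ∀ᶠ f in hsNhds s f₀, ∀ x ∈ S, IsC2Small g δ (fun z => f z - f₀ z) x)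
    (Eventually.of_forall fun _ _ h => h.elim)
    (fun S T hST hT => hT.mono fun f hf x hx => hf x (hST hx))
    (fun S T hS hT => (hS.and hT).mono fun f hf x hx => hx.elim (hf.1 x) (hf.2 x)) fun x _ => ?_
  have hx := mem_chart_source E6 x
  obtain ⟨K, hK, hxK, hKφ⟩ :=
    exists_compact_subset (chartAt E6 x).open_target ((chartAt E6 x).map_source hx)
  refine ⟨(chartAt E6 x).source ∩ chartAt E6 x ⁻¹' K, mem_nhdsWithin_of_mem_nhds
    (inter_mem ((chartAt E6 x).open_source.mem_nhds hx) (((chartAt E6 x).continuousAt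
      hx).preimage_mem_nhds (mem_interior_iff_mem_nhds.1 hxK))), ?_⟩
  filter_upwards [eventually_forall_isC2Small_symm g hs hf₀ (chart_mem_atlas E6 x) hK hKφ hδ]
    with f hf z hz
  simpa only [(chartAt E6 x).left_inv hz.1] using hf _ hz.2

end Neighbourhoods

/-! ### The equations of motion determine `2R - |F₁|²` and `|F₃|² - 2T` -/

section Equations

variable {M : Type*} [TopologicalSpace M] [ChartedSpace E6 M] {D : FieldData M}

theorem FieldData.IsTypeIIB.cast_q (hD : D.IsTypeIIB) : (D.q : ℝ) = 3 := by
  rw [hD.1]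
  norm_num

variable [IsManifold (𝓡 6) ∞ M] (g : Metric6 M)

theorem Form.normSq_zero {p : ℕ} (x : M) : (0 : Form M p).normSq g x = 0 := by
  have comp_zero (φ : OpenPartialHomeomorph M E6) (i : Fin p → Fin 6) (y : E6) :
      (0 : Form M p).comp φ i y = 0 := rfl
  simp [Form.normSq, comp_zero]

theorem FieldData.IsTypeIIB.sum_normSq (hD : D.IsTypeIIB) (t : ℝ) (x : M) :
    ∑ p ∈ Finset.range 7, t ^ (3 - (p : ℤ)) * (D.F p).normSq g x =
      t ^ 2 * (D.F 1).normSq g x + (D.F 3).normSq g x + t⁻¹ ^ 2 * (D.F 5).normSq g x := by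
  obtain ⟨-, h0, h2, h4, h6⟩ := hD
  simp only [Finset.sum_range_succ, Finset.sum_range_zero, h0, h2, h4, h6, Form.normSq_zero]
  norm_num

theorem FieldData.IsTypeIIB.sum_sub_mul_normSq (hD : D.IsTypeIIB) (t : ℝ) (x : M) :
    ∑ p ∈ Finset.range 7, (3 - (p : ℝ)) * t ^ (2 - (p : ℤ)) * (D.F p).normSq g x =
      2 * t * (D.F 1).normSq g x - 2 * t⁻¹ ^ 3 * (D.F 5).normSq g x := by
  obtain ⟨-, h0, h2, h4, h6⟩ := hD
  simp only [Finset.sum_range_succ, Finset.sum_range_zero, h0, h2, h4, h6, Form.normSq_zero]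
  norm_num
  ring

/-- The function which the equation of motion of `v` forces `2R - |F₁|²` to be, for the five-form
`F = F₅`. -/
def curvatureTerm (α β : ℝ) (F : Form M 5) (v u : M → ℝ) (x : M) : ℝ :=
  (5 * laplace g (fun z => u z ^ 2 * v z) x + 5 * u x ^ 2 * laplace g v x
    - 6 * v x * gradDot g u u x - u x ^ 2 * (v x)⁻¹ ^ 3 * F.normSq g x
    - 6 * (α * u x * v x ^ 2 + β * v x ^ 2)) * (u x)⁻¹ ^ 2 * (v x)⁻¹

/-- The function which the equations of motion force `|F₃|² - 2T` to be, for the five-form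
`F = F₅`: the equation of motion of `u`, in which `curvatureTerm` is substituted for
`2R - |F₁|²`. -/
def stringTerm (α β : ℝ) (F : Form M 5) (v u : M → ℝ) (x : M) : ℝ :=
  (2 * α * v x ^ 3 - 10 * u x * v x * laplace g v x - 6 * divGrad g (fun z => v z ^ 2) u x
    + u x * v x ^ 2 * curvatureTerm g α β F v u x
    - u x * (v x)⁻¹ ^ 2 * F.normSq g x) * (u x)⁻¹

variable {v u : M → ℝ} {x : M}

theorem eq_v_iff (hD : D.IsTypeIIB) (hv : 0 < v x) (hu : 0 < u x) :
    5 * laplace g (fun z => u z ^ 2 * v z) x + 5 * u x ^ 2 * laplace g v x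
      - 2 * u x ^ 2 * v x * D.R x - 6 * v x * gradDot g u u x
      + u x ^ 2 / 2 * ∑ p ∈ Finset.range 7,
          (3 - (p : ℝ)) * v x ^ (2 - (p : ℤ)) * (D.F p).normSq g x
      - ((D.q : ℝ) - 3) / 2 * u x ^ 2 * v x ^ (((D.q : ℝ) - 5) / 2) * D.T x
    = 6 * (D.α * u x * v x ^ 2 + D.β * v x ^ 2) ↔
      2 * D.R x - (D.F 1).normSq g x = curvatureTerm g D.α D.β (D.F 5) v u x := by
  rw [hD.sum_sub_mul_normSq, hD.cast_q, curvatureTerm, mul_assoc _ ((u x)⁻¹ ^ 2), inv_pow (u x),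
    ← mul_inv, ← div_eq_mul_inv, eq_div_iff (by positivity)]
  constructor <;> intro h <;> linear_combination -h

theorem eq_u_iff (hD : D.IsTypeIIB) (hu : u x ≠ 0)
    (hR : 2 * D.R x - (D.F 1).normSq g x = curvatureTerm g D.α D.β (D.F 5) v u x) :
    10 * u x * v x * laplace g v x + 6 * divGrad g (fun z => v z ^ 2) u x
      - 2 * u x * v x ^ 2 * D.R x
      + u x * ∑ p ∈ Finset.range 7, v x ^ (3 - (p : ℤ)) * (D.F p).normSq g x
      - 2 * u x * v x ^ (((D.q : ℝ) - 3) / 2) * D.T x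
    = 2 * D.α * v x ^ 3 ↔
      (D.F 3).normSq g x - 2 * D.T x = stringTerm g D.α D.β (D.F 5) v u x := by
  rw [hD.sum_normSq, hD.cast_q, sub_self, zero_div, Real.rpow_zero, stringTerm, ← hR,
    ← div_eq_mul_inv, eq_div_iff hu]
  constructor <;> intro h <;> linear_combination h

theorem isSolution_iff (hD : D.IsTypeIIB)
    (hv : ContMDiff (𝓡 6) 𝓘(ℝ, ℝ) 2 v) (hu : ContMDiff (𝓡 6) 𝓘(ℝ, ℝ) 2 u)
    (hv0 : ∀ x, 0 < v x) (hu0 : ∀ x, 0 < u x) :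
    IsSolution g D v u ↔
      (∀ x, 2 * D.R x - (D.F 1).normSq g x = curvatureTerm g D.α D.β (D.F 5) v u x) ∧
      (∀ x, (D.F 3).normSq g x - 2 * D.T x = stringTerm g D.α D.β (D.F 5) v u x) := by
  refine ⟨fun h => ?_, fun ⟨hR, hT⟩ => ⟨hv, hu, hv0, hu0,
    fun x => (eq_u_iff g hD (hu0 x).ne' (hR x)).2 (hT x),
    fun x => (eq_v_iff g hD (hv0 x) (hu0 x)).2 (hR x)⟩⟩
  have hR := fun x => (eq_v_iff g hD (hv0 x) (hu0 x)).1 (h.eq_v x)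
  exact ⟨hR, fun x => (eq_u_iff g hD (hu0 x).ne' (hR x)).1 (h.eq_u x)⟩

variable [T2Space M] [CompactSpace M] {s : ℝ} {F : Form M 5}

theorem memHs_curvatureTerm (hs : 13 < s) (α β : ℝ) (hF : F.MemHs s) (hv : MemHs s v)
    (hu : MemHs s u) (hv0 : ∀ x, v x ≠ 0) (hu0 : ∀ x, u x ≠ 0) :
    MemHs (s - 2) (curvatureTerm g α β F v u) := by
  have h3 : 3 < s - 2 := by linarith
  have hv' := hv.mono (by linarith : s - 2 ≤ s)
  have hu' := hu.mono (by linarith : s - 2 ≤ s)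
  have hv_inv := hv'.inv (by linarith) hv0
  have hu_inv := hu'.inv (by linarith) hu0
  have hv_sq := hv'.pow h3 2
  have hu_sq := hu'.pow h3 2
  have hnormSq := (hF.normSq g (by linarith)).mono (by linarith : s - 2 ≤ s)
  have hgrad := (hu.gradDot g (by linarith) hu).mono (by linarith : s - 2 ≤ s - 1)
  have hlaplace_mul := ((hu.pow (by linarith) 2).mul (by linarith) hv).laplace g (by linarith)
  have hlaplace := hv.laplace g (by linarith)
  exact ((((((hlaplace_mul.const_mul 5).add ((hu_sq.const_mul 5).mul h3 hlaplace)).sub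
    ((hv'.const_mul 6).mul h3 hgrad)).sub ((hu_sq.mul h3 (hv_inv.pow h3 3)).mul h3 hnormSq)).sub
    ((((hu'.const_mul α).mul h3 hv_sq).add (hv_sq.const_mul β)).const_mul 6)).mul h3
    (hu_inv.pow h3 2)).mul h3 hv_inv

theorem memHs_stringTerm (hs : 13 < s) (α β : ℝ) (hF : F.MemHs s) (hv : MemHs s v)
    (hu : MemHs s u) (hv0 : ∀ x, v x ≠ 0) (hu0 : ∀ x, u x ≠ 0) :
    MemHs (s - 2) (stringTerm g α β F v u) := by
  have h3 : 3 < s - 2 := by linarith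
  have hv' := hv.mono (by linarith : s - 2 ≤ s)
  have hu' := hu.mono (by linarith : s - 2 ≤ s)
  have hv_inv := hv'.inv (by linarith) hv0
  have hu_inv := hu'.inv (by linarith) hu0
  have hnormSq := (hF.normSq g (by linarith)).mono (by linarith : s - 2 ≤ s)
  have hlaplace := hv.laplace g (by linarith)
  have hdiv := (hv.pow (by linarith) 2).divGrad g (by linarith) hu
  have hcurvature := memHs_curvatureTerm g hs α β hF hv hu hv0 hu0
  exact ((((((hv'.pow h3 3).const_mul (2 * α)).sub
    (((hu'.const_mul 10).mul h3 hv').mul h3 hlaplace)).sub (hdiv.const_mul 6)).add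
    ((hu'.mul h3 (hv'.pow h3 2)).mul h3 hcurvature)).sub
    ((hu'.mul h3 (hv_inv.pow h3 2)).mul h3 hnormSq)).mul h3 hu_inv

end Equations

/-! ### Differentiation under the integral sign -/

section ParametricIntegral

theorem iteratedDeriv_two_eq {𝕜 E : Type*} [NontriviallyNormedField 𝕜] [NormedAddCommGroup E]
    [NormedSpace 𝕜 E] {f f' : 𝕜 → E} {f'' : E} {x : 𝕜}
    (hf : ∀ᶠ y in 𝓝 x, HasDerivAt f (f' y) y) (hf' : HasDerivAt f' f'' x) :
    iteratedDeriv 2 f x = f'' := by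
  have deriv_eq : deriv f =ᶠ[𝓝 x] f' := hf.mono fun _ h => h.deriv
  rw [iteratedDeriv_succ, iteratedDeriv_one, deriv_eq.deriv_eq, hf'.deriv]

theorem isOpen_setOf_forall_add_ne_zero {A X : Type*} [AddGroup A] [TopologicalSpace A]
    [IsTopologicalAddGroup A] [T2Space A] [TopologicalSpace X] [CompactSpace X] {v : X → A}
    (hv : Continuous v) : IsOpen {t : A | ∀ x, v x + t ≠ 0} := by
  have : {t : A | ∀ x, v x + t ≠ 0} = (range fun x => -v x)ᶜ := by
    ext t
    simp [neg_eq_iff_add_eq_zero]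
  rw [this]
  exact (isCompact_range hv.neg).isClosed.isOpen_compl

variable {𝕜 X : Type*} [RCLike 𝕜] [TopologicalSpace X] [CompactSpace X] [MeasurableSpace X]
  [OpensMeasurableSpace X] (μ : Measure X) [IsFiniteMeasure μ]

theorem hasDerivAt_integral_of_continuousOn {E : Type*} [NormedAddCommGroup E] [NormedSpace ℝ E]
    [NormedSpace 𝕜 E] {F F' : 𝕜 → X → E} {U : Set 𝕜} (hU : IsOpen U)
    (hF : ∀ t ∈ U, Continuous (F t)) (hF' : ContinuousOn (fun p : 𝕜 × X => F' p.1 p.2) (U ×ˢ univ))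
    (hd : ∀ t ∈ U, ∀ x, HasDerivAt (fun t => F t x) (F' t x) t) {t : 𝕜} (ht : t ∈ U) :
    HasDerivAt (fun t => ∫ x, F t x ∂μ) (∫ x, F' t x ∂μ) t := by
  obtain ⟨K, hK, htK, hKU⟩ := exists_compact_subset hU ht
  obtain ⟨B, hB⟩ := (hK.prod isCompact_univ).exists_bound_of_continuousOn
    (hF'.mono (prod_mono_left hKU))
  have continuous_F' : Continuous (F' t) :=
    hF'.comp_continuous (f := fun x => (t, x)) (by fun_prop) fun x => ⟨ht, mem_univ x⟩
  refine (hasDerivAt_integral_of_dominated_loc_of_deriv_le (bound := fun _ => B)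
    (mem_interior_iff_mem_nhds.1 htK) ?_
    ((hF t ht).integrable_of_hasCompactSupport (.of_compactSpace _))
    continuous_F'.aestronglyMeasurable_of_compactSpace ?_ (integrable_const B) ?_).2
  · filter_upwards [hU.mem_nhds ht] with t ht
    exact (hF t ht).aestronglyMeasurable_of_compactSpace
  · exact .of_forall fun x t ht => hB (t, x) ⟨ht, mem_univ x⟩
  · exact .of_forall fun x t ht => hd t (hKU ht) x

variable {ι : Type*} (S : Finset ι) (e : ι → ℤ) {c : ι → X → 𝕜} {v : X → 𝕜}

theorem hasDerivAt_integral_sum_zpow (hc : ∀ i, Continuous (c i)) (hv : Continuous v) {t : 𝕜}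
    (ht : ∀ x, v x + t ≠ 0) :
    HasDerivAt (fun t => ∫ x, ∑ i ∈ S, c i x * (v x + t) ^ e i ∂μ)
      (∫ x, ∑ i ∈ S, e i * c i x * (v x + t) ^ (e i - 1) ∂μ) t := by
  refine hasDerivAt_integral_of_continuousOn μ
    (F' := fun t x => ∑ i ∈ S, e i * c i x * (v x + t) ^ (e i - 1))
    (isOpen_setOf_forall_add_ne_zero hv) (fun t ht => ?_) ?_ (fun t ht x => ?_) ht
  · exact continuous_finsetSum S fun i _ => (hc i).mul
      ((hv.add_const t).zpow₀ (e i) fun x => .inl (ht x))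
  · refine continuousOn_finsetSum S fun i _ => ContinuousOn.mul (by fun_prop) ?_
    exact ContinuousOn.zpow₀ (by fun_prop) _ fun p hp => .inl (hp.1 p.2)
  · refine HasDerivAt.fun_sum fun i _ => ?_
    refine (((hasDerivAt_zpow (e i) (v x + t) (.inl (ht x))).comp_const_add (v x) t).const_mul
      (c i x)).congr_deriv ?_
    ring

theorem iteratedDeriv_two_integral_sum_zpow (hc : ∀ i, Continuous (c i)) (hv : Continuous v)
    (hv0 : ∀ x, v x ≠ 0) :
    iteratedDeriv 2 (fun t => ∫ x, ∑ i ∈ S, c i x * (v x + t) ^ e i ∂μ) 0 =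
      ∫ x, ∑ i ∈ S, ((e i - 1 : ℤ) : 𝕜) * (e i * c i x) * v x ^ (e i - 1 - 1) ∂μ := by
  have add_zero_ne (x : X) : v x + 0 ≠ 0 := by simpa only [add_zero] using hv0 x
  have hderiv := hasDerivAt_integral_sum_zpow μ S (fun i => e i - 1)
    (fun i => (hc i).const_mul (e i : 𝕜)) hv add_zero_ne
  simp only [add_zero] at hderiv
  refine iteratedDeriv_two_eq ?_ hderiv
  filter_upwards [(isOpen_setOf_forall_add_ne_zero hv).mem_nhds add_zero_ne] with t ht
  exact hasDerivAt_integral_sum_zpow μ S e hc hv ht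

end ParametricIntegral

/-! ### The second variation of the effective potential -/

section AddConst

variable {M : Type*} [TopologicalSpace M] [ChartedSpace E6 M] [IsManifold (𝓡 6) ∞ M]
  (g : Metric6 M)

theorem pd_add_const (i : Fin 6) (f : E6 → ℝ) (c : ℝ) : pd i (fun y => f y + c) = pd i f := by
  ext y
  simp only [pd, fderiv_add_const]

theorem gradDot_add_const_left (f h : M → ℝ) (c : ℝ) :
    gradDot g (fun z => f z + c) h = gradDot g f h := by
  ext x
  simp only [gradDot, pd_add_const]

theorem gradDot_add_const_right (f h : M → ℝ) (c : ℝ) :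
    gradDot g f (fun z => h z + c) = gradDot g f h := by
  ext x
  simp only [gradDot, pd_add_const]

theorem laplace_add_const (f : M → ℝ) (c : ℝ) :
    laplace g (fun z => f z + c) = laplace g f := by
  ext x
  simp only [laplace, divGrad, pd_add_const]

end AddConst

section SecondVariation

variable {M : Type*} [TopologicalSpace M] [ChartedSpace E6 M] [IsManifold (𝓡 6) ∞ M]
  (g : Metric6 M) (D : FieldData M) (v u : M → ℝ)

/-- The integrand of the first integral in the definition of `Veff`. -/
def actionDensity (x : M) : ℝ :=
  -(u x ^ 2 * v x ^ 2 * D.R x)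
    - 5 * gradDot g v (fun z => u z ^ 2 * v z) x
    - 3 * v x ^ 2 * gradDot g u u x
    + u x ^ 2 / 2 * ∑ p ∈ Finset.range 7, v x ^ (3 - (p : ℤ)) * (D.F p).normSq g x
    - u x ^ 2 * v x ^ (((D.q : ℝ) - 3) / 2) * D.T x

/-- The exponents of the density of `V_eff(v + t, u)` as a Laurent polynomial in `v + t`. -/
def potentialExponent : Fin 5 → ℤ := ![-2, 0, 1, 2, 3]

/-- The coefficients, in the order of `potentialExponent`, of the density of `V_eff(v + t, u)` as a
Laurent polynomial in `v + t`. -/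
def potentialCoeff : Fin 5 → M → ℝ :=
  ![fun x => u x ^ 2 * (D.F 5).normSq g x / 4,
    fun x => u x ^ 2 * ((D.F 3).normSq g x - 2 * D.T x) / 4 - 5 / 2 * (u x ^ 2 * gradDot g v v x),
    fun x => -(5 / 2 * gradDot g v (fun z => u z ^ 2) x),
    fun x => -(u x ^ 2 * (2 * D.R x - (D.F 1).normSq g x) / 4) - 3 / 2 * gradDot g u u x,
    fun x => -(D.α * u x + D.β)]

/-- The density of the mass squared: the second `t`-derivative, at `t = 0`, of the density of
`V_eff(v + t, u)`. -/
def massDensity (x : M) : ℝ :=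
  3 / 2 * (u x ^ 2 * (v x)⁻¹ ^ 4 * (D.F 5).normSq g x)
    - u x ^ 2 * (2 * D.R x - (D.F 1).normSq g x) / 2 - 3 * gradDot g u u x
    - 6 * (D.α * u x + D.β) * v x

variable {D v u}

theorem sum_potentialCoeff_second_deriv (x : M) :
    ∑ i, ((potentialExponent i - 1 : ℤ) : ℝ) * (potentialExponent i * potentialCoeff g D v u i x) *
      v x ^ (potentialExponent i - 1 - 1) = massDensity g D v u x := by
  simp only [potentialExponent, potentialCoeff, massDensity, Fin.sum_univ_five, Matrix.cons_val]
  norm_num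
  ring

variable [T2Space M] [CompactSpace M] {s : ℝ}

theorem actionDensity_add_const (hD : D.IsTypeIIB) (hs : 5 < s) (hv : MemHs s v) (hu : MemHs s u)
    (t : ℝ) (x : M) :
    1 / 2 * actionDensity g D (fun z => v z + t) u x - (D.α * u x + D.β) * (v x + t) ^ 3 =
      ∑ i, potentialCoeff g D v u i x * (v x + t) ^ potentialExponent i := by
  have hx := (chartAt E6 x).map_source (mem_chart_source E6 x)
  have hatlas := chart_mem_atlas E6 x
  rw [actionDensity, gradDot_add_const_left,
    gradDot_mul_right g ((hu.pow (by linarith) 2).differentiableAt hs hatlas hx)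
      ((hv.add (.const t)).differentiableAt hs hatlas hx),
    gradDot_add_const_right, hD.sum_normSq, hD.cast_q, sub_self, zero_div, Real.rpow_zero]
  simp only [potentialExponent, potentialCoeff, Fin.sum_univ_five, Matrix.cons_val]
  norm_num
  ring

theorem continuous_potentialCoeff (hs : 5 < s) (hF : (D.F 5).MemHs s) (hv : MemHs s v)
    (hu : MemHs s u) (hR : Continuous fun x => 2 * D.R x - (D.F 1).normSq g x)
    (hT : Continuous fun x => (D.F 3).normSq g x - 2 * D.T x) (i : Fin 5) :
    Continuous (potentialCoeff g D v u i) := by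
  have continuous_u := hu.1
  have continuous_normSq := (hF.normSq g (by linarith)).1
  have continuous_gradDot_v := (hv.gradDot g hs hv).1
  have continuous_gradDot_u := (hu.gradDot g hs hu).1
  have continuous_gradDot_vu := (hv.gradDot g hs (hu.pow (by linarith) 2)).1
  fin_cases i <;> simp only [potentialCoeff] <;> dsimp <;> fun_prop

theorem continuous_massDensity (hs : 5 < s) (hF : (D.F 5).MemHs s) (hv : MemHs s v)
    (hu : MemHs s u) (hR : Continuous fun x => 2 * D.R x - (D.F 1).normSq g x)
    (hv0 : ∀ x, v x ≠ 0) : Continuous (massDensity g D v u) := by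
  have continuous_v := hv.1
  have continuous_u := hu.1
  have continuous_normSq := (hF.normSq g (by linarith)).1
  have continuous_gradDot_u := (hu.gradDot g hs hu).1
  unfold massDensity
  fun_prop

variable [MeasurableSpace M] [BorelSpace M]

theorem Veff_eq_integral (hv : Continuous v) (hu : Continuous u)
    (hL : Continuous (actionDensity g D v u)) :
    Veff g D v u = (D.α * (1 / D.GN) + D.β * (vol g).real univ) +
      ∫ x, (1 / 2 * actionDensity g D v u x - (D.α * u x + D.β) * v x ^ 3) ∂(vol g) := by
  have int_L := integrable_of_continuous g (hL.const_mul (1 / 2))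
  have int_α : Integrable (fun x => D.α * (u x * v x ^ 3)) (vol g) :=
    integrable_of_continuous g (by fun_prop)
  have int_β : Integrable (fun x => D.β * v x ^ 3) (vol g) :=
    integrable_of_continuous g (by fun_prop)
  have integrand_eq (x : M) : 1 / 2 * actionDensity g D v u x - (D.α * u x + D.β) * v x ^ 3 =
      1 / 2 * actionDensity g D v u x - (D.α * (u x * v x ^ 3) + D.β * v x ^ 3) := by ring
  simp only [integrand_eq]
  rw [integral_sub int_L (int_α.fun_add int_β), integral_add int_α int_β, integral_const_mul,
    integral_const_mul, integral_const_mul, Veff]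
  simp only [actionDensity]
  ring

theorem Veff_add_const (hD : D.IsTypeIIB) (hs : 5 < s) (hF : (D.F 5).MemHs s) (hv : MemHs s v)
    (hu : MemHs s u) (hR : Continuous fun x => 2 * D.R x - (D.F 1).normSq g x)
    (hT : Continuous fun x => (D.F 3).normSq g x - 2 * D.T x) {t : ℝ} (ht : ∀ x, v x + t ≠ 0) :
    Veff g D (fun x => v x + t) u = (D.α * (1 / D.GN) + D.β * (vol g).real univ) +
      ∫ x, ∑ i, potentialCoeff g D v u i x * (v x + t) ^ potentialExponent i ∂(vol g) := by
  have continuous_v := hv.1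
  have continuous_u := hu.1
  have continuous_sum : Continuous fun x =>
      ∑ i, potentialCoeff g D v u i x * (v x + t) ^ potentialExponent i :=
    continuous_finsetSum _ fun i _ => (continuous_potentialCoeff g hs hF hv hu hR hT i).mul
      ((continuous_v.add_const t).zpow₀ _ fun x => .inl (ht x))
  have actionDensity_eq : actionDensity g D (fun z => v z + t) u = fun x =>
      2 * (∑ i, potentialCoeff g D v u i x * (v x + t) ^ potentialExponent i +
        (D.α * u x + D.β) * (v x + t) ^ 3) := by
    ext x
    linear_combination 2 * actionDensity_add_const g hD hs hv hu t x
  rw [Veff_eq_integral g (by fun_prop) continuous_u (actionDensity_eq ▸ by fun_prop)]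
  simp only [actionDensity_add_const g hD hs hv hu]

theorem massSq_eq_integral (hD : D.IsTypeIIB) (hs : 5 < s) (hF : (D.F 5).MemHs s)
    (hv : MemHs s v) (hu : MemHs s u) (hR : Continuous fun x => 2 * D.R x - (D.F 1).normSq g x)
    (hT : Continuous fun x => (D.F 3).normSq g x - 2 * D.T x) (hv0 : ∀ x, v x ≠ 0) :
    massSq g D v u = ∫ x, massDensity g D v u x ∂(vol g) := by
  have Veff_eq : (fun t => Veff g D (fun x => v x + t * 1) u) =ᶠ[𝓝 0] fun t =>
      (D.α * (1 / D.GN) + D.β * (vol g).real univ) +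
        ∫ x, ∑ i, potentialCoeff g D v u i x * (v x + t) ^ potentialExponent i ∂(vol g) := by
    filter_upwards [(isOpen_setOf_forall_add_ne_zero hv.1).mem_nhds
      (by simpa only [mem_ofPred_eq, add_zero] using hv0)] with t ht
    simpa only [mul_one] using Veff_add_const g hD hs hF hv hu hR hT ht
  rw [massSq, secondVariation, Veff_eq.iteratedDeriv_eq, iteratedDeriv_const_add two_pos,
    iteratedDeriv_two_integral_sum_zpow (vol g) _ _
      (continuous_potentialCoeff g hs hF hv hu hR hT) hv.1 hv0]
  simp only [sum_potentialCoeff_second_deriv]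

end SecondVariation

/-! ### Stability -/

section Stability

theorem two_mul_dotProduct_mulVec_le {n : Type*} [Fintype n] {A : Matrix n n ℝ}
    (hA : A.PosSemidef) (p q : n → ℝ) :
    2 * (p ⬝ᵥ A *ᵥ q) ≤ p ⬝ᵥ A *ᵥ p + q ⬝ᵥ A *ᵥ q := by
  have nonneg := hA.dotProduct_mulVec_nonneg (p - q)
  have comm : q ⬝ᵥ A *ᵥ p = p ⬝ᵥ A *ᵥ q := by
    rw [Matrix.dotProduct_mulVec, ← Matrix.mulVec_transpose, dotProduct_comm,
      ← Matrix.conjTranspose_eq_transpose_of_trivial, hA.isHermitian.eq]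
  simp only [star_trivial, Matrix.mulVec_sub, dotProduct_sub, sub_dotProduct, comm] at nonneg
  linarith

variable {M : Type*} [TopologicalSpace M] [ChartedSpace E6 M]

theorem eventually_form_memHs (p : ℕ) (s : ℝ) : ∀ᶠ F in formNhdsZero M p s, F.MemHs s :=
  mem_inf_of_right (mem_principal_self _)

variable [IsManifold (𝓡 6) ∞ M] (g : Metric6 M)

theorem two_mul_gradDot_le (f h : M → ℝ) (x : M) :
    2 * gradDot g f h x ≤ gradDot g f f x + gradDot g h h x := by
  have posDef := gMat_posDef g (chart_mem_atlas E6 x)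
    ((chartAt E6 x).map_source (mem_chart_source E6 x))
  have gradDot_eq (f h : M → ℝ) : gradDot g f h x =
    gradIn g (chartAt E6 x) (fun y => f ((chartAt E6 x).symm y))
      (fun y => h ((chartAt E6 x).symm y)) (chartAt E6 x x) := rfl
  simp only [gradDot_eq, gradIn_eq_dotProduct]
  exact two_mul_dotProduct_mulVec_le posDef.inv.posSemidef _ _

theorem laplace_sq_mul {v u : M → ℝ} {x : M}
    (hv : ContDiffAt ℝ 2 (fun y => v ((chartAt E6 x).symm y)) (chartAt E6 x x))
    (hu : ContDiffAt ℝ 2 (fun y => u ((chartAt E6 x).symm y)) (chartAt E6 x x)) :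
    laplace g (fun z => u z ^ 2 * v z) x =
      u x ^ 2 * laplace g v x + v x * (2 * u x * laplace g u x + 2 * gradDot g u u x) +
        4 * u x * gradDot g u v x := by
  have sq_mul_eq : (fun z => u z ^ 2 * v z) = fun z => u z * (u z * v z) := by
    ext z
    ring
  rw [sq_mul_eq, laplace_mul g (h := fun z => u z * v z) hu (hu.mul hv), laplace_mul g hu hv,
    gradDot_mul_right g (hu.differentiableAt two_ne_zero) (hv.differentiableAt two_ne_zero)]
  ring

variable {D : FieldData M} {v u : M → ℝ} {x : M}

theorem massDensity_eq (hv : v x ≠ 0) (hu : u x ≠ 0)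
    (hR : 2 * D.R x - (D.F 1).normSq g x = curvatureTerm g D.α D.β (D.F 5) v u x) :
    massDensity g D v u x =
      2 * u x ^ 2 * (v x)⁻¹ ^ 4 * (D.F 5).normSq g x - 3 * v x * (D.α * u x + D.β)
      - 5 / 2 * (laplace g (fun z => u z ^ 2 * v z) x + u x ^ 2 * laplace g v x) / v x := by
  rw [massDensity, hR, curvatureTerm]
  field_simp
  ring

section NearOne

variable {δ : ℝ}

theorem IsC2Small.mem_Icc {f : M → ℝ} {c : ℝ} (hf : IsC2Small g δ (fun z => f z - c) x) :
    f x ∈ Icc (c - δ) (c + δ) := by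
  have := abs_sub_le_iff.1 hf.abs_le
  constructor <;> linarith

theorem laplace_terms_le (hδ : δ ≤ 1 / 4)
    (hvC : ContDiffAt ℝ 2 (fun y => v ((chartAt E6 x).symm y)) (chartAt E6 x x))
    (huC : ContDiffAt ℝ 2 (fun y => u ((chartAt E6 x).symm y)) (chartAt E6 x x))
    (hv : IsC2Small g δ (fun z => v z - 1) x) (hu : IsC2Small g δ (fun z => u z - 1) x) :
    5 / 2 * (laplace g (fun z => u z ^ 2 * v z) x + u x ^ 2 * laplace g v x) / v x ≤ 60 * δ := by
  obtain ⟨v_ge, v_le⟩ := hv.mem_Icc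
  obtain ⟨u_ge, u_le⟩ := hu.mem_Icc
  obtain ⟨hδ0, hΔv, hv_grad⟩ := hv
  obtain ⟨-, hΔu, hu_grad⟩ := hu
  replace hδ0 := (abs_nonneg _).trans hδ0
  simp only [sub_eq_add_neg, laplace_add_const, gradDot_add_const_left,
    gradDot_add_const_right] at hΔv hv_grad hΔu hu_grad
  have mul_le {c k K : ℝ} (hc : c ≤ δ) (hk : 0 ≤ k) (hK : k ≤ K) : k * c ≤ K * δ :=
    (mul_le_mul_of_nonneg_left hc hk).trans (mul_le_mul_of_nonneg_right hK hδ0)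
  have hΔv_le : 2 * u x ^ 2 * laplace g v x ≤ 4 * δ :=
    mul_le ((le_abs_self _).trans hΔv) (by positivity) (by nlinarith)
  have hΔu_le : 2 * (v x * u x) * laplace g u x ≤ 4 * δ :=
    mul_le ((le_abs_self _).trans hΔu) (by nlinarith) (by nlinarith)
  have hu_grad_le : 2 * v x * gradDot g u u x ≤ 4 * δ :=
    mul_le hu_grad (by linarith) (by linarith)
  have huv_grad_le : 4 * u x * gradDot g u v x ≤ 5 * δ :=
    mul_le (by linarith [two_mul_gradDot_le g u v x]) (by linarith) (by linarith)
  rw [laplace_sq_mul g hvC huC, div_le_iff₀ (by linarith)]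
  nlinarith

theorem le_massDensity {ε : ℝ} (hδ : δ ≤ 1 / 4) (hδε : δ ≤ ε / 1000) (hα : D.α = ε / 4)
    (hβ : D.β = -(ε / 2))
    (hR : 2 * D.R x - (D.F 1).normSq g x = curvatureTerm g D.α D.β (D.F 5) v u x)
    (hvC : ContDiffAt ℝ 2 (fun y => v ((chartAt E6 x).symm y)) (chartAt E6 x x))
    (huC : ContDiffAt ℝ 2 (fun y => u ((chartAt E6 x).symm y)) (chartAt E6 x x))
    (hv : IsC2Small g δ (fun z => v z - 1) x) (hu : IsC2Small g δ (fun z => u z - 1) x) :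
    ε / 4 ≤ massDensity g D v u x := by
  obtain ⟨v_ge, v_le⟩ := hv.mem_Icc
  obtain ⟨u_ge, u_le⟩ := hu.mem_Icc
  have five_form_nonneg : 0 ≤ 2 * u x ^ 2 * (v x)⁻¹ ^ 4 * (D.F 5).normSq g x :=
    mul_nonneg (by positivity) ((D.F 5).normSq_nonneg g x)
  have multiplier_ge : 27 / 64 * ε ≤ -(3 * v x * (D.α * u x + D.β)) := by
    have : 9 / 16 ≤ v x * (2 - u x) := by nlinarith
    rw [hα, hβ]
    nlinarith
  rw [massDensity_eq g (by linarith) (by linarith) hR]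
  linarith [laplace_terms_le g hδ hvC huC hv hu]

end NearOne

variable [T2Space M] [CompactSpace M] [MeasurableSpace M] [BorelSpace M]

theorem integral_pos_of_forall_le [Nonempty M] {f : M → ℝ} (hf : Continuous f) {c : ℝ}
    (hc : 0 < c) (hcf : ∀ x, c ≤ f x) : 0 < ∫ x, f x ∂(vol g) := by
  calc 0 < ∫ _, c ∂(vol g) := by
        rw [integral_const, smul_eq_mul]
        exact mul_pos (ENNReal.toReal_pos (vol_univ_pos g).ne' (measure_ne_top _ _)) hc
    _ ≤ _ := integral_mono (integrable_const c) (integrable_of_continuous g hf) hcf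

theorem massSq_pos [Nonempty M] (hD : D.IsTypeIIB) {s : ℝ} (hs : 13 < s) {ε δ : ℝ} (hε : 0 < ε)
    (hδ : δ ≤ 1 / 4) (hδε : δ ≤ ε / 1000) (hα : D.α = ε / 4) (hβ : D.β = -(ε / 2))
    (hF : (D.F 5).MemHs s) (hv : MemHs s v) (hu : MemHs s u)
    (hv1 : ∀ x, IsC2Small g δ (fun z => v z - 1) x) (hu1 : ∀ x, IsC2Small g δ (fun z => u z - 1) x)
    (hR : ∀ x, 2 * D.R x - (D.F 1).normSq g x = curvatureTerm g D.α D.β (D.F 5) v u x)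
    (hT : ∀ x, (D.F 3).normSq g x - 2 * D.T x = stringTerm g D.α D.β (D.F 5) v u x) :
    0 < massSq g D v u := by
  have hs5 : 5 < s := by linarith
  have hv0 (x : M) : v x ≠ 0 := by linarith [(hv1 x).mem_Icc.1]
  have hu0 (x : M) : u x ≠ 0 := by linarith [(hu1 x).mem_Icc.1]
  have hRc : Continuous fun x => 2 * D.R x - (D.F 1).normSq g x := by
    simpa only [hR] using (memHs_curvatureTerm g hs D.α D.β hF hv hu hv0 hu0).1
  have hTc : Continuous fun x => (D.F 3).normSq g x - 2 * D.T x := by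
    simpa only [hT] using (memHs_stringTerm g hs D.α D.β hF hv hu hv0 hu0).1
  rw [massSq_eq_integral g hD hs5 hF hv hu hRc hTc hv0]
  refine integral_pos_of_forall_le g (continuous_massDensity g hs5 hF hv hu hRc hv0)
    (c := ε / 4) (by positivity) fun x => ?_
  have hx := (chartAt E6 x).map_source (mem_chart_source E6 x)
  exact le_massDensity g hδ hδε hα hβ (hR x) (hv.contDiffAt_two hs5 (chart_mem_atlas E6 x) hx)
    (hu.contDiffAt_two hs5 (chart_mem_atlas E6 x) hx) (hv1 x) (hu1 x)

end Stability

end Warped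

end

theorem mainTheorem8 {M : Type*} [TopologicalSpace M] [ChartedSpace Warped.E6 M]
    [IsManifold (𝓡 6) ∞ M] [T2Space M] [CompactSpace M] [Nonempty M]
    [MeasurableSpace M] [BorelSpace M] (g : Warped.Metric6 M) :
    ∃ s₀ : ℝ, ∀ s : ℝ, s₀ ≤ s → ∀ ε : ℝ, 0 < ε →
      ∃ α β : ℝ, 0 < α ∧ α < ε ∧ -ε < β ∧ β < 0 ∧
        ∀ᶠ w : Warped.Form M 5 × (M → ℝ) × (M → ℝ) in
            Warped.formNhdsZero M 5 s ×ˢ (Warped.hsNhds s (fun _ => 1) ×ˢ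
              Warped.hsNhds s (fun _ => 1)),
          ∃ a b : M → ℝ, Warped.MemHs (s - 2) a ∧ Warped.MemHs (s - 2) b ∧
            ∀ D : Warped.FieldData M, D.IsTypeIIB → D.α = α → D.β = β → D.F 5 = w.1 →
              (Warped.IsSolution g D w.2.1 w.2.2 ↔
                (∀ x, 2 * D.R x - (D.F 1).normSq g x = a x) ∧
                (∀ x, (D.F 3).normSq g x - 2 * D.T x = b x)) ∧
              (Warped.IsSolution g D w.2.1 w.2.2 → Warped.IsStable g D w.2.1 w.2.2) := by
  refine ⟨20, fun s hs ε hε => ⟨ε / 4, -(ε / 2), by positivity, by linarith, by linarith,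
    by linarith, ?_⟩⟩
  have hs5 : 5 < s := by linarith
  have hs13 : 13 < s := by linarith
  have hδ : 0 < min (1 / 4) (ε / 1000) := lt_min (by norm_num) (by positivity)
  have near_one : ∀ᶠ f in Warped.hsNhds (M := M) s (fun _ => 1), Warped.MemHs s f ∧
      ∀ x, Warped.IsC2Small g (min (1 / 4) (ε / 1000)) (fun z => f z - 1) x :=
    (Warped.eventually_memHs s _).and
      (Warped.eventually_forall_isC2Small g hs5 (Warped.MemHs.const 1) hδ)
  filter_upwards [(Warped.eventually_form_memHs 5 s).prod_mk (near_one.prod_mk near_one)]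
  rintro ⟨F, v, u⟩ ⟨hF, ⟨hv, hv1⟩, hu, hu1⟩
  have hδ4 := min_le_left (1 / 4) (ε / 1000)
  have v_pos (x : M) : 0 < v x := by linarith [(hv1 x).mem_Icc.1]
  have u_pos (x : M) : 0 < u x := by linarith [(hu1 x).mem_Icc.1]
  refine ⟨_, _, Warped.memHs_curvatureTerm g hs13 (ε / 4) (-(ε / 2)) hF hv hu
    (fun x => (v_pos x).ne') (fun x => (u_pos x).ne'), Warped.memHs_stringTerm g hs13 (ε / 4)
    (-(ε / 2)) hF hv hu (fun x => (v_pos x).ne') (fun x => (u_pos x).ne'),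
    fun D hD hα hβ hDF => ?_⟩
  have hsol := Warped.isSolution_iff g hD (hv.contMDiff (n := 2) (by norm_num; linarith))
    (hu.contMDiff (n := 2) (by norm_num; linarith)) v_pos u_pos
  rw [← hα, ← hβ, ← hDF]
  exact ⟨hsol, fun h => ⟨h, Warped.massSq_pos g hD hs13 hε hδ4 (min_le_right _ _) hα hβ
    (hDF ▸ hF) hv hu hv1 hu1 (hsol.1 h).1 (hsol.1 h).2⟩⟩
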